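/- **Quadratic equivalent for the conjugate kernel in the proportional limit.** *Setting.* Let $n,d,N\to\infty$ along a sequence with $n/N\to\phi\in(0,\infty)$ and $n/d\to\psi\in(0,\infty)$, where $4\mid n$ and $2\mid d$, and let $r=r_n\ge 0$ be deterministic with $r=O(n^{1/4})$. Let $\sigma:\mathbb R\to\mathbb R$ be three times differentiable with $|\sigma'|,|\sigma''|,|\sigma'''|\le\lambda_\sigma<\infty$ and, for $\xi\sim\mathcal N(0,1)$, $\mathbb E[\sigma(\xi)]=0$, $\mathbb E[\sigma(\xi)^2]=1$; put $b_\sigma=\mathbb E[\sigma'(\xi)]$ and $c_\sigma=\mathbb E[\sigma''(\xi)]$. Let $W\in\mathbb R^{N\times d}$ have i.i.d. $\mathcal N(0,1)$ entries and $Z\in\mathbb R^{d\times n}$ i.i.d. $\mathcal N(0,1/d)$ entries, independent of $W$. Let $$u_1=\tfrac1{\sqrt d}\begin{bmatrix}\mathbf 1_{d/2}\\-\mathbf 1_{d/2}\end{bmatrix},\quad u_2=\tfrac1{\sqrt d}\mathbf 1_d,\quad v_1=\sqrt{\tfrac2n}\begin{bmatrix}\mathbf 1_{n/4}\\-\mathbf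 1_{n/4}\\\mathbf 0_{n/2}\end{bmatrix},\quad v_2=\sqrt{\tfrac2n}\begin{bmatrix}\mathbf 0_{n/2}\\\mathbf 1_{n/4}\\-\mathbf 1_{n/4}\end{bmatrix},$$ $\theta=r\sqrt{n/(2d)}$, $M=\theta(u_1v_1^\top+u_2v_2^\top)$, $X=M+Z$ (the XOR data), $g_\ell=Wu_\ell$, and $$Y=\tfrac1{\sqrt N}\sigma(WX),\qquad Y_{\rm QE}=\tfrac1{\sqrt N}\sigma(WZ)+\tfrac{\theta b_\sigma}{\sqrt N}\big(g_1v_1^\top+g_2v_2^\top\big)+\tfrac{\theta^2c_\sigma}{2\sqrt N}\big(g_1^{\odot2}(v_1^{\odot2})^\top+g_2^{\odot2}(v_2^{\odot2})^\top\big),$$ with $\sigma$ and $\odot$ acting entrywise, $K=Y^\top Y$, $K_{\rm QE}=Y_{\rm QE}^\top Y_{\rm QE}$. Write $\|\cdot\|$ for the operator norm. For random variables $A_n$, deterministic $B_n\ge0$ and events $E_n$, "$A_n\prec B_n$ on $E_n$" means: for all $\epsilon,D>0$ and all large $n$, $\mathbb P(E_n,\ A_n\ge n^{\epsilon}B_n)\le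 n^{-D}$; $A_n\prec B_n$ is the case where $E_n$ is the whole space. *Claim.* (i) $\|Y-Y_{\rm QE}\|\prec n^{-1/4}$; in particular $\|Y-Y_{\rm QE}\|\to0$ in probability. (ii) Suppose that $\|Y\|,\|Y_{\rm QE}\|\lesssim1$, in the sense that both are bounded in probability or that both are $\prec1$. Then $\|K-K_{\rm QE}\|\prec n^{-1/4}$, and $K$ and $K_{\rm QE}$ have asymptotically matching (outlier) eigenvalues and eigenvector alignments: * the ordered eigenvalues satisfy $\max_{i\le n}|\lambda_i(K)-\lambda_i(K_{\rm QE})|\prec n^{-1/4}$; * for all $\delta>0$ and all deterministic sequences $a_n,b_n$, let $E_n$ be the event that for $K$ or for $K_{\rm QE}$ every eigenvalue has distance at least $\delta$ from $a_n$ and from $b_n$, and let $P_n$, $P_n^{\rm QE}$ be the spectral projectors of $K$, $K_{\rm QE}$ onto their eigenvalues in $[a_n,b_n]$. Then: for every $D>0$ and all large $n$, the probability that $E_n$ holds and $K$, $K_{\rm QE}$ have different numbers of eigenvalues in $[a_n,b_n]$ (with multiplicity) is at most $n^{-D}$; $\|P_n-P_n^{\rm QE}\|\prec n^{-1/4}$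 on $E_n$; and $|x_n^\top P_nx_n-x_n^\top P_n^{\rm QE}x_n|\prec n^{-1/4}$ on $E_n$ for all deterministic vectors $x_n\in\mathbb R^n$ with $\|x_n\|\le1$. -/

import Mathlib

open MeasureTheory ProbabilityTheory Filter Topology Matrix

open scoped NNReal Asymptotics

noncomputable section

/-- The assumption on the activation: `σ` is three times differentiable, its first three
derivatives are bounded by `L`, and it is centered and normalized under the standard Gaussian. -/
structure ActivationAssumption (σ : ℝ → ℝ) (L : ℝ) : Prop where
  diff_zero : Differentiable ℝ σ
  diff_one : Differentiable ℝ (deriv σ)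
  diff_two : Differentiable ℝ (deriv (deriv σ))
  pos : 0 < L
  bound_one : ∀ x, |deriv σ x| ≤ L
  bound_two : ∀ x, |deriv (deriv σ) x| ≤ L
  bound_three : ∀ x, |deriv (deriv (deriv σ)) x| ≤ L
  centered : ∫ x, σ x ∂(gaussianReal 0 1) = 0
  normalized : ∫ x, σ x ^ 2 ∂(gaussianReal 0 1) = 1

/-- The first Hermite coefficient `b_σ = E[σ'(ξ)]`, `ξ ∼ N(0,1)`. -/
def bCoeff (σ : ℝ → ℝ) : ℝ := ∫ x, deriv σ x ∂(gaussianReal 0 1)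

/-- The second Hermite coefficient `c_σ = E[σ''(ξ)]`, `ξ ∼ N(0,1)`. -/
def cCoeff (σ : ℝ → ℝ) : ℝ := ∫ x, deriv (deriv σ) x ∂(gaussianReal 0 1)

/-- The proportional limit: `n, d, N → ∞` with `n / N → φ` and `n / d → ψ`, both limits being
positive and finite. -/
structure ProportionalLimit (n d N : ℕ → ℕ) (φ ψ : ℝ) : Prop where
  n_top : Tendsto n atTop atTop
  d_top : Tendsto d atTop atTop
  N_top : Tendsto N atTop atTop
  phi_pos : 0 < φ
  psi_pos : 0 < ψ
  lim_phi : Tendsto (fun k => (n k : ℝ) / (N k : ℝ)) atTop (𝓝 φ)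
  lim_psi : Tendsto (fun k => (n k : ℝ) / (d k : ℝ)) atTop (𝓝 ψ)

/-- `W` has i.i.d. `N(0,1)` entries, `Z` has i.i.d. `N(0,1/d)` entries, and `W`, `Z` are
independent: all entries of both matrices together form an independent family. -/
structure IsGaussianPair {Ω : Type*} [MeasurableSpace Ω] (P : Measure Ω) {N d n : ℕ}
    (W : Ω → Matrix (Fin N) (Fin d) ℝ) (Z : Ω → Matrix (Fin d) (Fin n) ℝ) : Prop where
  law_W : ∀ i j, HasLaw (fun ω => W ω i j) (gaussianReal 0 1) P
  law_Z : ∀ i j, HasLaw (fun ω => Z ω i j) (gaussianReal 0 ((d : ℝ≥0)⁻¹)) P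
  indep : iIndepFun
    (Sum.elim (fun (p : Fin N × Fin d) (ω : Ω) => W ω p.1 p.2)
      (fun (p : Fin d × Fin n) (ω : Ω) => Z ω p.1 p.2)) P

/-! ### The XOR signal -/

/-- `u₁ = d^{-1/2} (1_{d/2}, -1_{d/2})`. -/
def xorU1 (d : ℕ) : Fin d → ℝ := fun i =>
  if (i : ℕ) < d / 2 then 1 / √(d : ℝ) else -(1 / √(d : ℝ))

/-- `u₂ = d^{-1/2} (1_{d/2}, 1_{d/2})`. -/
def xorU2 (d : ℕ) : Fin d → ℝ := fun _ => 1 / √(d : ℝ)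

/-- `v₁ = (2/n)^{1/2} (1_{n/4}, -1_{n/4}, 0_{n/2})`. -/
def xorV1 (n : ℕ) : Fin n → ℝ := fun j =>
  if (j : ℕ) < n / 4 then √(2 / (n : ℝ))
  else if (j : ℕ) < n / 2 then -√(2 / (n : ℝ))
  else 0

/-- `v₂ = (2/n)^{1/2} (0_{n/2}, 1_{n/4}, -1_{n/4})`. -/
def xorV2 (n : ℕ) : Fin n → ℝ := fun j =>
  if (j : ℕ) < n / 2 then 0
  else if (j : ℕ) < n / 2 + n / 4 then √(2 / (n : ℝ))
  else -√(2 / (n : ℝ))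

/-- `θ = r (n / (2d))^{1/2}`. -/
def thetaSNR (r : ℝ) (n d : ℕ) : ℝ := r * √((n : ℝ) / (2 * (d : ℝ)))

/-- The rank-two signal `M = θ (u₁ v₁ᵀ + u₂ v₂ᵀ)`. -/
def xorSignal (r : ℝ) (d n : ℕ) : Matrix (Fin d) (Fin n) ℝ :=
  thetaSNR r n d • (vecMulVec (xorU1 d) (xorV1 n) + vecMulVec (xorU2 d) (xorV2 n))

/-! ### Feature matrices, the quadratic equivalent and the conjugate kernel -/

/-- The feature matrix `N^{-1/2} σ(W X)`, with `σ` applied entrywise. -/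
def featureMatrix (σ : ℝ → ℝ) {N d n : ℕ} (W : Matrix (Fin N) (Fin d) ℝ)
    (X : Matrix (Fin d) (Fin n) ℝ) : Matrix (Fin N) (Fin n) ℝ :=
  (1 / √(N : ℝ)) • (W * X).map σ

/-- `Y = N^{-1/2} σ(W X)` for the XOR data `X = M + Z`. -/
def xorFeature (σ : ℝ → ℝ) (r : ℝ) {N d n : ℕ} (W : Matrix (Fin N) (Fin d) ℝ)
    (Z : Matrix (Fin d) (Fin n) ℝ) : Matrix (Fin N) (Fin n) ℝ :=
  featureMatrix σ W (xorSignal r d n + Z)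

/-- The linear term `T₁ = θ b_σ N^{-1/2} (g₁ v₁ᵀ + g₂ v₂ᵀ)`, `gₗ = W uₗ`. -/
def qeLinear (σ : ℝ → ℝ) (r : ℝ) {N d : ℕ} (n : ℕ) (W : Matrix (Fin N) (Fin d) ℝ) :
    Matrix (Fin N) (Fin n) ℝ :=
  (thetaSNR r n d * bCoeff σ / √(N : ℝ)) •
    (vecMulVec (W *ᵥ xorU1 d) (xorV1 n) + vecMulVec (W *ᵥ xorU2 d) (xorV2 n))

/-- The quadratic term `T₂ = θ² c_σ / (2 N^{1/2}) (g₁^{⊙2} v₁^{⊙2}ᵀ + g₂^{⊙2} v₂^{⊙2}ᵀ)`,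
`gₗ = W uₗ`; the squares of vectors are entrywise. -/
def qeQuadratic (σ : ℝ → ℝ) (r : ℝ) {N d : ℕ} (n : ℕ) (W : Matrix (Fin N) (Fin d) ℝ) :
    Matrix (Fin N) (Fin n) ℝ :=
  (thetaSNR r n d ^ 2 * cCoeff σ / (2 * √(N : ℝ))) •
    (vecMulVec (fun i => (W *ᵥ xorU1 d) i ^ 2) (fun j => xorV1 n j ^ 2) +
      vecMulVec (fun i => (W *ᵥ xorU2 d) i ^ 2) (fun j => xorV2 n j ^ 2))

/-- The quadratic equivalent `Y_QE = N^{-1/2} σ(W Z) + T₁ + T₂`. -/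
def qeFeature (σ : ℝ → ℝ) (r : ℝ) {N d n : ℕ} (W : Matrix (Fin N) (Fin d) ℝ)
    (Z : Matrix (Fin d) (Fin n) ℝ) : Matrix (Fin N) (Fin n) ℝ :=
  featureMatrix σ W Z + qeLinear σ r n W + qeQuadratic σ r n W

/-- The Gram (conjugate kernel) matrix `K = Yᵀ Y`. -/
def ckGram {N n : ℕ} (Y : Matrix (Fin N) (Fin n) ℝ) : Matrix (Fin n) (Fin n) ℝ := Yᵀ * Y

theorem ckGram_isHermitian {N n : ℕ} (Y : Matrix (Fin N) (Fin n) ℝ) : (ckGram Y).IsHermitian := by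
  simpa [ckGram, conjTranspose_eq_transpose_of_trivial] using isHermitian_conjTranspose_mul_self Y

/-- The operator norm of a rectangular matrix between Euclidean spaces. -/
def opNorm {m n : ℕ} (A : Matrix (Fin m) (Fin n) ℝ) : ℝ :=
  ‖LinearMap.toContinuousLinearMap (toEuclideanLin A)‖

/-- The `i`-th largest eigenvalue of `Yᵀ Y`, counted with multiplicity. -/
def gramEig {N n : ℕ} (Y : Matrix (Fin N) (Fin n) ℝ) (i : Fin n) : ℝ :=
  (ckGram_isHermitian Y).eigenvalues₀ (Fin.cast (Fintype.card_fin n).symm i)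

/-- The number, counted with multiplicity, of eigenvalues of `Yᵀ Y` in `I`. -/
def gramCount {N n : ℕ} (Y : Matrix (Fin N) (Fin n) ℝ) (I : Set ℝ) : ℕ :=
  {i : Fin n | gramEig Y i ∈ I}.ncard

/-- The spectral projector of `Yᵀ Y` onto the eigenvalues in `I`, i.e. `1_I(Yᵀ Y)`. -/
def gramProj {N n : ℕ} (Y : Matrix (Fin N) (Fin n) ℝ) (I : Set ℝ) :
    Matrix (Fin n) (Fin n) ℝ :=
  (ckGram_isHermitian Y).cfc (I.indicator fun _ => (1 : ℝ))

/-- No eigenvalue of `Yᵀ Y` is closer than `δ` to an endpoint of `[a, b]`: the eigenvalues in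
`[a, b]` are separated from all the others. -/
def GramGap {N n : ℕ} (Y : Matrix (Fin N) (Fin n) ℝ) (δ a b : ℝ) : Prop :=
  ∀ i : Fin n, δ ≤ |gramEig Y i - a| ∧ δ ≤ |gramEig Y i - b|

/-! ### Stochastic domination -/

section Domination

variable {Ω : Type*} [MeasurableSpace Ω]

/-- `X ≺ B` on the events `E`, with `n k` as the size parameter: for all `ε, D > 0`, for all
large `k`, the probability that `E k` holds and `X k ≥ n^ε B k` is at most `n^{-D}`. -/
def StochDomOn (P : Measure Ω) (n : ℕ → ℕ) (E : ℕ → Set Ω) (X : ℕ → Ω → ℝ) (B : ℕ → ℝ) : Prop :=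
  ∀ ε > (0 : ℝ), ∀ D > (0 : ℝ), ∀ᶠ k in atTop,
    P.real {ω | ω ∈ E k ∧ (n k : ℝ) ^ ε * B k ≤ X k ω} ≤ (n k : ℝ) ^ (-D)

/-- Stochastic domination `X ≺ B`. -/
def StochDom (P : Measure Ω) (n : ℕ → ℕ) (X : ℕ → Ω → ℝ) (B : ℕ → ℝ) : Prop :=
  StochDomOn P n (fun _ => Set.univ) X B

/-- `X` is bounded in probability. -/
def BoundedInProb (P : Measure Ω) (X : ℕ → Ω → ℝ) : Prop :=
  ∀ ε > (0 : ℝ), ∃ C : ℝ, ∀ᶠ k in atTop, P.real {ω | C < X k ω} ≤ ε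

/-- The spectra of `YᵀY` and `Y'ᵀY'` match at rate `n^{-1/4}`: the ordered eigenvalues agree
uniformly, and for each spectral window `[a, b]` whose endpoints are at distance at least a fixed
`δ > 0` from the spectrum of one of the two matrices, both matrices have the same number of
eigenvalues in the window, the spectral projectors agree in operator norm, and so do the
alignments `xᵀ P x = ‖P x‖²` of the eigenspaces with any deterministic vectors `x` of norm at
most one. -/
def SpectraMatch (P : Measure Ω) (N n : ℕ → ℕ)
    (Y Y' : (k : ℕ) → Ω → Matrix (Fin (N k)) (Fin (n k)) ℝ) : Prop :=
  StochDom P n (fun k ω => ⨆ i, |gramEig (Y k ω) i - gramEig (Y' k ω) i|)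
    (fun k => (n k : ℝ) ^ (-(1 / 4) : ℝ)) ∧
  ∀ δ > (0 : ℝ), ∀ a b : ℕ → ℝ, ∀ E : ℕ → Set Ω,
    (∀ k, E k = {ω | GramGap (Y k ω) δ (a k) (b k) ∨ GramGap (Y' k ω) δ (a k) (b k)}) →
    (∀ D > (0 : ℝ), ∀ᶠ k in atTop,
      P.real {ω | ω ∈ E k ∧ gramCount (Y k ω) (Set.Icc (a k) (b k)) ≠
        gramCount (Y' k ω) (Set.Icc (a k) (b k))} ≤ (n k : ℝ) ^ (-D)) ∧
    StochDomOn P n E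
      (fun k ω => opNorm (gramProj (Y k ω) (Set.Icc (a k) (b k)) -
        gramProj (Y' k ω) (Set.Icc (a k) (b k))))
      (fun k => (n k : ℝ) ^ (-(1 / 4) : ℝ)) ∧
    ∀ x : (k : ℕ) → Fin (n k) → ℝ, (∀ k, x k ⬝ᵥ x k ≤ 1) →
      StochDomOn P n E
        (fun k ω => |x k ⬝ᵥ (gramProj (Y k ω) (Set.Icc (a k) (b k)) *ᵥ x k) -
          x k ⬝ᵥ (gramProj (Y' k ω) (Set.Icc (a k) (b k)) *ᵥ x k)|)
        (fun k => (n k : ℝ) ^ (-(1 / 4) : ℝ))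

end Domination

end

/-! ### Gaussian concentration (Maurey–Pisier) -/

/-! Let q denote the entrywise bound `signalBound` for W M. The u_ℓ are unit vectors, so the entries
of W u_ℓ are standard Gaussians and stay below n^ε simultaneously. Since θ √(2/n) = r / √d and r =
O(n^{1/4}), this gives q ≺ n^{-1/4} (`exists_signalBound_le`, `stochDom_signalSize`).

Expand σ(WZ + WM) entrywise to second order in WM. The vectors v₁ and v₂ have disjoint supports, so
the square of WM has no cross term, and replacing σ'(WZ), σ''(WZ) by their Gaussian means b_σ, c_σ
produces exactly Y_QE. Three errors remain (`opNorm_xorFeature_sub_qeFeature_le`). The first two are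
entrywise products of σ'(WZ) - b_σ and σ''(WZ) - c_σ with sums of two rank-one matrices. Such a
product is a sum of terms diag · D · diag, so it costs only factors q and q². The cubic remainder is
bounded in Frobenius norm by L q³ √(Nn). After division by √N the errors are of order n^{-1/4},
n^{-1/2} and n^{-3/4} √n = n^{-1/4}, provided that the centered matrices have norm ≺ √n.

That proviso is the probabilistic core (`stochDom_feature`): ‖f(WZ) - E f(ξ)‖ ≺ √n for every
differentiable f with bounded derivative. Given W, each bilinear form of f(WZ) is a Lipschitz
function of Z with constant of order ‖W‖/√d, which is at most n^ε with overwhelming probability.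
Gaussian concentration, proved by the Maurey–Pisier rotation argument (`lintegral_exp_sub_le`), and
a union bound over nets of size 5^{N+n} control the deviation from the conditional mean. That mean
depends on W only through the row norms; these concentrate at relative scale d^{-1/2}, so it differs
from E f(ξ) by about d^{-1/2} per entry, hence by about √n in Frobenius norm.

For the spectra, K - K_QE is controlled by (‖Y‖ + ‖Y_QE‖) ‖Y - Y_QE‖, the eigenvalues by Weyl's
inequality (`LinearMap.IsSymmetric.eigenvalues_le_add`), and the projectors by a Davis–Kahan bound
that needs a gap in only one of the two spectra (`opNorm_cfc_indicator_Icc_sub_le`).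

Boundedness in probability carries no polynomial tail, so it must be upgraded. All of Y_QE except
its linear term is always ≺ 1. If Y_QE is bounded with probability near one, then so is the linear
term up to n^ε, and its norm is at least a constant times θ |b_σ| with probability at least 2/3.
Hence the deterministic number θ |b_σ| is at most n^ε (`stochDom_thetaSNR_of_boundedInProb`), and
the linear term is ≺ 1 as well. -/

theorem ofReal_exp_integral_le_lintegral {α : Type*} [MeasurableSpace α] {ν : Measure α}
    [IsProbabilityMeasure ν] {u : α → ℝ} (hu : Integrable u ν) :
    ENNReal.ofReal (Real.exp (∫ x, u x ∂ν)) ≤ ∫⁻ x, ENNReal.ofReal (Real.exp (u x)) ∂ν := by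
  by_cases h : ∫⁻ x, ENNReal.ofReal (Real.exp (u x)) ∂ν = ⊤
  · simp [h]
  have hm : AEStronglyMeasurable (fun x => Real.exp (u x)) ν :=
    Real.continuous_exp.comp_aestronglyMeasurable hu.1
  have hi : Integrable (fun x => Real.exp (u x)) ν :=
    (lintegral_ofReal_ne_top_iff_integrable hm (ae_of_all _ fun x => (Real.exp_pos _).le)).1 h
  rw [← ofReal_integral_eq_lintegral_ofReal hi (ae_of_all _ fun x => (Real.exp_pos _).le)]
  exact ENNReal.ofReal_le_ofReal <|
    convexOn_exp.map_integral_le Real.continuous_exp.continuousOn isClosed_univ (by simp) hu hi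

/-- Chernoff's bound. With `lintegral` no integrability of the exponential has to be known
beforehand. -/
theorem measure_ge_le_exp_mul_lintegral {α : Type*} [MeasurableSpace α] {ν : Measure α}
    {X : α → ℝ} (hX : Measurable X) {s : ℝ} (hs : 0 ≤ s) (t : ℝ) :
    ν {x | t ≤ X x}
      ≤ ENNReal.ofReal (Real.exp (-(s * t))) * ∫⁻ x, ENNReal.ofReal (Real.exp (s * X x)) ∂ν := by
  rw [← lintegral_const_mul _ (by fun_prop)]
  refine le_trans (le_of_eq (one_mul _).symm) (le_trans (mul_le_mul_right (measure_mono ?_) _)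
    (mul_meas_ge_le_lintegral (by fun_prop) 1))
  intro x hx
  simp only [Set.mem_ofPred_eq] at hx ⊢
  rw [← ENNReal.ofReal_mul (Real.exp_pos _).le, ← Real.exp_add, ENNReal.one_le_ofReal,
    Real.one_le_exp_iff]
  nlinarith [mul_le_mul_of_nonneg_left hx hs]

section Concentration

variable {E : Type*} [NormedAddCommGroup E] [InnerProductSpace ℝ E] [FiniteDimensional ℝ E]
  [MeasurableSpace E] [BorelSpace E]

theorem integrable_stdGaussian_of_fderiv_le {G : E → ℝ} (hG : Differentiable ℝ G) {K : ℝ}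
    (hK : ∀ x, ‖fderiv ℝ G x‖ ≤ K) : Integrable G (stdGaussian E) := by
  have h1 : Integrable (fun x : E => |G 0| + K * ‖x‖) (stdGaussian E) :=
    (integrable_const _).add (IsGaussian.integrable_id.norm.const_mul _)
  refine h1.mono' hG.continuous.aestronglyMeasurable (ae_of_all _ fun x => ?_)
  have := Convex.norm_image_sub_le_of_norm_fderiv_le (𝕜 := ℝ) (f := G) (s := Set.univ)
    (fun x _ => hG x) (fun x _ => hK x) convex_univ (Set.mem_univ 0) (Set.mem_univ x)
  simp only [sub_zero, Real.norm_eq_abs] at this ⊢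
  have h2 := abs_sub_abs_le_abs_sub (G x) (G 0)
  linarith

theorem lintegral_exp_strongDual_stdGaussian (L : StrongDual ℝ E) :
    ∫⁻ x, ENNReal.ofReal (Real.exp (L x)) ∂(stdGaussian E)
      = ENNReal.ofReal (Real.exp (‖L‖ ^ 2 / 2)) := by
  have h1 : (stdGaussian E).map L = gaussianReal 0 (‖L‖₊ ^ 2) := by
    rw [IsGaussian.map_eq_gaussianReal, integral_strongDual_stdGaussian,
      variance_dual_stdGaussian]
    congr 1
    ext; simp
  have h2 := integrable_exp_mul_gaussianReal (μ := 0) (v := ‖L‖₊ ^ 2) 1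
  have h3 : ∫⁻ x, ENNReal.ofReal (Real.exp (L x)) ∂(stdGaussian E)
      = ∫⁻ y, ENNReal.ofReal (Real.exp (1 * y)) ∂((stdGaussian E).map L) := by
    rw [lintegral_map (by fun_prop) (by fun_prop)]
    simp
  rw [h3, h1, ← ofReal_integral_eq_lintegral_ofReal h2 (ae_of_all _ fun x => (Real.exp_pos _).le)]
  have h4 := congrFun (mgf_id_gaussianReal (μ := 0) (v := ‖L‖₊ ^ 2)) 1
  simp only [mgf, id] at h4
  rw [h4]
  simp

/-- Maurey–Pisier. Join two independent Gaussian points by the quarter turn cos · z.1 + sin · z.2,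
and write the increment of `G` as the time integral of its derivative `u` along this path. Jensen
moves the exponential inside the time integral. At each fixed time, position and velocity are again
independent standard Gaussians, so given the position the derivative is a centered Gaussian with
standard deviation at most |s| (π/2) K. -/
theorem lintegral_exp_sub_le {G : E → ℝ} (hG : Differentiable ℝ G) {K : ℝ}
    (hK : ∀ x, ‖fderiv ℝ G x‖ ≤ K) (s : ℝ) :
    ∫⁻ z, ENNReal.ofReal (Real.exp (s * (G z.2 - G z.1))) ∂((stdGaussian E).prod (stdGaussian E))
      ≤ ENNReal.ofReal (Real.exp (2 * s ^ 2 * K ^ 2)) := by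
  set ν : Measure ℝ := volume.restrict (Set.Ioc (0 : ℝ) 1) with hν
  have : IsProbabilityMeasure ν := ⟨by simp [hν]⟩
  let R : ℝ → E × E → E × E := fun t => ContinuousLinearMap.rotation (Real.pi / 2 * t)
  let u : ℝ → E × E → ℝ := fun t z => s * (Real.pi / 2) * fderiv ℝ G (R t z).1 (R t z).2
  have hK0 : 0 ≤ K := (norm_nonneg _).trans (hK 0)
  have hR : Continuous (fun p : ℝ × (E × E) => R p.1 p.2) := by
    simp only [R, ContinuousLinearMap.rotation_apply]
    fun_prop
  have happ : Measurable (fun p : E × E => fderiv ℝ G p.1 p.2) := by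
    have h1 : Measurable (fun p : E × E => (fderiv ℝ G p.1, p.2)) :=
      ((measurable_fderiv ℝ G).comp measurable_fst).prodMk measurable_snd
    exact (isBoundedBilinearMap_apply (𝕜 := ℝ) (E := E) (F := ℝ)).continuous.measurable.comp h1
  have hu : Measurable (fun p : ℝ × (E × E) => u p.1 p.2) :=
    (happ.comp hR.measurable).const_mul _
  have hpath : ∀ z t, HasDerivAt (fun t => s * G (R t z).1) (u t z) t := by
    intro z t
    have h0 : HasDerivAt (fun t : ℝ => Real.pi / 2 * t) (Real.pi / 2) t := by
      simpa using (hasDerivAt_id t).const_mul (Real.pi / 2)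
    have h1 : HasDerivAt (fun t => (R t z).1) ((Real.pi / 2) • (R t z).2) t := by
      have h2 := (((Real.hasDerivAt_cos _).comp t h0).smul_const z.1).add
        (((Real.hasDerivAt_sin _).comp t h0).smul_const z.2)
      refine h2.congr_deriv ?_
      simp only [R, ContinuousLinearMap.rotation_apply, smul_add, smul_smul]
      congr 2 <;> ring
    have h3 := ((hG (R t z).1).hasFDerivAt.comp_hasDerivAt t h1).const_mul s
    refine h3.congr_deriv ?_
    simp only [u, map_smul, smul_eq_mul]
    ring
  have hui : ∀ z, Integrable (fun t => u t z) ν := by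
    intro z
    refine Integrable.of_bound (C := |s * (Real.pi / 2)| * (K * (‖z.1‖ + ‖z.2‖)))
      ((hu.comp (measurable_id.prodMk measurable_const)).aestronglyMeasurable)
      (ae_of_all _ fun t => ?_)
    simp only [u, norm_mul, Real.norm_eq_abs (s * (Real.pi / 2))]
    simp only [Real.norm_eq_abs, abs_mul]
    gcongr
    refine ((fderiv ℝ G _).le_opNorm _).trans ?_
    gcongr
    · exact hK _
    · simp only [R, ContinuousLinearMap.rotation_apply]
      refine (norm_add_le _ _).trans ?_
      rw [norm_smul, norm_smul, Real.norm_eq_abs, Real.norm_eq_abs, abs_neg]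
      have := Real.abs_sin_le_one (Real.pi / 2 * t)
      have := Real.abs_cos_le_one (Real.pi / 2 * t)
      have := norm_nonneg z.1
      have := norm_nonneg z.2
      nlinarith
  have hftc : ∀ z, ∫ t, u t z ∂ν = s * (G z.2 - G z.1) := by
    intro z
    have h1 := intervalIntegral.integral_eq_sub_of_hasDerivAt (a := 0) (b := 1)
      (fun t _ => hpath z t)
      ((intervalIntegrable_iff_integrableOn_Ioc_of_le zero_le_one).2 (hui z))
    rw [intervalIntegral.integral_of_le zero_le_one] at h1
    rw [hν, h1]
    simp [R, ContinuousLinearMap.rotation_apply]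
    ring
  have hinner : ∀ t, ∫⁻ z, ENNReal.ofReal (Real.exp (u t z))
      ∂((stdGaussian E).prod (stdGaussian E)) ≤ ENNReal.ofReal (Real.exp (2 * s ^ 2 * K ^ 2)) := by
    intro t
    have hm : Measurable (fun z : E × E =>
        ENNReal.ofReal (Real.exp (s * (Real.pi / 2) * fderiv ℝ G z.1 z.2))) :=
      (happ.const_mul _).exp.ennreal_ofReal
    -- The rotated pair has the law of the original pair, so the time `t` disappears from the
    -- estimate.
    have hrot := IsGaussian.map_rotation_eq_self (μ := stdGaussian E)
      (by simp) (Real.pi / 2 * t)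
    have h1 : ∫⁻ z, ENNReal.ofReal (Real.exp (u t z)) ∂((stdGaussian E).prod (stdGaussian E))
        = ∫⁻ z, ENNReal.ofReal (Real.exp (s * (Real.pi / 2) * fderiv ℝ G z.1 z.2))
          ∂((stdGaussian E).prod (stdGaussian E)) := by
      conv_rhs => rw [← hrot]
      rw [lintegral_map hm (ContinuousLinearMap.continuous _).measurable]
    rw [h1, lintegral_prod _ hm.aemeasurable]
    calc _ ≤ ∫⁻ _ : E, ENNReal.ofReal (Real.exp (2 * s ^ 2 * K ^ 2)) ∂(stdGaussian E) := by
          refine lintegral_mono fun z => ?_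
          have h2 := lintegral_exp_strongDual_stdGaussian ((s * (Real.pi / 2)) • fderiv ℝ G z)
          simp only [FunLike.coe_smul, Pi.smul_apply, smul_eq_mul] at h2
          rw [h2]
          refine ENNReal.ofReal_le_ofReal (Real.exp_le_exp.2 ?_)
          rw [norm_smul, mul_pow, Real.norm_eq_abs, sq_abs]
          have h3 : ‖fderiv ℝ G z‖ ^ 2 ≤ K ^ 2 := by
            have := hK z
            gcongr
          -- The crude bound π ≤ 4 is what turns the Gaussian exponent into 2 s² K².
          have h4 : (Real.pi / 2) ^ 2 ≤ 4 := by nlinarith [Real.pi_le_four, Real.pi_pos]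
          calc (s * (Real.pi / 2)) ^ 2 * ‖fderiv ℝ G z‖ ^ 2 / 2
              = s ^ 2 * ((Real.pi / 2) ^ 2 * ‖fderiv ℝ G z‖ ^ 2) / 2 := by ring
            _ ≤ s ^ 2 * (4 * K ^ 2) / 2 := by gcongr
            _ = _ := by ring
      _ = _ := by simp
  calc _ = ∫⁻ z, ENNReal.ofReal (Real.exp (∫ t, u t z ∂ν))
        ∂((stdGaussian E).prod (stdGaussian E)) := by simp_rw [hftc]
    _ ≤ ∫⁻ z, ∫⁻ t, ENNReal.ofReal (Real.exp (u t z)) ∂ν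
        ∂((stdGaussian E).prod (stdGaussian E)) :=
      lintegral_mono fun z => ofReal_exp_integral_le_lintegral (hui z)
    _ = ∫⁻ t, ∫⁻ z, ENNReal.ofReal (Real.exp (u t z))
        ∂((stdGaussian E).prod (stdGaussian E)) ∂ν :=
      lintegral_lintegral_swap
        ((hu.comp measurable_swap).exp.ennreal_ofReal.aemeasurable)
    _ ≤ ∫⁻ _, ENNReal.ofReal (Real.exp (2 * s ^ 2 * K ^ 2)) ∂ν := lintegral_mono hinner
    _ = _ := by simp

/-- Gaussian concentration in exponential form. -/
theorem lintegral_exp_sub_integral_le {G : E → ℝ} (hG : Differentiable ℝ G) {K : ℝ}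
    (hK : ∀ x, ‖fderiv ℝ G x‖ ≤ K) (s : ℝ) :
    ∫⁻ z, ENNReal.ofReal (Real.exp (s * (G z - ∫ x, G x ∂(stdGaussian E)))) ∂(stdGaussian E)
      ≤ ENNReal.ofReal (Real.exp (2 * s ^ 2 * K ^ 2)) := by
  set m := ∫ x, G x ∂(stdGaussian E) with hm
  have hGi := integrable_stdGaussian_of_fderiv_le hG hK
  have hGm : Measurable G := hG.continuous.measurable
  -- Symmetrization: the exponential moment for an independent pair factors, and by Jensen the
  -- factor of the first point is at least one, so it can be dropped.
  have h1 : (1 : ENNReal) ≤ ∫⁻ z, ENNReal.ofReal (Real.exp (-s * (G z - m))) ∂(stdGaussian E) := by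
    have := ofReal_exp_integral_le_lintegral (ν := stdGaussian E) (u := fun z => -s * (G z - m))
      ((hGi.sub (integrable_const _)).const_mul _)
    rw [integral_const_mul, integral_sub hGi (integrable_const _)] at this
    simpa [← hm] using this
  refine le_trans ?_ (lintegral_exp_sub_le hG hK s)
  have h2 : ∀ z : E × E, ENNReal.ofReal (Real.exp (s * (G z.2 - G z.1)))
      = ENNReal.ofReal (Real.exp (-s * (G z.1 - m))) * ENNReal.ofReal (Real.exp (s * (G z.2 - m))) := by
    intro z
    rw [← ENNReal.ofReal_mul (Real.exp_pos _).le, ← Real.exp_add]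
    congr 2; ring
  simp_rw [h2]
  rw [lintegral_prod_mul (f := fun z => ENNReal.ofReal (Real.exp (-s * (G z - m))))
    (g := fun z => ENNReal.ofReal (Real.exp (s * (G z - m)))) (by fun_prop) (by fun_prop)]
  exact le_mul_of_one_le_left' h1

theorem stdGaussian_ge_le {G : E → ℝ} (hG : Differentiable ℝ G) {K : ℝ} (hK0 : 0 < K)
    (hK : ∀ x, ‖fderiv ℝ G x‖ ≤ K) {t : ℝ} (ht : 0 ≤ t) :
    (stdGaussian E) {z | t ≤ G z - ∫ x, G x ∂(stdGaussian E)}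
      ≤ ENNReal.ofReal (Real.exp (-(t ^ 2 / (8 * K ^ 2)))) := by
  have hGm : Measurable G := hG.continuous.measurable
  -- The value t / (4K²) minimizes -st + 2 s² K², with minimum -t² / (8K²).
  refine (measure_ge_le_exp_mul_lintegral (hGm.sub_const _) (s := t / (4 * K ^ 2))
    (by positivity) t).trans ?_
  refine (mul_le_mul_right (lintegral_exp_sub_integral_le hG hK _) _).trans ?_
  rw [← ENNReal.ofReal_mul (Real.exp_pos _).le, ← Real.exp_add]
  refine ENNReal.ofReal_le_ofReal (Real.exp_le_exp.2 (le_of_eq ?_))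
  field_simp
  ring

end Concentration

/-! ### The operator norm -/

section OpNorm

open scoped Matrix.Norms.L2Operator

theorem opNorm_eq_norm {m n : ℕ} (A : Matrix (Fin m) (Fin n) ℝ) : opNorm A = ‖A‖ := by
  rw [opNorm, Matrix.l2_opNorm_def]; rfl

theorem opNorm_nonneg {m n : ℕ} (A : Matrix (Fin m) (Fin n) ℝ) : 0 ≤ opNorm A := norm_nonneg _

theorem opNorm_add_le {m n : ℕ} (A B : Matrix (Fin m) (Fin n) ℝ) :
    opNorm (A + B) ≤ opNorm A + opNorm B := by
  simpa only [opNorm_eq_norm] using norm_add_le A B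

theorem opNorm_sub_le {m n : ℕ} (A B : Matrix (Fin m) (Fin n) ℝ) :
    opNorm (A - B) ≤ opNorm A + opNorm B := by
  simpa only [opNorm_eq_norm] using norm_sub_le A B

theorem opNorm_sub_comm {m n : ℕ} (A B : Matrix (Fin m) (Fin n) ℝ) :
    opNorm (A - B) = opNorm (B - A) := by
  simpa only [opNorm_eq_norm] using norm_sub_rev A B

theorem opNorm_smul {m n : ℕ} (c : ℝ) (A : Matrix (Fin m) (Fin n) ℝ) :
    opNorm (c • A) = |c| * opNorm A := by
  simpa only [opNorm_eq_norm, Real.norm_eq_abs] using! norm_smul c A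

theorem opNorm_mul_le {l m n : ℕ} (A : Matrix (Fin l) (Fin m) ℝ) (B : Matrix (Fin m) (Fin n) ℝ) :
    opNorm (A * B) ≤ opNorm A * opNorm B := by
  simpa only [opNorm_eq_norm] using Matrix.l2_opNorm_mul A B

theorem opNorm_transpose {m n : ℕ} (A : Matrix (Fin m) (Fin n) ℝ) : opNorm Aᵀ = opNorm A := by
  simpa only [opNorm_eq_norm, conjTranspose_eq_transpose_of_trivial]
    using Matrix.l2_opNorm_conjTranspose A

theorem opNorm_zero {m n : ℕ} : opNorm (0 : Matrix (Fin m) (Fin n) ℝ) = 0 := by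
  simp only [opNorm_eq_norm, norm_zero]

theorem opNorm_diagonal_le {n : ℕ} {v : Fin n → ℝ} {c : ℝ} (hc : 0 ≤ c) (hv : ∀ i, |v i| ≤ c) :
    opNorm (diagonal v) ≤ c := by
  rw [opNorm_eq_norm, Matrix.l2_opNorm_diagonal]
  exact (pi_norm_le_iff_of_nonneg hc).2 hv

theorem norm_toEuclideanLin_le {m n : ℕ} (A : Matrix (Fin m) (Fin n) ℝ)
    (x : EuclideanSpace ℝ (Fin n)) : ‖toEuclideanLin A x‖ ≤ opNorm A * ‖x‖ :=
  (LinearMap.toContinuousLinearMap (toEuclideanLin A)).le_opNorm x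

theorem continuous_opNorm {m n : ℕ} :
    Continuous (opNorm : Matrix (Fin m) (Fin n) ℝ → ℝ) := by
  have h : Continuous (fun A : Matrix (Fin m) (Fin n) ℝ => ‖A‖) := continuous_norm
  exact h.congr fun A => (opNorm_eq_norm A).symm

theorem dotProduct_eq_norm_sq {n : ℕ} (x : Fin n → ℝ) : x ⬝ᵥ x = ‖WithLp.toLp 2 x‖ ^ 2 := by
  rw [EuclideanSpace.real_norm_sq_eq]
  simp [dotProduct, sq]

theorem abs_dotProduct_mulVec_le {m n : ℕ} (A : Matrix (Fin m) (Fin n) ℝ) (x : Fin m → ℝ)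
    (y : Fin n → ℝ) :
    |x ⬝ᵥ (A *ᵥ y)| ≤ opNorm A * (‖WithLp.toLp 2 x‖ * ‖WithLp.toLp 2 y‖) := by
  have h1 : x ⬝ᵥ (A *ᵥ y) = inner ℝ (WithLp.toLp 2 x) (toEuclideanLin A (WithLp.toLp 2 y)) := by
    simp [EuclideanSpace.inner_eq_star_dotProduct, dotProduct_comm]
  rw [h1]
  refine (abs_real_inner_le_norm _ _).trans ?_
  have := mul_le_mul_of_nonneg_left (norm_toEuclideanLin_le A (WithLp.toLp 2 y))
    (norm_nonneg (WithLp.toLp 2 x))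
  linarith

theorem opNorm_le_sqrt_sum_sq {m n : ℕ} (A : Matrix (Fin m) (Fin n) ℝ) :
    opNorm A ≤ √(∑ i, ∑ j, A i j ^ 2) := by
  refine ContinuousLinearMap.opNorm_le_bound _ (Real.sqrt_nonneg _) fun x => ?_
  refine (sq_le_sq₀ (norm_nonneg _) (by positivity)).1 ?_
  rw [mul_pow, Real.sq_sqrt (by positivity), EuclideanSpace.real_norm_sq_eq,
    EuclideanSpace.real_norm_sq_eq, Finset.sum_mul]
  refine Finset.sum_le_sum fun i _ => ?_
  simpa [mulVec, dotProduct] using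
    Finset.sum_mul_sq_le_sq_mul_sq Finset.univ (fun j => A i j) (fun j => x j)

theorem opNorm_le_of_abs_le {m n : ℕ} {A : Matrix (Fin m) (Fin n) ℝ} {c : ℝ} (hc : 0 ≤ c)
    (h : ∀ i j, |A i j| ≤ c) : opNorm A ≤ c * √(m * n) := by
  refine (opNorm_le_sqrt_sum_sq A).trans ?_
  have h1 : ∑ i, ∑ j, A i j ^ 2 ≤ ∑ _i : Fin m, ∑ _j : Fin n, c ^ 2 :=
    Finset.sum_le_sum fun i _ => Finset.sum_le_sum fun j _ => sq_le_sq' (abs_le.1 (h i j)).1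
      (abs_le.1 (h i j)).2
  refine (Real.sqrt_le_sqrt h1).trans (le_of_eq ?_)
  simp only [Finset.sum_const, Finset.card_univ, Fintype.card_fin, nsmul_eq_mul]
  rw [show (m : ℝ) * (n * c ^ 2) = c ^ 2 * (m * n) by ring, Real.sqrt_mul (sq_nonneg c),
    Real.sqrt_sq hc]

theorem opNorm_unitary_conj {n : ℕ} (U : unitaryGroup (Fin n) ℝ) (A : Matrix (Fin n) (Fin n) ℝ) :
    opNorm (Unitary.conjStarAlgAut ℝ _ U A) = opNorm A := by
  rw [opNorm_eq_norm, opNorm_eq_norm, Unitary.conjStarAlgAut_apply]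
  rw [← Unitary.coe_star, CStarRing.norm_mul_coe_unitary, CStarRing.norm_coe_unitary_mul]

end OpNorm

/-! ### Nets and the operator norm -/

/-- A maximal 1-separated subset of the ball of radius 2 is a 1-net of that ball, and the volume
bound 5^n guarantees that a subset of maximal cardinality exists. -/
theorem exists_net (n : ℕ) : ∃ T : Finset (EuclideanSpace ℝ (Fin n)), T.card ≤ 5 ^ n ∧
    (∀ x ∈ T, ‖x‖ ≤ 2) ∧ ∀ x, ‖x‖ ≤ 2 → ∃ y ∈ T, ‖x - y‖ ≤ 1 := by
  classical
  let p : ℕ → Prop := fun k => ∃ T : Finset (EuclideanSpace ℝ (Fin n)), T.card = k ∧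
    (∀ x ∈ T, ‖x‖ ≤ 2) ∧ ∀ x ∈ T, ∀ y ∈ T, x ≠ y → 1 ≤ ‖x - y‖
  have hb : ∀ k, p k → k ≤ 5 ^ n := by
    rintro k ⟨T, rfl, h1, h2⟩
    simpa using Besicovitch.card_le_of_separated T h1 h2
  have h0 : p 0 := ⟨∅, by simp⟩
  obtain ⟨T, hT, h1, h2⟩ := Nat.findGreatest_spec (P := p) (Nat.zero_le (5 ^ n)) h0
  refine ⟨T, hT ▸ Nat.findGreatest_le _, h1, fun x hx => ?_⟩
  by_contra! hcon
  have hxT : x ∉ T := fun h => by simpa using (hcon x h).trans_le' zero_le_one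
  have h3 : p (Nat.findGreatest p (5 ^ n) + 1) := by
    refine ⟨insert x T, by rw [Finset.card_insert_of_notMem hxT, hT], ?_, ?_⟩
    · simpa [hx] using h1
    · intro y hy z hz hyz
      rcases Finset.mem_insert.1 hy with rfl | hy' <;> rcases Finset.mem_insert.1 hz with rfl | hz'
      · exact absurd rfl hyz
      · exact (hcon z hz').le
      · rw [norm_sub_rev]; exact (hcon y hy').le
      · exact h2 y hy' z hz' hyz
  have := Nat.le_findGreatest (hb _ h3) h3
  omega

/-- Radius 2 against mesh 1 makes the discretization lossless. For a unit vector x pick a net point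
z with ‖2x - z‖ ≤ 1; then 2‖Ax‖ ≤ max ‖Az‖ + ‖A‖, which yields ‖A‖ ≤ max ‖Az‖. On the left side, a
net point within 1 of 2w/‖w‖ has inner product at least 2‖w‖ - ‖w‖ with w. -/
theorem exists_net_opNorm_le {m n : ℕ} {S : Finset (EuclideanSpace ℝ (Fin m))}
    {T : Finset (EuclideanSpace ℝ (Fin n))} (hS : ∀ x, ‖x‖ ≤ 2 → ∃ y ∈ S, ‖x - y‖ ≤ 1)
    (hT : ∀ x, ‖x‖ ≤ 2 → ∃ y ∈ T, ‖x - y‖ ≤ 1) (A : Matrix (Fin m) (Fin n) ℝ) :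
    ∃ x ∈ S, ∃ y ∈ T, opNorm A ≤ x.ofLp ⬝ᵥ (A *ᵥ y.ofLp) := by
  have h1 : ∃ y ∈ T, opNorm A ≤ ‖toEuclideanLin A y‖ := by
    obtain ⟨y0, hy0, -⟩ := hT 0 (by simp)
    obtain ⟨y, hy, hmax⟩ := T.exists_max_image (fun y => ‖toEuclideanLin A y‖) ⟨y0, hy0⟩
    refine ⟨y, hy, ?_⟩
    set M := ‖toEuclideanLin A y‖
    have h2 : opNorm A ≤ (M + opNorm A) / 2 := by
      refine ContinuousLinearMap.opNorm_le_bound _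
        (by have := opNorm_nonneg A; positivity) fun x => ?_
      rcases eq_or_ne x 0 with rfl | hx
      · simp
      have hx' : 0 < ‖x‖ := norm_pos_iff.2 hx
      obtain ⟨z, hz, hxz⟩ := hT ((2 / ‖x‖) • x) (by
        rw [norm_smul, Real.norm_eq_abs, abs_of_pos (by positivity)]; field_simp; rfl)
      have h3 : toEuclideanLin A ((2 / ‖x‖) • x)
          = toEuclideanLin A z + toEuclideanLin A ((2 / ‖x‖) • x - z) := by
        rw [← map_add]; congr 1; abel
      have h4 : ‖toEuclideanLin A ((2 / ‖x‖) • x)‖ ≤ M + opNorm A * 1 := by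
        rw [h3]
        refine (norm_add_le _ _).trans (add_le_add (hmax z hz) ?_)
        refine (norm_toEuclideanLin_le A _).trans ?_
        exact mul_le_mul_of_nonneg_left hxz (opNorm_nonneg A)
      rw [map_smul, norm_smul, Real.norm_eq_abs, abs_of_pos (by positivity)] at h4
      change ‖toEuclideanLin A x‖ ≤ _
      rw [div_mul_eq_mul_div, div_le_iff₀ hx'] at h4
      linarith
    linarith
  obtain ⟨y, hy, h1⟩ := h1
  set w := toEuclideanLin A y with hw
  have h2 : ∃ x ∈ S, ‖w‖ ≤ inner ℝ x w := by
    rcases eq_or_ne w 0 with h0 | hx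
    · obtain ⟨y0, hy0, -⟩ := hS 0 (by simp)
      exact ⟨y0, hy0, by simp [h0]⟩
    have hx' : 0 < ‖w‖ := norm_pos_iff.2 hx
    obtain ⟨z, hz, hxz⟩ := hS ((2 / ‖w‖) • w) (by
      rw [norm_smul, Real.norm_eq_abs, abs_of_pos (by positivity)]; field_simp; rfl)
    refine ⟨z, hz, ?_⟩
    have h3 := real_inner_le_norm ((2 / ‖w‖) • w - z) w
    rw [inner_sub_left, real_inner_smul_left, real_inner_self_eq_norm_sq] at h3
    have h4 : 2 / ‖w‖ * ‖w‖ ^ 2 = 2 * ‖w‖ := by field_simp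
    nlinarith
  obtain ⟨x, hx, h2⟩ := h2
  refine ⟨x, hx, y, hy, h1.trans (h2.trans (le_of_eq ?_))⟩
  simp [hw, EuclideanSpace.inner_eq_star_dotProduct, dotProduct_comm]

/-! ### Weyl's inequality -/

/-- The Courant–Fischer dimension count. Eigenvectors 0, …, i of `S` span dimension i + 1 and
eigenvectors i, …, n - 1 of `T` span dimension n - i. These add up to n + 1, so the spans share a
nonzero vector, and the two quadratic forms are compared there. -/
theorem LinearMap.IsSymmetric.eigenvalues_le_add {E : Type*} [NormedAddCommGroup E]
    [InnerProductSpace ℝ E] [FiniteDimensional ℝ E] {S T : E →ₗ[ℝ] E} (hS : S.IsSymmetric)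
    (hT : T.IsSymmetric) {n : ℕ} (hn : Module.finrank ℝ E = n) {c : ℝ}
    (h : ∀ x, inner ℝ (S x) x ≤ inner ℝ (T x) x + c * ‖x‖ ^ 2) (i : Fin n) :
    hS.eigenvalues hn i ≤ hT.eigenvalues hn i + c := by
  classical
  set b := hS.eigenvectorBasis hn
  set b' := hT.eigenvectorBasis hn
  let U := Submodule.span ℝ (Set.range fun j : {j : Fin n // j ≤ i} => b j)
  let V := Submodule.span ℝ (Set.range fun j : {j : Fin n // i ≤ j} => b' j)
  have hU : Module.finrank ℝ U = i + 1 := by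
    refine (finrank_span_eq_card
      (b.orthonormal.linearIndependent.comp _ Subtype.val_injective)).trans ?_
    rw [Fintype.card_subtype, show (Finset.univ.filter (· ≤ i)) = Finset.Iic i by ext; simp,
      Fin.card_Iic]
  have hV : Module.finrank ℝ V = n - i := by
    refine (finrank_span_eq_card
      (b'.orthonormal.linearIndependent.comp _ Subtype.val_injective)).trans ?_
    rw [Fintype.card_subtype, show (Finset.univ.filter (i ≤ ·)) = Finset.Ici i by ext; simp,
      Fin.card_Ici]
  have hUV : ∃ x, x ∈ U ∧ x ∈ V ∧ x ≠ 0 := by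
    by_contra! hcon
    have hd : Disjoint U V := Submodule.disjoint_def.2 hcon
    have := Submodule.finrank_add_finrank_le_of_disjoint hd
    have := i.2
    omega
  obtain ⟨x, hxU, hxV, hx0⟩ := hUV
  have key : ∀ {R : E →ₗ[ℝ] E} (hR : R.IsSymmetric) (x : E), inner ℝ (R x) x
      = ∑ j, hR.eigenvalues hn j * inner ℝ (hR.eigenvectorBasis hn j) x ^ 2 := by
    intro R hR x
    rw [← (hR.eigenvectorBasis hn).sum_inner_mul_inner]
    refine Finset.sum_congr rfl fun j _ => ?_
    rw [hR, hR.apply_eigenvectorBasis, inner_smul_right, real_inner_comm]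
    simp; ring
  have hnorm : ∀ (b : OrthonormalBasis (Fin n) ℝ E) (x : E), ‖x‖ ^ 2 = ∑ j, inner ℝ (b j) x ^ 2 :=
    fun b x => (b.sum_sq_inner_right x).symm
  have hzero : ∀ (b : OrthonormalBasis (Fin n) ℝ E) (p : Fin n → Prop) (x : E),
      x ∈ Submodule.span ℝ (Set.range fun j : {j : Fin n // p j} => b j) →
      ∀ j, ¬ p j → inner ℝ (b j) x = 0 := by
    intro b p x hx j hj
    induction hx using Submodule.span_induction with
    | mem y hy =>
      obtain ⟨k, rfl⟩ := hy
      exact b.orthonormal.2 fun h => hj (h ▸ k.2)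
    | zero => simp
    | add y z _ _ h1 h2 => rw [inner_add_right, h1, h2, add_zero]
    | smul a y _ h1 => rw [inner_smul_right, h1, mul_zero]
  have h1 : hS.eigenvalues hn i * ‖x‖ ^ 2 ≤ inner ℝ (S x) x := by
    rw [key hS, hnorm b, Finset.mul_sum]
    refine Finset.sum_le_sum fun j _ => ?_
    by_cases hj : j ≤ i
    · exact mul_le_mul_of_nonneg_right (hS.eigenvalues_antitone hn hj) (sq_nonneg _)
    · have := hzero b _ x hxU j hj
      simp [b] at this ⊢
      simp [this]
  have h2 : inner ℝ (T x) x ≤ hT.eigenvalues hn i * ‖x‖ ^ 2 := by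
    rw [key hT, hnorm b', Finset.mul_sum]
    refine Finset.sum_le_sum fun j _ => ?_
    by_cases hj : i ≤ j
    · exact mul_le_mul_of_nonneg_right (hT.eigenvalues_antitone hn hj) (sq_nonneg _)
    · have := hzero b' _ x hxV j hj
      simp [b'] at this ⊢
      simp [this]
  have h3 : 0 < ‖x‖ ^ 2 := by have := norm_pos_iff.2 hx0; positivity
  have h4 := h x
  nlinarith

theorem abs_gramEig_sub_le {N n : ℕ} (Y Y' : Matrix (Fin N) (Fin n) ℝ) (i : Fin n) :
    |gramEig Y i - gramEig Y' i| ≤ opNorm (ckGram Y - ckGram Y') := by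
  have h : ∀ Y Y' : Matrix (Fin N) (Fin n) ℝ,
      gramEig Y i ≤ gramEig Y' i + opNorm (ckGram Y - ckGram Y') := by
    intro Y Y'
    refine LinearMap.IsSymmetric.eigenvalues_le_add
      (isSymmetric_toEuclideanLin_iff.mpr (ckGram_isHermitian Y))
      (isSymmetric_toEuclideanLin_iff.mpr (ckGram_isHermitian Y')) finrank_euclideanSpace
      (fun x => ?_) _
    have h1 := real_inner_le_norm (toEuclideanLin (ckGram Y - ckGram Y') x) x
    have h2 := norm_toEuclideanLin_le (ckGram Y - ckGram Y') x
    have h3 := mul_le_mul_of_nonneg_right h2 (norm_nonneg x)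
    rw [map_sub, LinearMap.sub_apply, inner_sub_left] at h1
    rw [map_sub, LinearMap.sub_apply] at h3
    linarith [sq ‖x‖]
  rw [abs_le]
  have h1 := h Y Y'
  have h2 := h Y' Y
  rw [opNorm_sub_comm] at h2
  constructor <;> linarith

/-! ### Perturbation of spectral projectors -/

section Cfc

variable {n : ℕ} {A B : Matrix (Fin n) (Fin n) ℝ}

theorem opNorm_cfc_le (hA : A.IsHermitian) {f : ℝ → ℝ} {c : ℝ} (hc : 0 ≤ c)
    (h : ∀ i, |f (hA.eigenvalues i)| ≤ c) : opNorm (hA.cfc f) ≤ c := by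
  rw [IsHermitian.cfc, opNorm_unitary_conj]
  exact opNorm_diagonal_le hc h

theorem cfc_mul_cfc (hA : A.IsHermitian) (f g : ℝ → ℝ) :
    hA.cfc f * hA.cfc g = hA.cfc (fun x => f x * g x) := by
  rw [IsHermitian.cfc, IsHermitian.cfc, IsHermitian.cfc, ← map_mul, diagonal_mul_diagonal]
  rfl

theorem cfc_add_cfc (hA : A.IsHermitian) (f g : ℝ → ℝ) :
    hA.cfc f + hA.cfc g = hA.cfc (fun x => f x + g x) := by
  rw [IsHermitian.cfc, IsHermitian.cfc, IsHermitian.cfc, ← map_add, diagonal_add]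
  rfl

theorem cfc_congr_eigenvalues (hA : A.IsHermitian) {f g : ℝ → ℝ}
    (h : ∀ i, f (hA.eigenvalues i) = g (hA.eigenvalues i)) : hA.cfc f = hA.cfc g := by
  rw [IsHermitian.cfc, IsHermitian.cfc]
  congr 2
  ext i
  simp [h i]

theorem cfc_one_fun (hA : A.IsHermitian) : hA.cfc (fun _ => 1) = 1 := by
  have : (RCLike.ofReal ∘ (fun _ => (1 : ℝ)) ∘ hA.eigenvalues : Fin n → ℝ) = fun _ => 1 := by
    ext; simp
  rw [IsHermitian.cfc, this, diagonal_one, map_one]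

theorem cfc_sub_const (hA : A.IsHermitian) (c : ℝ) : hA.cfc (fun x => x - c) = A - c • 1 := by
  have h1 : hA.cfc (fun x => x) = A := by
    conv_rhs => rw [hA.spectral_theorem]
    rfl
  have h2 : hA.cfc (fun _ => -c) = -(c • 1) := by
    have : (diagonal (RCLike.ofReal ∘ (fun _ => -c) ∘ hA.eigenvalues) : Matrix (Fin n) (Fin n) ℝ)
        = (-c) • 1 := by
      ext i j; simp [diagonal_apply, one_apply]
    rw [IsHermitian.cfc, this, map_smul, map_one, neg_smul]
  have h3 := cfc_add_cfc hA (fun x => x) (fun _ => -c)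
  rw [h1, h2] at h3
  simpa [sub_eq_add_neg] using h3.symm

theorem cfc_transpose (hA : A.IsHermitian) (f : ℝ → ℝ) : (hA.cfc f)ᵀ = hA.cfc f := by
  have h : star (hA.cfc f) = hA.cfc f := by
    rw [IsHermitian.cfc, ← map_star, star_eq_conjTranspose, diagonal_conjTranspose]
    congr 2
  simpa [star_eq_conjTranspose] using h

/-- A Davis–Kahan bound: the part of `A` on `S` lies within distance `ρ₁` of `c` and that of `B`
on `S'` at distance at least `ρ₂` from `c`. -/
theorem opNorm_cfc_indicator_mul_le (hA : A.IsHermitian) (hB : B.IsHermitian) {S S' : Set ℝ}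
    {c ρ₁ ρ₂ : ℝ} (h₁ : 0 ≤ ρ₁) (h₂ : 0 < ρ₂)
    (hS : ∀ i, hA.eigenvalues i ∈ S → |hA.eigenvalues i - c| ≤ ρ₁)
    (hS' : ∀ i, hB.eigenvalues i ∈ S' → ρ₂ ≤ |hB.eigenvalues i - c|) :
    (ρ₂ - ρ₁) * opNorm (hB.cfc (S'.indicator fun _ => 1) * hA.cfc (S.indicator fun _ => 1))
      ≤ opNorm (A - B) := by
  classical
  set P := hA.cfc (S.indicator fun _ => 1) with hP
  set Q := hB.cfc (S'.indicator fun _ => 1) with hQ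
  set g : ℝ → ℝ := fun x => (S'.indicator fun _ => 1) x / (x - c) with hg
  set M := hA.cfc (fun x => (x - c) * (S.indicator fun _ => 1) x) with hM
  have hPle : opNorm P ≤ 1 := opNorm_cfc_le hA zero_le_one fun i => by
    by_cases h : hA.eigenvalues i ∈ S <;> simp [h]
  have hMle : opNorm M ≤ ρ₁ := opNorm_cfc_le hA h₁ fun i => by
    by_cases h : hA.eigenvalues i ∈ S
    · simpa [h] using hS i h
    · simpa [h] using h₁
  have hgle : opNorm (hB.cfc g) ≤ 1 / ρ₂ := opNorm_cfc_le hB (by positivity) fun i => by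
    by_cases h : hB.eigenvalues i ∈ S'
    · simp only [hg, h, Set.indicator_of_mem, abs_div, abs_one]
      exact one_div_le_one_div_of_le h₂ (hS' i h)
    · simp only [hg, h, not_false_eq_true, Set.indicator_of_notMem, zero_div, abs_zero]
      positivity
  have hgQ : hB.cfc g * Q = hB.cfc g := by
    rw [hQ, cfc_mul_cfc]
    refine cfc_congr_eigenvalues hB fun i => ?_
    by_cases h : hB.eigenvalues i ∈ S' <;> simp [hg, h]
  have hgB : hB.cfc g * (B - c • 1) = Q := by
    rw [← cfc_sub_const hB, cfc_mul_cfc]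
    refine cfc_congr_eigenvalues hB fun i => ?_
    by_cases h : hB.eigenvalues i ∈ S'
    · have := (hS' i h).trans_lt' h₂
      have : hB.eigenvalues i - c ≠ 0 := abs_pos.1 this
      simp [hg, h, this]
    · simp [hg, h]
  have hAP : (A - c • 1) * P = P * M := by
    rw [← cfc_sub_const hA, hP, hM, cfc_mul_cfc, cfc_mul_cfc]
    refine cfc_congr_eigenvalues hA fun i => ?_
    by_cases h : hA.eigenvalues i ∈ S <;> simp [h]
  -- With g = 1/(x - c) on `S'`, the product X = QP satisfies the linear equation X = g(B)((B - A)P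
  -- + X M). Since ‖g(B)‖ ≤ 1/ρ₂ and ‖M‖ ≤ ρ₁, taking norms and solving for ‖X‖ gives the bound.
  have hX : Q * P = hB.cfc g * ((B - A) * P + (Q * P) * M) := by
    calc Q * P = hB.cfc g * (B - c • 1) * P := by rw [hgB]
      _ = hB.cfc g * ((B - A) * P) + hB.cfc g * ((A - c • 1) * P) := by
        rw [← mul_add, ← add_mul, mul_assoc]; congr 2; abel
      _ = hB.cfc g * ((B - A) * P) + hB.cfc g * Q * (P * M) := by rw [hAP, hgQ]
      _ = _ := by rw [mul_add]; simp only [mul_assoc]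
  have h3 : opNorm (Q * P) ≤ 1 / ρ₂ * (opNorm (A - B) + opNorm (Q * P) * ρ₁) := by
    conv_lhs => rw [hX]
    refine (opNorm_mul_le _ _).trans ?_
    refine mul_le_mul hgle ?_ (opNorm_nonneg _) (by positivity)
    refine (opNorm_add_le _ _).trans (add_le_add ?_ ?_)
    · refine (opNorm_mul_le _ _).trans ?_
      rw [opNorm_sub_comm]
      exact mul_le_of_le_one_right (opNorm_nonneg _) hPle
    · exact (opNorm_mul_le _ _).trans (mul_le_mul_of_nonneg_left hMle (opNorm_nonneg _))
  rw [one_div, inv_mul_eq_div, le_div_iff₀ h₂] at h3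
  linarith

/-- The difference of the projectors splits into two mixed products, each inside-times-outside. Both
are measured from the midpoint of [a, b]. In `Q' * P` the gap of `A` shrinks the inner radius to (b
- a)/2 - δ; in `P' * Q` it enlarges the outer radius to (b - a)/2 + δ. In either case the radii
differ by δ with no gap required of `B`. -/
theorem opNorm_cfc_indicator_Icc_sub_le (hA : A.IsHermitian) (hB : B.IsHermitian) {δ a b : ℝ}
    (hδ : 0 < δ) (hgap : ∀ i, δ ≤ |hA.eigenvalues i - a| ∧ δ ≤ |hA.eigenvalues i - b|) :
    opNorm (hA.cfc ((Set.Icc a b).indicator fun _ => 1)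
      - hB.cfc ((Set.Icc a b).indicator fun _ => 1)) ≤ 2 * opNorm (A - B) / δ := by
  set I := Set.Icc a b with hI
  have hsplit : ∀ {C : Matrix (Fin n) (Fin n) ℝ} (hC : C.IsHermitian),
      hC.cfc (I.indicator fun _ => 1) + hC.cfc (Iᶜ.indicator fun _ => 1) = 1 := by
    intro C hC
    rw [cfc_add_cfc, ← cfc_one_fun hC]
    refine cfc_congr_eigenvalues hC fun i => ?_
    by_cases h : hC.eigenvalues i ∈ I <;> simp [h]
  set P := hA.cfc (I.indicator fun _ => 1) with hP
  set P' := hB.cfc (I.indicator fun _ => 1) with hP'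
  set Q := hA.cfc (Iᶜ.indicator fun _ => 1) with hQ
  set Q' := hB.cfc (Iᶜ.indicator fun _ => 1) with hQ'
  have hdec : P - P' = Q' * P - P' * Q := by
    have h1 : P = (P' + Q') * P := by rw [hsplit hB, one_mul]
    have h2 : P' = P' * (P + Q) := by rw [hsplit hA, mul_one]
    rw [add_mul] at h1
    rw [mul_add] at h2
    nth_rewrite 1 [h1]
    nth_rewrite 2 [h2]
    abel
  have hnn := opNorm_nonneg (A - B)
  have hX : δ * opNorm (Q' * P) ≤ opNorm (A - B) := by
    rcases le_or_gt δ ((b - a) / 2) with h | h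
    · have := opNorm_cfc_indicator_mul_le hA hB (S := I) (S' := Iᶜ) (c := (a + b) / 2)
        (ρ₁ := (b - a) / 2 - δ) (ρ₂ := (b - a) / 2) (by linarith) (by linarith)
        (fun i hi => by
          obtain ⟨h1, h2⟩ := hgap i
          rw [hI, Set.mem_Icc] at hi
          rw [abs_of_nonneg (by linarith [hi.1])] at h1
          rw [abs_of_nonpos (by linarith [hi.2])] at h2
          rw [abs_le]; constructor <;> linarith)
        (fun i hi => by
          rw [hI, Set.mem_compl_iff, Set.mem_Icc, not_and_or, not_le, not_le] at hi
          rw [le_abs]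
          rcases hi with hi | hi
          · right; linarith
          · left; linarith)
      rwa [sub_sub_cancel] at this
    -- An eigenvalue inside [a, b] at distance δ from both ends forces b - a ≥ 2δ, so in this case
    -- `A` has none there.
    · have hP0 : P = 0 := by
        have : hA.cfc (fun _ => (0 : ℝ)) = 0 := by
          have h1 := opNorm_cfc_le hA (f := fun _ => 0) le_rfl (fun i => by simp)
          open scoped Matrix.Norms.L2Operator in
          rw [opNorm_eq_norm] at h1
          exact norm_le_zero_iff.1 h1
        rw [hP, ← this]
        refine cfc_congr_eigenvalues hA fun i => ?_
        refine Set.indicator_of_notMem (fun hi => ?_) _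
        obtain ⟨h1, h2⟩ := hgap i
        rw [hI, Set.mem_Icc] at hi
        rw [abs_of_nonneg (by linarith [hi.1])] at h1
        rw [abs_of_nonpos (by linarith [hi.2])] at h2
        linarith
      rw [hP0, mul_zero, opNorm_zero, mul_zero]
      exact hnn
  have hX' : δ * opNorm (P' * Q) ≤ opNorm (A - B) := by
    rcases le_or_gt a b with h | h
    · have := opNorm_cfc_indicator_mul_le hB hA (S := I) (S' := Iᶜ) (c := (a + b) / 2)
        (ρ₁ := (b - a) / 2) (ρ₂ := (b - a) / 2 + δ) (by linarith) (by linarith)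
        (fun i hi => by
          rw [hI, Set.mem_Icc] at hi
          rw [abs_le]; constructor <;> linarith [hi.1, hi.2])
        (fun i hi => by
          obtain ⟨h1, h2⟩ := hgap i
          rw [hI, Set.mem_compl_iff, Set.mem_Icc, not_and_or, not_le, not_le] at hi
          rw [le_abs]
          rcases hi with hi | hi
          · rw [abs_of_nonpos (by linarith)] at h1
            right; linarith
          · rw [abs_of_nonneg (by linarith)] at h2
            left; linarith)
      rw [add_sub_cancel_left, opNorm_sub_comm] at this
      rw [← opNorm_transpose, transpose_mul, hP', hQ, cfc_transpose, cfc_transpose]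
      exact this
    · have hP0 : P' = 0 := by
        rw [hP', hI, Set.Icc_eq_empty (not_le.2 h), Set.indicator_empty]
        have h1 := opNorm_cfc_le hB (f := fun _ => 0) le_rfl (fun i => by simp)
        open scoped Matrix.Norms.L2Operator in
        rw [opNorm_eq_norm] at h1
        exact norm_le_zero_iff.1 h1
      rw [hP0, zero_mul, opNorm_zero, mul_zero]
      exact hnn
  rw [le_div_iff₀ hδ, hdec]
  have := opNorm_sub_le (Q' * P) (P' * Q)
  nlinarith

end Cfc

theorem opNorm_gramProj_sub_le {N n : ℕ} (Y Y' : Matrix (Fin N) (Fin n) ℝ) {δ a b : ℝ}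
    (hδ : 0 < δ) (hgap : GramGap Y δ a b ∨ GramGap Y' δ a b) :
    opNorm (gramProj Y (Set.Icc a b) - gramProj Y' (Set.Icc a b))
      ≤ 2 * opNorm (ckGram Y - ckGram Y') / δ := by
  have key : ∀ Y Y' : Matrix (Fin N) (Fin n) ℝ, GramGap Y δ a b →
      opNorm (gramProj Y (Set.Icc a b) - gramProj Y' (Set.Icc a b))
        ≤ 2 * opNorm (ckGram Y - ckGram Y') / δ := fun Y Y' h =>
    -- `GramGap` speaks of the ordered list `eigenvalues₀`, whereas `cfc` uses `eigenvalues`, the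
    -- same list reindexed through an equivalence with `Fin`.
    opNorm_cfc_indicator_Icc_sub_le _ _ hδ fun i =>
      h (Fin.cast (Fintype.card_fin n) ((Fintype.equivOfCardEq (Fintype.card_fin _)).symm i))
  rcases hgap with h | h
  · exact key Y Y' h
  · rw [opNorm_sub_comm, opNorm_sub_comm (ckGram Y)]
    exact key Y' Y h

/-- By Weyl's inequality every ordered eigenvalue moves by less than δ, hence none crosses an
endpoint: the two sets of indices coincide. -/
theorem gramCount_eq_of_lt {N n : ℕ} (Y Y' : Matrix (Fin N) (Fin n) ℝ) {δ a b : ℝ}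
    (hgap : GramGap Y δ a b ∨ GramGap Y' δ a b) (hlt : opNorm (ckGram Y - ckGram Y') < δ) :
    gramCount Y (Set.Icc a b) = gramCount Y' (Set.Icc a b) := by
  have key : ∀ Y Y' : Matrix (Fin N) (Fin n) ℝ, GramGap Y δ a b →
      opNorm (ckGram Y - ckGram Y') < δ →
      gramCount Y (Set.Icc a b) = gramCount Y' (Set.Icc a b) := by
    intro Y Y' h hlt
    rw [gramCount, gramCount]
    congr 1
    ext i
    have h0 := (abs_gramEig_sub_le Y Y' i).trans_lt hlt
    obtain ⟨h1, h2⟩ := h i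
    rw [abs_lt] at h0
    rw [le_abs] at h1 h2
    simp only [Set.mem_ofPred_eq, Set.mem_Icc]
    constructor
    · rintro ⟨h3, h4⟩
      constructor
      · rcases h1 with h1 | h1 <;> linarith
      · rcases h2 with h2 | h2 <;> linarith
    · rintro ⟨h3, h4⟩
      constructor
      · rcases h1 with h1 | h1 <;> linarith
      · rcases h2 with h2 | h2 <;> linarith
  rcases hgap with h | h
  · exact key Y Y' h hlt
  · rw [opNorm_sub_comm] at hlt
    exact (key Y' Y h hlt).symm

theorem opNorm_ckGram_sub_le {N n : ℕ} (Y Y' : Matrix (Fin N) (Fin n) ℝ) :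
    opNorm (ckGram Y - ckGram Y') ≤ (opNorm Y + opNorm Y') * opNorm (Y - Y') := by
  have h : ckGram Y - ckGram Y' = Yᵀ * (Y - Y') + (Y - Y')ᵀ * Y' := by
    simp only [ckGram, Matrix.mul_sub, transpose_sub, Matrix.sub_mul]; abel
  rw [h]
  refine (opNorm_add_le _ _).trans ?_
  have h1 := opNorm_mul_le Yᵀ (Y - Y')
  have h2 := opNorm_mul_le (Y - Y')ᵀ Y'
  rw [opNorm_transpose] at h1 h2
  linarith

/-! ### Concentration of Lipschitz functions and linear forms -/

theorem norm_fderiv_le_of_abs_sub_le {E : Type*} [NormedAddCommGroup E] [InnerProductSpace ℝ E]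
    {G : E → ℝ} {K : ℝ} (hK : 0 ≤ K)
    (h : ∀ z z', |G z - G z'| ≤ K * ‖z - z'‖) (x : E) : ‖fderiv ℝ G x‖ ≤ K := by
  have : LipschitzWith ⟨K, hK⟩ G := LipschitzWith.of_dist_le_mul fun z z' => by
    rw [Real.dist_eq, dist_eq_norm]; exact h z z'
  exact norm_fderiv_le_of_lipschitz ℝ this

section Lipschitz

variable {E : Type*} [NormedAddCommGroup E] [InnerProductSpace ℝ E] [FiniteDimensional ℝ E]
  [MeasurableSpace E] [BorelSpace E]

theorem stdGaussian_map_inner (a : E) :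
    (stdGaussian E).map (fun z => inner ℝ a z)
      = (gaussianReal 0 1).map (fun x => ‖a‖ * x) := by
  have h1 : (fun z => inner ℝ a z) = ⇑(innerSL ℝ a) := by ext; simp
  rw [h1, IsGaussian.map_eq_gaussianReal, integral_strongDual_stdGaussian,
    variance_dual_stdGaussian, gaussianReal_map_const_mul]
  congr 1
  · simp
  · ext; simp

theorem integral_comp_inner_stdGaussian {f : ℝ → ℝ} (hf : Measurable f) (a : E) :
    ∫ z, f (inner ℝ a z) ∂(stdGaussian E) = ∫ x, f (‖a‖ * x) ∂(gaussianReal 0 1) := by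
  rw [← integral_map (φ := fun z : E => inner ℝ a z) (by fun_prop) hf.aestronglyMeasurable,
    stdGaussian_map_inner, integral_map (by fun_prop) hf.aestronglyMeasurable]

theorem stdGaussian_inner_ge_le {a : E} {t K : ℝ} (hK : 0 < K) (ha : ‖a‖ ≤ K) (ht : 0 ≤ t) :
    (stdGaussian E) {z | t ≤ inner ℝ a z} ≤ ENNReal.ofReal (Real.exp (-(t ^ 2 / (8 * K ^ 2)))) := by
  have h := stdGaussian_ge_le (E := E) (G := fun z => inner ℝ a z) (innerSL ℝ a).differentiable hK
    (norm_fderiv_le_of_abs_sub_le hK.le fun z z' => by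
      rw [← inner_sub_right]
      exact (abs_real_inner_le_norm _ _).trans (by gcongr)) ht
  have h0 : ∫ z, inner ℝ a z ∂(stdGaussian E) = 0 := by
    have := integral_strongDual_stdGaussian (innerSL ℝ a)
    simpa using this
  simpa only [h0, sub_zero] using h

theorem stdGaussian_abs_inner_ge_le {a : E} {t : ℝ} (ha : ‖a‖ ≤ 1) (ht : 0 ≤ t) :
    (stdGaussian E) {z | t ≤ |inner ℝ a z|} ≤ 2 * ENNReal.ofReal (Real.exp (-(t ^ 2 / 8))) := by
  have h1 := stdGaussian_inner_ge_le one_pos ha ht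
  have h2 := stdGaussian_inner_ge_le (a := -a) one_pos (by simpa using ha) ht
  have h3 : {z : E | t ≤ |inner ℝ a z|} ⊆ {z | t ≤ inner ℝ a z} ∪ {z | t ≤ inner ℝ (-a) z} := by
    intro z hz
    simp only [Set.mem_ofPred_eq, Set.mem_union, inner_neg_left] at hz ⊢
    exact le_abs.1 hz
  refine (measure_mono h3).trans ((measure_union_le _ _).trans ?_)
  rw [two_mul]
  simp only [one_pow, mul_one] at h1 h2
  exact add_le_add h1 h2

end Lipschitz

/-! ### One-dimensional Gaussian integrals -/

theorem integrable_exp_mul_sq_gaussianReal {s : ℝ} (hs : s < 1 / 2) :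
    Integrable (fun x => Real.exp (s * x ^ 2)) (gaussianReal 0 1) ∧
    ∫ x, Real.exp (s * x ^ 2) ∂(gaussianReal 0 1) = (√(1 - 2 * s))⁻¹ := by
  have h1 : ∀ x : ℝ, gaussianPDFReal 0 1 x • Real.exp (s * x ^ 2)
      = (√(2 * Real.pi))⁻¹ * Real.exp (-(1 / 2 - s) * x ^ 2) := by
    intro x
    simp only [gaussianPDFReal, NNReal.coe_one, mul_one, sub_zero, smul_eq_mul]
    rw [mul_assoc, ← Real.exp_add]
    congr 2; ring
  constructor
  · rw [gaussianReal_of_var_ne_zero 0 one_ne_zero]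
    rw [integrable_withDensity_iff_integrable_smul₀' (by fun_prop) (ae_of_all _ fun _ => by
      simp [gaussianPDF])]
    simp_rw [toReal_gaussianPDF, h1]
    exact (integrable_exp_neg_mul_sq (by linarith)).const_mul _
  · rw [integral_gaussianReal_eq_integral_smul one_ne_zero]
    simp_rw [h1]
    rw [integral_const_mul, integral_gaussian, ← Real.sqrt_inv, ← Real.sqrt_inv,
      ← Real.sqrt_mul (by positivity)]
    congr 1
    have : 1 - 2 * s ≠ 0 := by linarith
    have : 1 / 2 - s ≠ 0 := by linarith
    field_simp

theorem inv_sqrt_one_sub_le {s : ℝ} (hs : |s| ≤ 1 / 4) :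
    (√(1 - 2 * s))⁻¹ ≤ Real.exp (s + 4 * s ^ 2) := by
  obtain ⟨h1, h2⟩ := abs_le.1 hs
  have h3 : 0 < 1 - 2 * s := by linarith
  rw [← Real.sqrt_inv]
  refine Real.sqrt_le_iff.2 ⟨(Real.exp_pos _).le, ?_⟩
  rw [← Real.exp_nat_mul]
  -- Multiplying out, (1 + 2s + 8s²)(1 - 2s) = 1 + 4s²(1 - 4s), which is at least 1 because s ≤ 1/4.
  have h4 : (1 - 2 * s)⁻¹ ≤ (2 * s + 8 * s ^ 2) + 1 := by
    rw [inv_le_iff_one_le_mul₀ h3]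
    nlinarith [mul_nonneg (sq_nonneg s) (by linarith : (0 : ℝ) ≤ 1 - 4 * s)]
  refine h4.trans ((Real.add_one_le_exp _).trans (Real.exp_le_exp.2 (le_of_eq ?_)))
  push_cast; ring

/-- Exponential moments of a centered weighted chi-square. -/
theorem lintegral_exp_sum_sq_sub_one_le {ι : Type*} [Fintype ι] {c : ι → ℝ}
    (hc : ∀ i, |c i| ≤ 1 / 4) :
    ∫⁻ z, ENNReal.ofReal (Real.exp (∑ i, c i * (z i ^ 2 - 1))) ∂(stdGaussian (EuclideanSpace ℝ ι))
      ≤ ENNReal.ofReal (Real.exp (4 * ∑ i, c i ^ 2)) := by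
  rw [← map_pi_eq_stdGaussian, lintegral_map (by fun_prop) (by fun_prop)]
  have hi : ∀ i, Integrable (fun x => Real.exp (c i * (x ^ 2 - 1))) (gaussianReal 0 1) ∧
      ∫ x, Real.exp (c i * (x ^ 2 - 1)) ∂(gaussianReal 0 1) ≤ Real.exp (4 * c i ^ 2) := by
    intro i
    have h0 : ∀ x : ℝ, Real.exp (c i * (x ^ 2 - 1))
        = Real.exp (c i * x ^ 2) * Real.exp (-c i) := by
      intro x; rw [← Real.exp_add]; congr 1; ring
    have h1 := integrable_exp_mul_sq_gaussianReal (s := c i) (by linarith [(abs_le.1 (hc i)).2])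
    simp_rw [h0]
    refine ⟨h1.1.mul_const _, ?_⟩
    rw [integral_mul_const, h1.2]
    refine (mul_le_mul_of_nonneg_right (inv_sqrt_one_sub_le (hc i)) (Real.exp_pos _).le).trans ?_
    rw [← Real.exp_add]
    exact Real.exp_le_exp.2 (by linarith)
  have hprod : ∀ z : ι → ℝ, Real.exp (∑ i, c i * (z i ^ 2 - 1))
      = ∏ i, Real.exp (c i * (z i ^ 2 - 1)) := fun z => Real.exp_sum _ _
  have hint : Integrable (fun z : ι → ℝ => ∏ i, Real.exp (c i * (z i ^ 2 - 1)))
      (Measure.pi fun _ => gaussianReal 0 1) :=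
    Integrable.fintype_prod (f := fun i x => Real.exp (c i * (x ^ 2 - 1))) fun i => (hi i).1
  simp only [hprod]
  rw [← ofReal_integral_eq_lintegral_ofReal hint
    (ae_of_all _ fun z => Finset.prod_nonneg fun i _ => (Real.exp_pos _).le),
    integral_fintype_prod_eq_prod (f := fun i x => Real.exp (c i * (x ^ 2 - 1)))]
  refine ENNReal.ofReal_le_ofReal ?_
  rw [Finset.mul_sum, Real.exp_sum]
  exact Finset.prod_le_prod (fun i _ => integral_nonneg fun x => (Real.exp_pos _).le)
    fun i _ => (hi i).2

/-- The integrands differ by at most L |s - s'| |x|, and E|ξ| ≤ 1 because |x| ≤ (1 + x²)/2. This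
makes the conditional mean of a feature a Lipschitz function of the normalized row norm. -/
theorem abs_integral_comp_mul_sub_le {f : ℝ → ℝ} {L : ℝ} (hf : Measurable f)
    (hL : ∀ x y, |f x - f y| ≤ L * |x - y|) (hL0 : 0 ≤ L) (s s' : ℝ) :
    |∫ x, f (s * x) ∂(gaussianReal 0 1) - ∫ x, f (s' * x) ∂(gaussianReal 0 1)|
      ≤ L * |s - s'| := by
  have hid : Integrable (fun x : ℝ => x) (gaussianReal 0 1) := IsGaussian.integrable_id
  have hi : ∀ s : ℝ, Integrable (fun x => f (s * x)) (gaussianReal 0 1) := by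
    intro s
    refine ((integrable_const |f 0|).add ((hid.abs.const_mul (L * |s|)))).mono'
      (hf.comp (measurable_const_mul s)).aestronglyMeasurable (ae_of_all _ fun x => ?_)
    have h1 := hL (s * x) 0
    have h2 := abs_sub_abs_le_abs_sub (f (s * x)) (f 0)
    rw [sub_zero, abs_mul, ← mul_assoc] at h1
    simp only [Real.norm_eq_abs, Pi.add_apply]
    linarith
  have hsq : Integrable (fun x : ℝ => x ^ 2) (gaussianReal 0 1) :=
    (memLp_id_gaussianReal (μ := 0) (v := 1) 2).integrable_sq
  have h2 : ∫ x, x ^ 2 ∂(gaussianReal 0 1) = 1 := by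
    have := variance_fun_id_gaussianReal (μ := 0) (v := 1)
    rw [variance_eq_integral (by fun_prop)] at this
    simpa using this
  have h1 : ∫ x, |x| ∂(gaussianReal 0 1) ≤ 1 := by
    calc ∫ x, |x| ∂(gaussianReal 0 1) ≤ ∫ x, (1 / 2 * (1 : ℝ) + 1 / 2 * x ^ 2) ∂(gaussianReal 0 1) :=
          integral_mono hid.abs ((integrable_const _).add (hsq.const_mul _)) fun x => by
            simp only
            nlinarith [sq_abs x, sq_nonneg (|x| - 1)]
      _ = 1 := by
          rw [integral_add (integrable_const _) (hsq.const_mul _), integral_const_mul,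
            integral_const_mul, h2]
          simp; norm_num
  rw [← integral_sub (hi s) (hi s')]
  refine abs_integral_le_integral_abs.trans ?_
  calc ∫ x, |f (s * x) - f (s' * x)| ∂(gaussianReal 0 1)
      ≤ ∫ x, L * |s - s'| * |x| ∂(gaussianReal 0 1) := by
        refine integral_mono ((hi s).sub (hi s')).abs (hid.abs.const_mul _) fun x => ?_
        refine (hL _ _).trans (le_of_eq ?_)
        rw [← sub_mul, abs_mul, mul_assoc]
    _ ≤ L * |s - s'| := by
        rw [integral_const_mul]
        exact mul_le_of_le_one_right (by positivity) h1

/-! ### Gaussian matrices -/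

/-- The matrix with the given family of entries. -/
def toMat {p q : ℕ} (z : EuclideanSpace ℝ (Fin p × Fin q)) : Matrix (Fin p) (Fin q) ℝ :=
  Matrix.of fun i j => z (i, j)

section GaussMatrix

variable {p q : ℕ}

theorem toMat_sub (z z' : EuclideanSpace ℝ (Fin p × Fin q)) :
    toMat (z - z') = toMat z - toMat z' := by
  ext; simp [toMat]

theorem continuous_toMat : Continuous (toMat : EuclideanSpace ℝ (Fin p × Fin q) → _) := by
  refine continuous_matrix fun i j => ?_
  simp only [toMat, Matrix.of_apply]
  fun_prop

theorem sqrt_sum_sq_toMat (z : EuclideanSpace ℝ (Fin p × Fin q)) :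
    √(∑ i, ∑ j, toMat z i j ^ 2) = ‖z‖ := by
  rw [EuclideanSpace.norm_eq, Fintype.sum_prod_type]
  simp [toMat]

theorem sqrt_sum_sq_mul_le {l m n : ℕ} (A : Matrix (Fin l) (Fin m) ℝ)
    (B : Matrix (Fin m) (Fin n) ℝ) :
    √(∑ i, ∑ j, (A * B) i j ^ 2) ≤ opNorm A * √(∑ i, ∑ j, B i j ^ 2) := by
  rw [Real.sqrt_le_left (by have := opNorm_nonneg A; positivity), mul_pow,
    Real.sq_sqrt (by positivity), Finset.sum_comm, Finset.sum_comm (f := fun i j => B i j ^ 2),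
    Finset.mul_sum]
  refine Finset.sum_le_sum fun j _ => ?_
  have h := norm_toEuclideanLin_le A (WithLp.toLp 2 fun k => B k j)
  have h2 := pow_le_pow_left₀ (norm_nonneg _) h 2
  rw [mul_pow, EuclideanSpace.real_norm_sq_eq, EuclideanSpace.real_norm_sq_eq] at h2
  simpa [mulVec, dotProduct, Matrix.mul_apply] using h2

theorem dotProduct_toMat_mulVec (z : EuclideanSpace ℝ (Fin p × Fin q)) (x : Fin p → ℝ)
    (y : Fin q → ℝ) :
    x ⬝ᵥ (toMat z *ᵥ y)
      = inner ℝ (WithLp.toLp 2 fun k : Fin p × Fin q => x k.1 * y k.2) z := by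
  simp only [EuclideanSpace.inner_eq_star_dotProduct, dotProduct, mulVec, toMat, Matrix.of_apply,
    Fintype.sum_prod_type, Finset.mul_sum, Pi.star_apply, star_trivial]
  refine Finset.sum_congr rfl fun i _ => Finset.sum_congr rfl fun j _ => by ring

theorem norm_outer (x : Fin p → ℝ) (y : Fin q → ℝ) :
    ‖(WithLp.toLp 2 fun k : Fin p × Fin q => x k.1 * y k.2 : EuclideanSpace ℝ (Fin p × Fin q))‖
      = ‖(WithLp.toLp 2 x : EuclideanSpace ℝ (Fin p))‖
        * ‖(WithLp.toLp 2 y : EuclideanSpace ℝ (Fin q))‖ := by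
  rw [EuclideanSpace.norm_eq, EuclideanSpace.norm_eq, EuclideanSpace.norm_eq,
    ← Real.sqrt_mul (by positivity), Fintype.sum_prod_type, Finset.sum_mul_sum]
  simp [mul_pow]

/-- Union bound over the product of two nets: it reduces an operator norm tail to the tail of a
single bilinear form, at the price of the factor 5^(p+q). -/
theorem measure_opNorm_ge_le {α : Type*} [MeasurableSpace α] {ν : Measure α}
    (A : α → Matrix (Fin p) (Fin q) ℝ) {t : ℝ} {b : ENNReal}
    (h : ∀ (x : EuclideanSpace ℝ (Fin p)) (y : EuclideanSpace ℝ (Fin q)), ‖x‖ ≤ 2 → ‖y‖ ≤ 2 →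
      ν {a | t ≤ x.ofLp ⬝ᵥ (A a *ᵥ y.ofLp)} ≤ b) :
    ν {a | t ≤ opNorm (A a)} ≤ 5 ^ (p + q) * b := by
  obtain ⟨S, hSc, hS2, hS⟩ := exists_net p
  obtain ⟨T, hTc, hT2, hT⟩ := exists_net q
  have h1 : {a | t ≤ opNorm (A a)}
      ⊆ ⋃ x ∈ S ×ˢ T, {a | t ≤ x.1.ofLp ⬝ᵥ (A a *ᵥ x.2.ofLp)} := by
    intro a ha
    obtain ⟨x, hx, y, hy, hxy⟩ := exists_net_opNorm_le hS hT (A a)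
    simp only [Set.mem_iUnion]
    exact ⟨(x, y), Finset.mk_mem_product hx hy, le_trans ha hxy⟩
  refine (measure_mono h1).trans ((measure_biUnion_finset_le _ _).trans ?_)
  calc _ ≤ ∑ _x ∈ S ×ˢ T, b := Finset.sum_le_sum fun x hx => by
        rw [Finset.mem_product] at hx
        exact h _ _ (hS2 _ hx.1) (hT2 _ hx.2)
    _ = ((S.card * T.card : ℕ) : ENNReal) * b := by simp
    _ ≤ _ := by
        gcongr
        calc ((S.card * T.card : ℕ) : ENNReal) ≤ ((5 ^ p * 5 ^ q : ℕ) : ENNReal) := by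
              exact_mod_cast Nat.mul_le_mul hSc hTc
          _ = _ := by push_cast; rw [pow_add]

theorem stdGaussian_opNorm_ge_le {t : ℝ} (ht : 0 ≤ t) :
    (stdGaussian (EuclideanSpace ℝ (Fin p × Fin q))) {z | t ≤ opNorm (toMat z)}
      ≤ 5 ^ (p + q) * ENNReal.ofReal (Real.exp (-(t ^ 2 / 128))) := by
  refine measure_opNorm_ge_le _ fun x y hx hy => ?_
  simp only [dotProduct_toMat_mulVec]
  -- Net points have norm at most 2, so the coefficient vector of the bilinear form has norm at most
  -- 4, and 8 · 4² = 128.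
  have := stdGaussian_inner_ge_le (K := 4) (by norm_num) (t := t)
    (a := (WithLp.toLp 2 fun k : Fin p × Fin q => x.ofLp k.1 * y.ofLp k.2)) (by
      rw [norm_outer]
      simp only [WithLp.toLp_ofLp]
      nlinarith [norm_nonneg x, norm_nonneg y]) ht
  norm_num at this ⊢
  exact this

theorem stdGaussian_abs_mulVec_ge_le {t : ℝ} (ht : 0 ≤ t) (i : Fin p) {u : Fin q → ℝ}
    (hu : u ⬝ᵥ u ≤ 1) :
    (stdGaussian (EuclideanSpace ℝ (Fin p × Fin q))) {z | t ≤ |(toMat z *ᵥ u) i|}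
      ≤ 2 * ENNReal.ofReal (Real.exp (-(t ^ 2 / 8))) := by
  have h1 : ∀ z : EuclideanSpace ℝ (Fin p × Fin q), (toMat z *ᵥ u) i
      = inner ℝ (WithLp.toLp 2 fun k : Fin p × Fin q => (Pi.single i 1 : Fin p → ℝ) k.1 * u k.2)
        z := by
    intro z
    rw [← dotProduct_toMat_mulVec, single_one_dotProduct]
  simp only [h1]
  refine stdGaussian_abs_inner_ge_le ?_ ht
  rw [norm_outer]
  rw [dotProduct_eq_norm_sq, sq_le_one_iff₀ (norm_nonneg _)] at hu
  simpa using hu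

/-- Squared row norms of a Gaussian matrix concentrate around their mean. -/
theorem stdGaussian_row_sq_ge_le (hq : 0 < q) (i : Fin p) (t : ℝ) :
    (stdGaussian (EuclideanSpace ℝ (Fin p × Fin q))) {z | t / √q ≤ |(∑ k, toMat z i k ^ 2) / q - 1|}
      ≤ 2 * ENNReal.ofReal (Real.exp (1 / 4 - t / 4)) := by
  have hq' : (0 : ℝ) < q := by exact_mod_cast hq
  have hsq : √(q : ℝ) ^ 2 = q := Real.sq_sqrt hq'.le
  have hs0 : 0 < √(q : ℝ) := Real.sqrt_pos.2 hq'
  have hs1 : 1 ≤ √(q : ℝ) := Real.one_le_sqrt.2 (by exact_mod_cast hq)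
  have key : ∀ e : ℝ, |e| = 1 → (stdGaussian (EuclideanSpace ℝ (Fin p × Fin q)))
      {z | √q * t ≤ e * (∑ k, toMat z i k ^ 2 - q)}
      ≤ ENNReal.ofReal (Real.exp (1 / 4 - t / 4)) := by
    intro e he
    have hm : Measurable fun z : EuclideanSpace ℝ (Fin p × Fin q) =>
        e * (∑ k, toMat z i k ^ 2 - q) := by
      simp only [toMat, Matrix.of_apply]
      fun_prop
    -- With this parameter each coefficient is at most 1/4, the squared coefficients of the row sum
    -- to 1/16, and the exponents become 4/16 = 1/4 and -t/4. The sign `e` selects the tail.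
    refine (measure_ge_le_exp_mul_lintegral hm (s := 1 / (4 * √q)) (by positivity) _).trans ?_
    have he2 : e ^ 2 = 1 := by rw [← sq_abs, he, one_pow]
    have h1 := lintegral_exp_sum_sq_sub_one_le (ι := Fin p × Fin q)
      (c := fun k => if k.1 = i then e / (4 * √q) else 0) (fun k => by
        split_ifs
        · rw [abs_div, he, abs_of_pos (by positivity)]
          exact one_div_le_one_div_of_le (by norm_num) (by linarith)
        · simp)
    have h2 : ∀ z : EuclideanSpace ℝ (Fin p × Fin q),
        ∑ k : Fin p × Fin q, (if k.1 = i then e / (4 * √q) else 0) * (z k ^ 2 - 1)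
        = 1 / (4 * √q) * (e * (∑ k, toMat z i k ^ 2 - q)) := by
      intro z
      simp only [Fintype.sum_prod_type, ite_mul, zero_mul]
      rw [Finset.sum_comm]
      simp only [Finset.sum_ite_eq', Finset.mem_univ, if_true, toMat, Matrix.of_apply]
      rw [← Finset.mul_sum, Finset.sum_sub_distrib]
      simp
      ring
    have h3 : ∑ k : Fin p × Fin q, (if k.1 = i then e / (4 * √q) else 0) ^ 2 = 1 / 16 := by
      simp only [Fintype.sum_prod_type, ite_pow]
      rw [Finset.sum_comm]
      simp [div_pow, he2, mul_pow, hsq]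
      field_simp
      norm_num
    simp only [h2, h3] at h1
    refine (mul_le_mul_right h1 _).trans ?_
    rw [← ENNReal.ofReal_mul (Real.exp_pos _).le, ← Real.exp_add]
    refine ENNReal.ofReal_le_ofReal (Real.exp_le_exp.2 (le_of_eq ?_))
    field_simp
    ring
  have hsub : {z : EuclideanSpace ℝ (Fin p × Fin q) |
        t / √q ≤ |(∑ k, toMat z i k ^ 2) / q - 1|}
      ⊆ {z | √q * t ≤ 1 * (∑ k, toMat z i k ^ 2 - q)}
        ∪ {z | √q * t ≤ -1 * (∑ k, toMat z i k ^ 2 - q)} := by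
    intro z hz
    simp only [Set.mem_ofPred_eq, Set.mem_union] at hz ⊢
    have h4 : t / √q * q = √q * t := by
      nth_rewrite 2 [← hsq]; field_simp
    have h5 : ((∑ k, toMat z i k ^ 2) / q - 1) * q = ∑ k, toMat z i k ^ 2 - q := by
      field_simp
    rcases le_abs.1 hz with h | h
    · left
      have := mul_le_mul_of_nonneg_right h hq'.le
      rw [h4, h5] at this
      linarith
    · right
      have := mul_le_mul_of_nonneg_right h hq'.le
      rw [h4, neg_mul, h5] at this
      linarith
  refine (measure_mono hsub).trans ((measure_union_le _ _).trans ?_)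
  rw [two_mul]
  exact add_le_add (key 1 (by simp)) (key (-1) (by simp))

/-- The image of a unit vector under a Gaussian matrix is not too short. -/
theorem stdGaussian_sum_mulVec_sq_le (hp : 0 < p) {u : Fin q → ℝ} (hu : u ⬝ᵥ u = 1) :
    (stdGaussian (EuclideanSpace ℝ (Fin p × Fin q)))
      {z | ∑ i, (toMat z *ᵥ u) i ^ 2 ≤ p / 60} ≤ ENNReal.ofReal (1 / 3) := by
  have hp' : (0 : ℝ) < p := by exact_mod_cast hp
  set γ := stdGaussian (EuclideanSpace ℝ (Fin p × Fin q))
  have hc : ∀ i, Continuous fun z : EuclideanSpace ℝ (Fin p × Fin q) => (toMat z *ᵥ u) i := by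
    intro i
    simp only [mulVec, dotProduct, toMat, Matrix.of_apply]
    fun_prop
  have hm : Measurable fun z : EuclideanSpace ℝ (Fin p × Fin q) =>
      -(60 / p * ∑ i, (toMat z *ᵥ u) i ^ 2) :=
    (continuous_const.mul (continuous_finsetSum _ fun i _ => (hc i).pow 2)).neg.measurable
  have hi : ∀ i, Integrable (fun z => (1 / p : ℝ) * Real.exp (-60 * (toMat z *ᵥ u) i ^ 2)) γ := by
    intro i
    refine Integrable.const_mul (Integrable.of_bound (C := 1) ?_ (ae_of_all _ fun z => ?_)) _
    · exact (Real.continuous_exp.comp (((hc i).pow 2).const_mul _)).aestronglyMeasurable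
    · rw [Real.norm_eq_abs, abs_of_pos (Real.exp_pos _), Real.exp_le_one_iff]
      nlinarith [sq_nonneg ((toMat z *ᵥ u) i)]
  -- The constant 60 makes 1 + 2 · 60 = 11² a perfect square; the final bound e/11 is below 1/3.
  have hone : ∀ i, ∫ z, Real.exp (-60 * (toMat z *ᵥ u) i ^ 2) ∂γ = 1 / 11 := by
    intro i
    have h1 : ∀ z : EuclideanSpace ℝ (Fin p × Fin q), (toMat z *ᵥ u) i
        = inner ℝ (WithLp.toLp 2 fun k : Fin p × Fin q =>
          (Pi.single i 1 : Fin p → ℝ) k.1 * u k.2) z := by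
      intro z
      rw [← dotProduct_toMat_mulVec, single_one_dotProduct]
    simp only [h1]
    rw [integral_comp_inner_stdGaussian (f := fun x => Real.exp (-60 * x ^ 2)) (by fun_prop),
      norm_outer]
    rw [dotProduct_eq_norm_sq, pow_eq_one_iff_of_nonneg (norm_nonneg _) two_ne_zero] at hu
    simp only [hu, PiLp.toLp_single, PiLp.norm_single, norm_one, one_mul]
    rw [(integrable_exp_mul_sq_gaussianReal (s := -60) (by norm_num)).2,
      show (1 : ℝ) - 2 * -60 = 11 ^ 2 by norm_num, Real.sqrt_sq (by norm_num)]
    norm_num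
  have hsub : {z : EuclideanSpace ℝ (Fin p × Fin q) | ∑ i, (toMat z *ᵥ u) i ^ 2 ≤ p / 60}
      ⊆ {z | -1 ≤ -(60 / p * ∑ i, (toMat z *ᵥ u) i ^ 2)} := by
    intro z hz
    simp only [Set.mem_ofPred_eq] at hz ⊢
    have : 60 / (p : ℝ) * ∑ i, (toMat z *ᵥ u) i ^ 2 ≤ 60 / p * (p / 60) := by gcongr
    rw [show 60 / (p : ℝ) * (p / 60) = 1 by field_simp] at this
    linarith
  refine (measure_mono hsub).trans
    ((measure_ge_le_exp_mul_lintegral hm zero_le_one (-1)).trans ?_)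
  -- Convexity replaces the exponential of the row average by the average of the exponentials, so
  -- only the law of each row is needed and not the independence of the rows.
  have hle : ∫⁻ z, ENNReal.ofReal (Real.exp (1 * -(60 / p * ∑ i, (toMat z *ᵥ u) i ^ 2))) ∂γ
      ≤ ENNReal.ofReal (1 / 11) := by
    calc _ ≤ ∫⁻ z, ENNReal.ofReal
          (∑ i, (1 / p : ℝ) * Real.exp (-60 * (toMat z *ᵥ u) i ^ 2)) ∂γ := by
          refine lintegral_mono fun z => ENNReal.ofReal_le_ofReal ?_
          have := convexOn_exp.map_sum_le (t := Finset.univ) (w := fun _ : Fin p => (1 / p : ℝ))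
            (p := fun i => -60 * (toMat z *ᵥ u) i ^ 2) (fun _ _ => by positivity)
            (by simp [hp'.ne']) (fun _ _ => Set.mem_univ _)
          simp only [smul_eq_mul] at this
          refine le_trans (le_of_eq ?_) this
          congr 1
          rw [← Finset.mul_sum, ← Finset.mul_sum]
          ring
      _ = ENNReal.ofReal (1 / 11) := by
          rw [← ofReal_integral_eq_lintegral_ofReal (integrable_finsetSum _ fun i _ => hi i)
            (ae_of_all _ fun z => Finset.sum_nonneg fun i _ => by positivity),
            integral_finsetSum _ fun i _ => hi i]
          simp only [integral_const_mul, hone]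
          congr 1
          simp
          field_simp
  refine (mul_le_mul_right hle _).trans ?_
  rw [← ENNReal.ofReal_mul (Real.exp_pos _).le]
  refine ENNReal.ofReal_le_ofReal ?_
  have := Real.exp_one_lt_d9
  rw [show -((1 : ℝ) * -1) = 1 by norm_num]
  linarith

end GaussMatrix

/-! ### Concentration of nonlinear features -/

section Features

variable {N d n : ℕ} {f : ℝ → ℝ} {L : ℝ}

theorem abs_sub_le_of_abs_deriv_le (hf : Differentiable ℝ f) (hL : ∀ x, |deriv f x| ≤ L) (x y : ℝ) :
    |f x - f y| ≤ L * |x - y| := by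
  simpa [Real.norm_eq_abs] using Convex.norm_image_sub_le_of_norm_deriv_le (f := f) (s := Set.univ)
    (fun x _ => hf x) (fun x _ => by simpa using hL x) convex_univ (Set.mem_univ y)
    (Set.mem_univ x)

theorem continuous_gaussianMean (hf : Differentiable ℝ f) (hL : ∀ x, |deriv f x| ≤ L) :
    Continuous fun s : ℝ => ∫ x, f (s * x) ∂(gaussianReal 0 1) := by
  have hL0 : 0 ≤ L := (abs_nonneg _).trans (hL 0)
  have : LipschitzWith ⟨L, hL0⟩ fun s : ℝ => ∫ x, f (s * x) ∂(gaussianReal 0 1) :=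
    LipschitzWith.of_dist_le_mul fun s s' => by
      simpa only [Real.dist_eq] using! abs_integral_comp_mul_sub_le hf.continuous.measurable
        (abs_sub_le_of_abs_deriv_le hf hL) hL0 s s'
  exact this.continuous

/-- The conditional mean of `f (W Z)` given `W`, where `Z` has i.i.d. `N(0, c²)` entries. -/
noncomputable def featureMean (f : ℝ → ℝ) (c : ℝ) (W : Matrix (Fin N) (Fin d) ℝ) (n : ℕ) :
    Matrix (Fin N) (Fin n) ℝ :=
  Matrix.of fun i _ => ∫ x, f (|c| * √(∑ k, W i k ^ 2) * x) ∂(gaussianReal 0 1)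

theorem mul_smul_toMat_apply (W : Matrix (Fin N) (Fin d) ℝ) (c : ℝ)
    (z : EuclideanSpace ℝ (Fin d × Fin n)) (i : Fin N) (j : Fin n) :
    (W * (c • toMat z)) i j
      = inner ℝ (WithLp.toLp 2 fun k : Fin d × Fin n => (c * W i k.1) * (Pi.single j 1 : Fin n → ℝ) k.2)
        z := by
  rw [← dotProduct_toMat_mulVec z (fun k => c * W i k)]
  simp [Matrix.mul_apply, dotProduct, mul_comm, mul_left_comm]

theorem integral_feature (hf : Differentiable ℝ f) (W : Matrix (Fin N) (Fin d) ℝ) (c : ℝ)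
    (i : Fin N) (j : Fin n) :
    ∫ z : EuclideanSpace ℝ (Fin d × Fin n), f ((W * (c • toMat z)) i j) ∂(stdGaussian _)
      = featureMean f c W n i j := by
  simp only [mul_smul_toMat_apply]
  rw [integral_comp_inner_stdGaussian hf.continuous.measurable, norm_outer (fun k => c * W i k)]
  simp only [PiLp.toLp_single, PiLp.norm_single, norm_one, mul_one,
    featureMean, Matrix.of_apply]
  congr! 5
  rw [EuclideanSpace.norm_eq]
  simp only [Real.norm_eq_abs, sq_abs, mul_pow]
  rw [← Finset.mul_sum, Real.sqrt_mul (sq_nonneg c), Real.sqrt_sq_eq_abs]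

theorem differentiable_feature (hf : Differentiable ℝ f) (W : Matrix (Fin N) (Fin d) ℝ) (c : ℝ)
    (i : Fin N) (j : Fin n) : Differentiable ℝ
      fun z : EuclideanSpace ℝ (Fin d × Fin n) => f ((W * (c • toMat z)) i j) := by
  simp only [mul_smul_toMat_apply]
  exact hf.comp (innerSL ℝ _).differentiable

theorem integrable_feature (hf : Differentiable ℝ f) (hL : ∀ x, |deriv f x| ≤ L)
    (W : Matrix (Fin N) (Fin d) ℝ) (c : ℝ) (i : Fin N) (j : Fin n) :
    Integrable (fun z : EuclideanSpace ℝ (Fin d × Fin n) => f ((W * (c • toMat z)) i j))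
      (stdGaussian _) := by
  have hL0 : 0 ≤ L := (abs_nonneg _).trans (hL 0)
  refine integrable_stdGaussian_of_fderiv_le (differentiable_feature hf W c i j)
    (norm_fderiv_le_of_abs_sub_le (K := L * ‖(WithLp.toLp 2 fun k : Fin d × Fin n =>
      (c * W i k.1) * (Pi.single j 1 : Fin n → ℝ) k.2 : EuclideanSpace ℝ (Fin d × Fin n))‖)
      (by positivity) fun z z' => ?_)
  refine (abs_sub_le_of_abs_deriv_le hf hL _ _).trans ?_
  rw [mul_smul_toMat_apply, mul_smul_toMat_apply, ← inner_sub_right, mul_assoc]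
  exact mul_le_mul_of_nonneg_left (abs_real_inner_le_norm _ _) hL0

theorem dotProduct_mulVec_eq_sum {p q : ℕ} (A : Matrix (Fin p) (Fin q) ℝ) (x : Fin p → ℝ)
    (y : Fin q → ℝ) : x ⬝ᵥ (A *ᵥ y) = ∑ i, ∑ j, x i * y j * A i j := by
  simp only [dotProduct, mulVec, Finset.mul_sum]
  exact Finset.sum_congr rfl fun i _ => Finset.sum_congr rfl fun j _ => by ring

/-- For fixed `W` a bilinear form in the features is 4Lκ-Lipschitz in the Gaussian vector: applying
f entrywise expands the Frobenius norm by at most L, left multiplication by cW by at most κ, and the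
two net vectors contribute 2 · 2. Gaussian concentration and the net bound then apply. -/
theorem stdGaussian_feature_sub_mean_ge_le (hf : Differentiable ℝ f) (hL0 : 0 < L)
    (hL : ∀ x, |deriv f x| ≤ L) (W : Matrix (Fin N) (Fin d) ℝ) {c κ : ℝ} (hκ : 0 < κ)
    (hW : |c| * opNorm W ≤ κ) {t : ℝ} (ht : 0 ≤ t) :
    (stdGaussian (EuclideanSpace ℝ (Fin d × Fin n)))
        {z | t ≤ opNorm ((W * (c • toMat z)).map f - featureMean f c W n)}
      ≤ 5 ^ (N + n) * ENNReal.ofReal (Real.exp (-(t ^ 2 / (128 * (L * κ) ^ 2)))) := by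
  refine measure_opNorm_ge_le _ fun x y hx hy => ?_
  set G : EuclideanSpace ℝ (Fin d × Fin n) → ℝ :=
    fun z => x.ofLp ⬝ᵥ ((W * (c • toMat z)).map f *ᵥ y.ofLp) with hG
  have hGsum : ∀ z, G z = ∑ i, ∑ j, x i * y j * f ((W * (c • toMat z)) i j) := fun z => by
    rw [hG]; simp only [dotProduct_mulVec_eq_sum, Matrix.map_apply]
  have hGd : Differentiable ℝ G := by
    rw [funext hGsum]
    exact Differentiable.fun_sum fun i _ => Differentiable.fun_sum fun j _ =>
      (differentiable_feature hf W c i j).const_mul _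
  have hmean : ∫ z, G z ∂(stdGaussian _) = x.ofLp ⬝ᵥ (featureMean f c W n *ᵥ y.ofLp) := by
    rw [funext hGsum, integral_finsetSum _ fun i _ => integrable_finsetSum _ fun j _ =>
      (integrable_feature hf hL W c i j).const_mul _, dotProduct_mulVec_eq_sum]
    refine Finset.sum_congr rfl fun i _ => ?_
    rw [integral_finsetSum _ fun j _ => (integrable_feature hf hL W c i j).const_mul _]
    refine Finset.sum_congr rfl fun j _ => ?_
    rw [integral_const_mul, integral_feature hf]
  have hlip : ∀ z z', |G z - G z'| ≤ (4 * (L * κ)) * ‖z - z'‖ := by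
    intro z z'
    set A := W * (c • toMat z)
    set A' := W * (c • toMat z')
    have h1 : G z - G z' = x.ofLp ⬝ᵥ ((A.map f - A'.map f) *ᵥ y.ofLp) := by
      rw [Matrix.sub_mulVec, dotProduct_sub]
    have h2 : opNorm (A.map f - A'.map f) ≤ L * κ * ‖z - z'‖ := by
      have h3 : √(∑ i, ∑ j, (A.map f - A'.map f) i j ^ 2) ≤ √(∑ i, ∑ j, L ^ 2 * (A - A') i j ^ 2) := by
        refine Real.sqrt_le_sqrt (Finset.sum_le_sum fun i _ => Finset.sum_le_sum fun j _ => ?_)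
        rw [← mul_pow, sq_le_sq, abs_mul, abs_of_pos hL0]
        exact abs_sub_le_of_abs_deriv_le hf hL _ _
      simp only [← Finset.mul_sum] at h3
      rw [Real.sqrt_mul (sq_nonneg L), Real.sqrt_sq hL0.le] at h3
      have h4 : A - A' = (c • W) * toMat (z - z') := by
        rw [toMat_sub]; simp [A, A', Matrix.mul_sub]
      have h5 := sqrt_sum_sq_mul_le (c • W) (toMat (z - z'))
      rw [← h4, sqrt_sum_sq_toMat, opNorm_smul] at h5
      refine (opNorm_le_sqrt_sum_sq _).trans (h3.trans ?_)
      rw [mul_assoc]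
      gcongr
      exact h5.trans (by gcongr)
    rw [h1]
    refine (abs_dotProduct_mulVec_le _ _ _).trans ?_
    simp only [WithLp.toLp_ofLp]
    have h6 : ‖x‖ * ‖y‖ ≤ 4 := by nlinarith [norm_nonneg x, norm_nonneg y]
    calc _ ≤ L * κ * ‖z - z'‖ * 4 := by
          gcongr
      _ = _ := by ring
  have h := stdGaussian_ge_le hGd (K := 4 * (L * κ)) (by positivity)
    (norm_fderiv_le_of_abs_sub_le (by positivity) hlip) ht
  rw [hmean] at h
  have h1 : ∀ z, G z - x.ofLp ⬝ᵥ (featureMean f c W n *ᵥ y.ofLp)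
      = x.ofLp ⬝ᵥ (((W * (c • toMat z)).map f - featureMean f c W n) *ᵥ y.ofLp) := by
    intro z
    rw [Matrix.sub_mulVec, dotProduct_sub]
  simp only [h1] at h
  rwa [show 8 * (4 * (L * κ)) ^ 2 = 128 * (L * κ) ^ 2 by ring] at h

/-- The conditional mean is a Gaussian integral dilated by the normalized row norm s, and |s - 1| ≤
|s² - 1| for s ≥ 0, so concentration of the squared row norm is enough. -/
theorem abs_featureMean_sub_le (hf : Differentiable ℝ f) (hL : ∀ x, |deriv f x| ≤ L) (hd : 0 < d)
    (W : Matrix (Fin N) (Fin d) ℝ) {η : ℝ} (i : Fin N) (j : Fin n)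
    (h : |(∑ k, W i k ^ 2) / d - 1| ≤ η) :
    |featureMean f (1 / √d) W n i j - ∫ x, f x ∂(gaussianReal 0 1)| ≤ L * η := by
  have hL0 : 0 ≤ L := (abs_nonneg _).trans (hL 0)
  have h1 := abs_integral_comp_mul_sub_le hf.continuous.measurable
    (abs_sub_le_of_abs_deriv_le hf hL) hL0 (|1 / √d| * √(∑ k, W i k ^ 2)) 1
  simp only [one_mul] at h1
  refine h1.trans (mul_le_mul_of_nonneg_left (le_trans ?_ h) hL0)
  set s := |1 / √(d : ℝ)| * √(∑ k, W i k ^ 2) with hs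
  have hs0 : 0 ≤ s := by positivity
  have hsq : (∑ k, W i k ^ 2) / d = s ^ 2 := by
    rw [hs, mul_pow, sq_abs, div_pow, Real.sq_sqrt (by positivity), Real.sq_sqrt (by positivity)]
    ring
  rw [hsq, show s ^ 2 - 1 = (s - 1) * (s + 1) by ring, abs_mul, abs_of_nonneg (by linarith : 0 ≤ s + 1)]
  nlinarith [abs_nonneg (s - 1)]

/-- The constant matrix. -/
def constMat (N n : ℕ) (a : ℝ) : Matrix (Fin N) (Fin n) ℝ := Matrix.of fun _ _ => a

/-- Nonlinear Gaussian features have operator norm of order `√N + √n` after centering. -/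
theorem prod_feature_sub_const_ge_le (hf : Differentiable ℝ f) (hL0 : 0 < L)
    (hL : ∀ x, |deriv f x| ≤ L) (hd : 0 < d) {κ τ t : ℝ} (hκ : 0 < κ)
    (ht : 2 * (L * (τ / √d) * √(N * n)) ≤ t) (hτ : 0 ≤ τ) :
    ((stdGaussian (EuclideanSpace ℝ (Fin N × Fin d))).prod
        (stdGaussian (EuclideanSpace ℝ (Fin d × Fin n))))
        {z | t ≤ opNorm ((toMat z.1 * ((1 / √(d : ℝ)) • toMat z.2)).map f
          - constMat N n (∫ x, f x ∂(gaussianReal 0 1)))}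
      ≤ 5 ^ (N + d) * ENNReal.ofReal (Real.exp (-((κ * √d) ^ 2 / 128)))
        + N * (2 * ENNReal.ofReal (Real.exp (1 / 4 - τ / 4)))
        + 5 ^ (N + n) * ENNReal.ofReal (Real.exp (-((t / 2) ^ 2 / (128 * (L * κ) ^ 2)))) := by
  set γ₁ := stdGaussian (EuclideanSpace ℝ (Fin N × Fin d)) with hγ₁
  set γ₂ := stdGaussian (EuclideanSpace ℝ (Fin d × Fin n)) with hγ₂
  have hd' : (0 : ℝ) < d := by exact_mod_cast hd
  have hs0 : 0 < √(d : ℝ) := Real.sqrt_pos.2 hd'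
  have ht0 : 0 ≤ t := le_trans (by positivity) ht
  set F : EuclideanSpace ℝ (Fin N × Fin d) → EuclideanSpace ℝ (Fin d × Fin n) →
    Matrix (Fin N) (Fin n) ℝ := fun w z => (toMat w * ((1 / √(d : ℝ)) • toMat z)).map f with hF
  set A₁ : Set (EuclideanSpace ℝ (Fin N × Fin d)) := {w | κ * √d ≤ opNorm (toMat w)} with hA₁
  set A₂ : Set (EuclideanSpace ℝ (Fin N × Fin d)) :=
    ⋃ i, {w | τ / √d ≤ |(∑ k, toMat w i k ^ 2) / d - 1|} with hA₂
  set A₃ : Set (EuclideanSpace ℝ (Fin N × Fin d) × EuclideanSpace ℝ (Fin d × Fin n)) :=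
    {z | opNorm (toMat z.1) ≤ κ * √d ∧
      t / 2 ≤ opNorm (F z.1 z.2 - featureMean f (1 / √d) (toMat z.1) n)} with hA₃
  -- Outside the three bad events `W` is not too large, every row norm is close to √d, and the
  -- deviation from the conditional mean is below t/2. The hypothesis on t leaves the other t/2 for
  -- the deviation of the conditional mean from the constant.
  have hsub : {z | t ≤ opNorm (F z.1 z.2 - constMat N n (∫ x, f x ∂(gaussianReal 0 1)))}
      ⊆ (A₁ ×ˢ Set.univ ∪ A₂ ×ˢ Set.univ) ∪ A₃ := by
    intro z hz
    by_contra hcon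
    simp only [hA₁, hA₂, hA₃, Set.mem_union, Set.mem_prod, Set.mem_univ, and_true, Set.mem_iUnion,
      Set.mem_ofPred_eq, not_or, not_and, not_le, not_exists] at hcon hz
    obtain ⟨⟨h1, h2⟩, h3⟩ := hcon
    have h4 := h3 h1.le
    have h5 : opNorm (featureMean f (1 / √d) (toMat z.1) n
        - constMat N n (∫ x, f x ∂(gaussianReal 0 1))) ≤ L * (τ / √d) * √(N * n) :=
      opNorm_le_of_abs_le (by positivity) fun i j =>
        abs_featureMean_sub_le hf hL hd _ i j (h2 i).le
    have h6 := opNorm_add_le (F z.1 z.2 - featureMean f (1 / √d) (toMat z.1) n)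
      (featureMean f (1 / √d) (toMat z.1) n - constMat N n (∫ x, f x ∂(gaussianReal 0 1)))
    rw [sub_add_sub_cancel] at h6
    linarith
  refine (measure_mono hsub).trans ((measure_union_le _ _).trans
    (add_le_add ((measure_union_le _ _).trans (add_le_add ?_ ?_)) ?_))
  · rw [Measure.prod_prod, measure_univ, mul_one]
    exact stdGaussian_opNorm_ge_le (by positivity)
  · rw [Measure.prod_prod, measure_univ, mul_one]
    refine (measure_iUnion_fintype_le _ _).trans ?_
    calc _ ≤ ∑ _i : Fin N, 2 * ENNReal.ofReal (Real.exp (1 / 4 - τ / 4)) :=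
          Finset.sum_le_sum fun i _ => stdGaussian_row_sq_ge_le hd i τ
      _ = _ := by simp
  · have hcW : Continuous fun z : EuclideanSpace ℝ (Fin N × Fin d) ×
        EuclideanSpace ℝ (Fin d × Fin n) => toMat z.1 := continuous_toMat.comp continuous_fst
    have hcZ : Continuous fun z : EuclideanSpace ℝ (Fin N × Fin d) ×
        EuclideanSpace ℝ (Fin d × Fin n) => toMat z.2 := continuous_toMat.comp continuous_snd
    have hcF : Continuous fun z : EuclideanSpace ℝ (Fin N × Fin d) ×
        EuclideanSpace ℝ (Fin d × Fin n) => F z.1 z.2 :=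
      (hcW.matrix_mul (hcZ.const_smul (1 / √(d : ℝ)))).matrix_map hf.continuous
    have hcM : Continuous fun z : EuclideanSpace ℝ (Fin N × Fin d) ×
        EuclideanSpace ℝ (Fin d × Fin n) => featureMean f (1 / √d) (toMat z.1) n := by
      refine continuous_matrix fun i j => ?_
      simp only [featureMean, Matrix.of_apply]
      refine (continuous_gaussianMean hf hL).comp (continuous_const.mul
        (Real.continuous_sqrt.comp (continuous_finsetSum _ fun k _ => ?_)))
      exact (hcW.matrix_elem i k).pow 2
    have hmeas : MeasurableSet A₃ :=
      ((isClosed_le (continuous_opNorm.comp hcW) continuous_const).inter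
        (isClosed_le continuous_const (continuous_opNorm.comp (hcF.sub hcM)))).measurableSet
    rw [Measure.prod_apply hmeas]
    calc _ ≤ ∫⁻ _w, 5 ^ (N + n) *
          ENNReal.ofReal (Real.exp (-((t / 2) ^ 2 / (128 * (L * κ) ^ 2)))) ∂γ₁ := by
          refine lintegral_mono fun w => ?_
          -- The bound on `W` is part of `A₃`, so the slices over large `W` are empty and the
          -- conditional estimate covers all the others.
          by_cases hw : opNorm (toMat w) ≤ κ * √d
          · refine (measure_mono ?_).trans (stdGaussian_feature_sub_mean_ge_le hf hL0 hL (toMat w)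
              (c := 1 / √d) hκ ?_ (t := t / 2) (by positivity))
            · intro z hz
              exact hz.2
            · rw [abs_of_pos (by positivity), one_div, inv_mul_le_iff₀ hs0]
              linarith
          · have : Prod.mk w ⁻¹' A₃ = ∅ := by
              ext z
              simp only [hA₃, Set.mem_preimage, Set.mem_ofPred_eq, hw, false_and,
                Set.mem_empty_iff_false]
            rw [this, measure_empty]
            exact zero_le
      _ = _ := by simp

end Features

/-! ### The joint law of the two Gaussian matrices -/

/-- Transfers estimates from the given pair to a product of standard Gaussian measures, after
multiplying `Z` by √d. Only an inequality is claimed, because `p` is arbitrary and its event need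
not be measurable. -/
theorem IsGaussianPair.measure_le {Ω : Type*} [MeasurableSpace Ω] {P : Measure Ω}
    [IsProbabilityMeasure P] {N d n : ℕ} (hd : 0 < d)
    {W : Ω → Matrix (Fin N) (Fin d) ℝ} {Z : Ω → Matrix (Fin d) (Fin n) ℝ}
    (h : IsGaussianPair P W Z)
    (p : Matrix (Fin N) (Fin d) ℝ → Matrix (Fin d) (Fin n) ℝ → Prop) :
    P {ω | p (W ω) (Z ω)} ≤ ((stdGaussian (EuclideanSpace ℝ (Fin N × Fin d))).prod
      (stdGaussian (EuclideanSpace ℝ (Fin d × Fin n))))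
      {z | p (toMat z.1) ((1 / √(d : ℝ)) • toMat z.2)} := by
  have hd' : (0 : ℝ) < d := by exact_mod_cast hd
  have hs0 : √(d : ℝ) ≠ 0 := (Real.sqrt_pos.2 hd').ne'
  set X : (Fin N × Fin d) ⊕ (Fin d × Fin n) → Ω → ℝ :=
    Sum.elim (fun p ω => W ω p.1 p.2) (fun p ω => √d * Z ω p.1 p.2) with hX
  have hlaw : ∀ s, HasLaw (X s) (gaussianReal 0 1) P := by
    rintro (s | s)
    · exact h.law_W s.1 s.2
    · have := gaussianReal_const_mul (h.law_Z s.1 s.2) (√d)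
      have e : gaussianReal 0 1
          = gaussianReal (√d * 0) (⟨√(d : ℝ) ^ 2, sq_nonneg _⟩ * (d : ℝ≥0)⁻¹) := by
        rw [mul_zero]
        congr 1
        ext
        change 1 = √(d : ℝ) ^ 2 * (d : ℝ)⁻¹
        rw [Real.sq_sqrt hd'.le, mul_inv_cancel₀ hd'.ne']
      rw [e]
      exact this
  have hind : iIndepFun X P := by
    have := h.indep.comp (fun s x => Sum.elim (fun _ => x) (fun _ => √d * x) s) (by
      rintro (s | s)
      · exact measurable_id
      · exact measurable_const_mul _)
    convert this using 1
    ext s ω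
    rcases s with s | s <;> rfl
  have hmap : P.map (fun ω s => X s ω) = Measure.pi fun _ => gaussianReal 0 1 := by
    rw [(iIndepFun_iff_map_fun_eq_pi_map fun s => (hlaw s).aemeasurable).1 hind]
    congr 1
    ext1 s
    exact (hlaw s).map_eq
  set Ψ : ((Fin N × Fin d) ⊕ (Fin d × Fin n) → ℝ) → EuclideanSpace ℝ (Fin N × Fin d) ×
      EuclideanSpace ℝ (Fin d × Fin n) :=
    fun x => (WithLp.toLp 2 fun k => x (Sum.inl k), WithLp.toLp 2 fun k => x (Sum.inr k)) with hΨ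
  have hΨm : Measurable Ψ := by fun_prop
  have hΨmap : (Measure.pi fun _ => gaussianReal 0 1).map Ψ
      = (stdGaussian (EuclideanSpace ℝ (Fin N × Fin d))).prod
        (stdGaussian (EuclideanSpace ℝ (Fin d × Fin n))) := by
    have h1 := (measurePreserving_sumPiEquivProdPi
      (fun _ : (Fin N × Fin d) ⊕ (Fin d × Fin n) => gaussianReal 0 1)).map_eq
    rw [← map_pi_eq_stdGaussian, ← map_pi_eq_stdGaussian,
      Measure.map_prod_map _ _ (by fun_prop) (by fun_prop), ← h1, Measure.map_map (by fun_prop)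
      (MeasurableEquiv.measurable _)]
    rfl
  have hm : AEMeasurable (fun ω s => X s ω) P := aemeasurable_pi_iff.2 fun s => (hlaw s).aemeasurable
  have hle := Measure.le_map_apply (μ := P) (f := Ψ ∘ fun ω s => X s ω) (hΨm.comp_aemeasurable hm)
    {z | p (toMat z.1) ((1 / √(d : ℝ)) • toMat z.2)}
  rw [← AEMeasurable.map_map_of_aemeasurable hΨm.aemeasurable hm, hmap, hΨmap] at hle
  refine le_trans (le_of_eq ?_) hle
  congr 1
  ext ω
  have h1 : toMat (Ψ fun s => X s ω).1 = W ω := by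
    ext i j; simp [toMat, hΨ, hX]
  have h2 : (1 / √(d : ℝ)) • toMat (Ψ fun s => X s ω).2 = Z ω := by
    ext i j; simp [toMat, hΨ, hX, hs0]
  simp only [Set.mem_ofPred_eq, Set.mem_preimage, Function.comp_apply, h1, h2]

/-! ### Calculus of stochastic domination -/

theorem StochDom.of_deterministic {Ω : Type*} [MeasurableSpace Ω] {P : Measure Ω} {n : ℕ → ℕ}
    {B : ℕ → ℝ} {c : ℕ → ℝ}
    (h : ∀ ε > (0 : ℝ), ∀ᶠ k in atTop, c k < (n k : ℝ) ^ ε * B k) :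
    StochDom P n (fun k _ => c k) B := by
  intro ε hε D hD
  filter_upwards [h ε hε] with k h1
  have : {ω : Ω | ω ∈ Set.univ ∧ (n k : ℝ) ^ ε * B k ≤ c k} = ∅ := by
    ext ω; simp [h1]
  rw [this, measureReal_empty]
  positivity

section StochDomCalculus

variable {Ω : Type*} [MeasurableSpace Ω] {P : Measure Ω} [IsProbabilityMeasure P] {n : ℕ → ℕ}
  {E : ℕ → Set Ω} {X X' : ℕ → Ω → ℝ} {B B' : ℕ → ℝ}

theorem eventually_le_rpow (hn : Tendsto n atTop atTop) {ε : ℝ} (hε : 0 < ε) (C : ℝ) :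
    ∀ᶠ k in atTop, C ≤ (n k : ℝ) ^ ε :=
  ((tendsto_rpow_atTop hε).comp (tendsto_natCast_atTop_atTop.comp hn)).eventually_ge_atTop C

theorem eventually_mul_rpow_neg_le (hn : Tendsto n atTop atTop) {D D' : ℝ} (hD : D < D') (C : ℝ) :
    ∀ᶠ k in atTop, C * (n k : ℝ) ^ (-D') ≤ (n k : ℝ) ^ (-D) := by
  filter_upwards [eventually_le_rpow hn (sub_pos.2 hD) C, hn.eventually_ge_atTop 1] with k hk h1
  have h0 : (0 : ℝ) < n k := by exact_mod_cast h1
  calc C * (n k : ℝ) ^ (-D') ≤ (n k : ℝ) ^ (D' - D) * (n k : ℝ) ^ (-D') := by gcongr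
    _ = _ := by rw [← Real.rpow_add h0]; congr 1; ring

theorem StochDomOn.of_le_mul (hn : Tendsto n atTop atTop) (hB : ∀ k, 0 ≤ B k)
    (h : StochDom P n X' B) {C : ℝ} (hC : 0 < C)
    (hle : ∀ᶠ k in atTop, ∀ ω ∈ E k, X k ω ≤ C * X' k ω) : StochDomOn P n E X B := by
  intro ε hε D hD
  filter_upwards [h (ε / 2) (half_pos hε) D hD, hle, eventually_le_rpow hn (half_pos hε) C,
    hn.eventually_ge_atTop 1] with k h1 h2 h3 h4
  refine le_trans (measureReal_mono fun ω hω => ?_) h1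
  refine ⟨Set.mem_univ ω, ?_⟩
  have h0 : (0 : ℝ) < n k := by exact_mod_cast h4
  have h5 := hω.2.trans (h2 ω hω.1)
  have h6 : (n k : ℝ) ^ ε = (n k : ℝ) ^ (ε / 2) * (n k : ℝ) ^ (ε / 2) := by
    rw [← Real.rpow_add h0]; congr 1; ring
  rw [h6, mul_assoc] at h5
  have h7 : 0 ≤ (n k : ℝ) ^ (ε / 2) * B k := by have := hB k; positivity
  have h8 := (mul_le_mul_of_nonneg_right h3 h7).trans h5
  exact le_of_mul_le_mul_left h8 hC

theorem StochDom.of_le_mul (hn : Tendsto n atTop atTop) (hB : ∀ k, 0 ≤ B k)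
    (h : StochDom P n X' B) {C : ℝ} (hC : 0 < C)
    (hle : ∀ᶠ k in atTop, ∀ ω, X k ω ≤ C * X' k ω) : StochDom P n X B :=
  StochDomOn.of_le_mul hn hB h hC (hle.mono fun _ h ω _ => h ω)

theorem StochDom.mono_right (h : StochDom P n X B) (hB : ∀ᶠ k in atTop, B k ≤ B' k) :
    StochDom P n X B' := by
  intro ε hε D hD
  filter_upwards [h ε hε D hD, hB] with k h1 h2
  refine le_trans (measureReal_mono fun ω hω => ?_) h1
  refine ⟨Set.mem_univ ω, ?_⟩
  refine le_trans ?_ hω.2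
  gcongr

theorem StochDom.add (hn : Tendsto n atTop atTop) (hB : ∀ k, 0 ≤ B k)
    (h : StochDom P n X B) (h' : StochDom P n X' B) :
    StochDom P n (fun k ω => X k ω + X' k ω) B := by
  intro ε hε D hD
  filter_upwards [h (ε / 2) (half_pos hε) (D + 1) (by linarith),
    h' (ε / 2) (half_pos hε) (D + 1) (by linarith), eventually_le_rpow hn (half_pos hε) 2,
    eventually_mul_rpow_neg_le hn (lt_add_one D) 2, hn.eventually_ge_atTop 1]
    with k h1 h2 h3 h4 h5
  have h0 : (0 : ℝ) < n k := by exact_mod_cast h5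
  have h6 : (n k : ℝ) ^ ε = (n k : ℝ) ^ (ε / 2) * (n k : ℝ) ^ (ε / 2) := by
    rw [← Real.rpow_add h0]; congr 1; ring
  refine (measureReal_mono (s₂ := {ω | ω ∈ Set.univ ∧ (n k : ℝ) ^ (ε / 2) * B k ≤ X k ω} ∪
    {ω | ω ∈ Set.univ ∧ (n k : ℝ) ^ (ε / 2) * B k ≤ X' k ω}) fun ω hω => ?_).trans
    ((measureReal_union_le _ _).trans (le_trans ?_ h4))
  · by_contra hcon
    simp only [Set.mem_union, Set.mem_ofPred_eq, Set.mem_univ, true_and, not_or, not_le] at hcon hω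
    have h7 : 0 ≤ (n k : ℝ) ^ (ε / 2) * B k := by have := hB k; positivity
    have h8 := mul_le_mul_of_nonneg_right h3 h7
    rw [h6, mul_assoc] at hω
    linarith [hcon.1, hcon.2]
  · linarith

theorem StochDom.mul (hn : Tendsto n atTop atTop) (hX : ∀ k ω, 0 ≤ X k ω) (hX' : ∀ k ω, 0 ≤ X' k ω)
    (h : StochDom P n X B) (h' : StochDom P n X' B') :
    StochDom P n (fun k ω => X k ω * X' k ω) (fun k => B k * B' k) := by
  intro ε hε D hD
  filter_upwards [h (ε / 2) (half_pos hε) (D + 1) (by linarith),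
    h' (ε / 2) (half_pos hε) (D + 1) (by linarith),
    eventually_mul_rpow_neg_le hn (lt_add_one D) 2, hn.eventually_ge_atTop 1]
    with k h1 h2 h4 h5
  have h0 : (0 : ℝ) < n k := by exact_mod_cast h5
  have h6 : (n k : ℝ) ^ ε = (n k : ℝ) ^ (ε / 2) * (n k : ℝ) ^ (ε / 2) := by
    rw [← Real.rpow_add h0]; congr 1; ring
  refine (measureReal_mono (s₂ := {ω | ω ∈ Set.univ ∧ (n k : ℝ) ^ (ε / 2) * B k ≤ X k ω} ∪
    {ω | ω ∈ Set.univ ∧ (n k : ℝ) ^ (ε / 2) * B' k ≤ X' k ω}) fun ω hω => ?_).trans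
    ((measureReal_union_le _ _).trans (le_trans ?_ h4))
  · by_contra hcon
    simp only [Set.mem_union, Set.mem_ofPred_eq, Set.mem_univ, true_and, not_or, not_le] at hcon hω
    have h7 := mul_lt_mul'' hcon.1 hcon.2 (hX k ω) (hX' k ω)
    rw [h6] at hω
    have h8 : (n k : ℝ) ^ (ε / 2) * B k * ((n k : ℝ) ^ (ε / 2) * B' k)
      = (n k : ℝ) ^ (ε / 2) * (n k : ℝ) ^ (ε / 2) * (B k * B' k) := by ring
    linarith
  · linarith

theorem StochDom.const_mul (c : ℕ → ℝ) (hc : ∀ᶠ k in atTop, 0 < c k) (h : StochDom P n X B) :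
    StochDom P n (fun k ω => c k * X k ω) (fun k => c k * B k) := by
  intro ε hε D hD
  filter_upwards [h ε hε D hD, hc] with k h1 h2
  refine le_trans (measureReal_mono fun ω hω => ?_) h1
  refine ⟨Set.mem_univ ω, ?_⟩
  have h3 := hω.2
  rw [mul_left_comm] at h3
  exact le_of_mul_le_mul_left h3 h2

theorem StochDom.tendstoInMeasure (hn : Tendsto n atTop atTop) (hX : ∀ k ω, 0 ≤ X k ω) {a : ℝ}
    (ha : 0 < a) (h : StochDom P n X fun k => (n k : ℝ) ^ (-a)) :
    TendstoInMeasure P X atTop fun _ => (0 : ℝ) := by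
  rw [tendstoInMeasure_iff_dist]
  intro ε hε
  have h1 := h (a / 2) (half_pos ha) 1 one_pos
  have h2 : Tendsto (fun k => (n k : ℝ) ^ (-1 : ℝ)) atTop (𝓝 0) :=
    (tendsto_rpow_neg_atTop one_pos).comp (tendsto_natCast_atTop_atTop.comp hn)
  have h3 : Tendsto (fun k => P.real {ω | ε ≤ dist (X k ω) 0}) atTop (𝓝 0) := by
    refine squeeze_zero' (Eventually.of_forall fun k => measureReal_nonneg) ?_ h2
    filter_upwards [h1, eventually_le_rpow hn (half_pos ha) (1 / ε), hn.eventually_ge_atTop 1]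
      with k h4 h5 h6
    have h0 : (0 : ℝ) < n k := by exact_mod_cast h6
    refine le_trans (measureReal_mono fun ω hω => ?_) h4
    refine ⟨Set.mem_univ ω, ?_⟩
    simp only [Set.mem_ofPred_eq, Real.dist_eq, sub_zero, abs_of_nonneg (hX k ω)] at hω
    refine le_trans ?_ hω
    rw [← Real.rpow_add h0, show a / 2 + -a = -(a / 2) by ring, Real.rpow_neg h0.le]
    rw [one_div] at h5
    exact inv_le_of_inv_le₀ hε h5
  have h4 := (ENNReal.tendsto_ofReal h3)
  simpa [ofReal_measureReal] using h4

/-- The size parameter enters through x = n^a, and x^(D/a) e^{-bx} tends to 0: stretched exponential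
tails beat every power of n. -/
theorem eventually_exp_neg_rpow_le (hn : Tendsto n atTop atTop) {a b D : ℝ} (ha : 0 < a)
    (hb : 0 < b) (C : ℝ) :
    ∀ᶠ k in atTop, C * Real.exp (-(b * (n k : ℝ) ^ a)) ≤ (n k : ℝ) ^ (-D) := by
  have h1 := ((tendsto_rpow_mul_exp_neg_mul_atTop_nhds_zero (D / a) b hb).comp
    ((tendsto_rpow_atTop ha).comp (tendsto_natCast_atTop_atTop.comp hn))).const_mul C
  rw [mul_zero] at h1
  filter_upwards [h1.eventually_le_const (zero_lt_one (α := ℝ)), hn.eventually_ge_atTop 1]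
    with k h2 h3
  have h0 : (0 : ℝ) < n k := by exact_mod_cast h3
  simp only [Function.comp_apply] at h2
  rw [← Real.rpow_mul h0.le, mul_div_cancel₀ _ ha.ne', neg_mul] at h2
  rw [Real.rpow_neg h0.le, ← one_div, le_div_iff₀ (by positivity)]
  linarith

end StochDomCalculus

/-! ### The proportional regime -/

theorem ProportionalLimit.exists_comparable {n d N : ℕ → ℕ} {φ ψ : ℝ}
    (h : ProportionalLimit n d N φ ψ) :
    ∃ C : ℝ, 1 ≤ C ∧ ∀ᶠ k in atTop, 0 < n k ∧ 0 < d k ∧ 0 < N k ∧ (N k : ℝ) ≤ C * n k ∧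
      (n k : ℝ) ≤ C * N k ∧ (d k : ℝ) ≤ C * n k ∧ (n k : ℝ) ≤ C * d k := by
  have key : ∀ {m : ℕ → ℕ} {a : ℝ}, 0 < a → Tendsto m atTop atTop →
      Tendsto (fun k => (n k : ℝ) / m k) atTop (𝓝 a) →
      ∀ᶠ k in atTop, (m k : ℝ) ≤ 2 / a * n k ∧ (n k : ℝ) ≤ 2 * a * m k := by
    intro m a ha hm hlim
    filter_upwards [hlim.eventually_const_lt (half_lt_self ha),
      hlim.eventually_lt_const (show a < 2 * a by linarith), hm.eventually_ge_atTop 1]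
      with k h1 h2 h3
    have h0 : (0 : ℝ) < m k := by exact_mod_cast h3
    rw [lt_div_iff₀ h0] at h1
    rw [div_lt_iff₀ h0] at h2
    refine ⟨?_, h2.le⟩
    rw [div_mul_eq_mul_div, le_div_iff₀ ha]
    linarith
  set C := 1 + 2 / φ + 2 * φ + 2 / ψ + 2 * ψ with hC
  have hφ := h.phi_pos
  have hψ := h.psi_pos
  have e1 : 0 < 2 / φ := by positivity
  have e2 : 0 < 2 / ψ := by positivity
  refine ⟨C, by linarith, ?_⟩
  filter_upwards [key hφ h.N_top h.lim_phi, key hψ h.d_top h.lim_psi, h.n_top.eventually_ge_atTop 1,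
    h.d_top.eventually_ge_atTop 1, h.N_top.eventually_ge_atTop 1] with k h1 h2 h3 h4 h5
  refine ⟨h3, h4, h5, h1.1.trans ?_, h1.2.trans ?_, h2.1.trans ?_, h2.2.trans ?_⟩ <;>
    gcongr <;> linarith

/-! ### Domination of Gaussian projections and of nonlinear features -/

section Domination

variable {Ω : Type*} [MeasurableSpace Ω] {P : Measure Ω} [IsProbabilityMeasure P]
  {n d N : ℕ → ℕ} {φ ψ : ℝ} {W : (k : ℕ) → Ω → Matrix (Fin (N k)) (Fin (d k)) ℝ}
  {Z : (k : ℕ) → Ω → Matrix (Fin (d k)) (Fin (n k)) ℝ}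

/-- The norm on functions is the sup norm. Each entry has Gaussian tails, and the union over at most
C n entries costs one power of n, whence the exponent D + 1. -/
theorem stochDom_norm_mulVec (hlim : ProportionalLimit n d N φ ψ)
    (hWZ : ∀ k, IsGaussianPair P (W k) (Z k)) (u : (k : ℕ) → Fin (d k) → ℝ)
    (hu : ∀ᶠ k in atTop, u k ⬝ᵥ u k ≤ 1) :
    StochDom P n (fun k ω => ‖W k ω *ᵥ u k‖) (fun _ => 1) := by
  obtain ⟨C, hC, hcomp⟩ := hlim.exists_comparable
  intro ε hε D hD
  filter_upwards [hcomp, hu, eventually_exp_neg_rpow_le hlim.n_top (a := 2 * ε) (b := 1 / 8)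
    (D := D + 1) (by positivity) (by norm_num) (2 * C)] with k hk huk hexp
  obtain ⟨hn, hd, hN, hNn, -, -, -⟩ := hk
  have h0 : (0 : ℝ) < n k := by exact_mod_cast hn
  have hpos : 0 < (n k : ℝ) ^ ε := by positivity
  have h1 := (hWZ k).measure_le hd
    (fun A _ => ∃ i, (n k : ℝ) ^ ε ≤ |(A *ᵥ u k) i|)
  have h2 : P {ω | ω ∈ Set.univ ∧ (n k : ℝ) ^ ε * 1 ≤ ‖W k ω *ᵥ u k‖}
      ≤ ENNReal.ofReal ((n k : ℝ) ^ (-D)) := by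
    refine (measure_mono fun ω hω => ?_).trans (h1.trans ?_)
    · simp only [Set.mem_ofPred_eq, mul_one, Set.mem_univ, true_and] at hω ⊢
      by_contra! hcon
      exact absurd ((pi_norm_lt_iff hpos).2 fun i => hcon i) (not_lt.2 hω)
    · have h3 : {z : EuclideanSpace ℝ (Fin (N k) × Fin (d k)) ×
          EuclideanSpace ℝ (Fin (d k) × Fin (n k)) |
          ∃ i, (n k : ℝ) ^ ε ≤ |(toMat z.1 *ᵥ u k) i|}
          = (⋃ i, {w | (n k : ℝ) ^ ε ≤ |(toMat w *ᵥ u k) i|}) ×ˢ Set.univ := by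
        ext z; simp
      rw [h3, Measure.prod_prod, measure_univ, mul_one]
      refine (measure_iUnion_fintype_le _ _).trans ?_
      calc _ ≤ ∑ _i : Fin (N k), 2 * ENNReal.ofReal (Real.exp (-(((n k : ℝ) ^ ε) ^ 2 / 8))) :=
            Finset.sum_le_sum fun i _ => stdGaussian_abs_mulVec_ge_le hpos.le i huk
        _ = ENNReal.ofReal (N k * (2 * Real.exp (-(((n k : ℝ) ^ ε) ^ 2 / 8)))) := by
            rw [ENNReal.ofReal_mul (by positivity), ENNReal.ofReal_mul (by positivity)]
            simp
        _ ≤ _ := by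
            refine ENNReal.ofReal_le_ofReal ?_
            have h4 : ((n k : ℝ) ^ ε) ^ 2 / 8 = 1 / 8 * (n k : ℝ) ^ (2 * ε) := by
              rw [← Real.rpow_natCast, ← Real.rpow_mul h0.le]
              push_cast; ring_nf
            rw [h4]
            calc _ ≤ C * n k * (2 * Real.exp (-(1 / 8 * (n k : ℝ) ^ (2 * ε)))) := by gcongr
              _ = n k * (2 * C * Real.exp (-(1 / 8 * (n k : ℝ) ^ (2 * ε)))) := by ring
              _ ≤ n k * (n k : ℝ) ^ (-(D + 1)) := by gcongr
              _ = (n k : ℝ) ^ (-D) := by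
                nth_rewrite 1 [← Real.rpow_one (n k : ℝ)]
                rw [← Real.rpow_add h0]; congr 1; ring
  exact ENNReal.toReal_le_of_le_ofReal (by positivity) h2

theorem five_pow_le_exp (m : ℕ) : (5 : ℝ) ^ m ≤ Real.exp (2 * m) := by
  rw [mul_comm, Real.exp_nat_mul]
  gcongr
  have := Real.exp_one_gt_d9
  rw [show (2 : ℝ) = 1 + 1 by norm_num, Real.exp_add]
  nlinarith

theorem stochDom_feature (hlim : ProportionalLimit n d N φ ψ)
    (hWZ : ∀ k, IsGaussianPair P (W k) (Z k)) {f : ℝ → ℝ} {L : ℝ} (hf : Differentiable ℝ f)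
    (hL0 : 0 < L) (hL : ∀ x, |deriv f x| ≤ L) :
    StochDom P n (fun k ω => opNorm ((W k ω * Z k ω).map f
      - constMat (N k) (n k) (∫ x, f x ∂(gaussianReal 0 1)))) (fun k => √(n k)) := by
  obtain ⟨C, hC, hcomp⟩ := hlim.exists_comparable
  intro ε hε D hD
  have hn := hlim.n_top
  have ha : 0 < ε / 4 := by positivity
  filter_upwards [hcomp, eventually_le_rpow hn ha (2 * L * C),
    eventually_le_rpow hn ha (128 * (2 * C ^ 2 + 3)),
    eventually_le_rpow hn ha (512 * L ^ 2 * (2 * C + 3)),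
    eventually_le_rpow hn ha 1,
    eventually_exp_neg_rpow_le hn (a := ε / 4) (b := 1) (D := D + 1) ha one_pos 3,
    eventually_exp_neg_rpow_le hn (a := ε / 4) (b := 1 / 4) (D := D + 1) ha (by norm_num)
      (6 * C * Real.exp (1 / 4)),
    eventually_mul_rpow_neg_le hn (lt_add_one D) 1] with k hk hx1 hx2 hx3 hx0 he1 he2 he3
  obtain ⟨hn0, hd, hN, hNn, hnN, hdn, hnd⟩ := hk
  have h0 : (0 : ℝ) < n k := by exact_mod_cast hn0
  have hn1 : (1 : ℝ) ≤ n k := by exact_mod_cast hn0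
  have hd0 : (0 : ℝ) < d k := by exact_mod_cast hd
  -- The choice κ = τ = x and t = x⁴ √n leaves room in every term. The mean error needs only t of
  -- order x √n. The exponents x² d / 128 and x⁶ n / (512 L²) beat the net entropies, which are
  -- linear in n, and e^{-x/4} absorbs the union over rows.
  set x := (n k : ℝ) ^ (ε / 4) with hx
  have hxpos : 0 < x := by positivity
  have hxε : (n k : ℝ) ^ ε = x ^ 4 := by
    rw [hx, ← Real.rpow_natCast, ← Real.rpow_mul h0.le]
    congr 1; push_cast; ring
  have hsn : √(n k : ℝ) ^ 2 = n k := Real.sq_sqrt h0.le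
  have hsd : √(d k : ℝ) ^ 2 = d k := Real.sq_sqrt hd0.le
  have hsd0 : 0 < √(d k : ℝ) := Real.sqrt_pos.2 hd0
  set t := (n k : ℝ) ^ ε * √(n k) with ht
  have hratio : √((N k : ℝ) * n k) / √(d k) ≤ C * √(n k) := by
    rw [div_le_iff₀ hsd0]
    refine Real.sqrt_le_iff.2 ⟨by positivity, ?_⟩
    rw [mul_pow, mul_pow, hsn, hsd]
    calc (N k : ℝ) * n k ≤ (C * n k) * (C * d k) := by gcongr
      _ = _ := by ring
  have htle : 2 * (L * (x / √(d k)) * √((N k : ℝ) * n k)) ≤ t := by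
    calc _ = 2 * L * x * (√((N k : ℝ) * n k) / √(d k)) := by ring
      _ ≤ 2 * L * x * (C * √(n k)) := by gcongr
      _ = (2 * L * C) * x * √(n k) := by ring
      _ ≤ x * x * √(n k) := by gcongr
      _ ≤ t := by
        rw [ht, hxε]
        gcongr
        nlinarith [one_le_pow₀ hx0 (n := 2), sq_nonneg x]
  have h1 := (hWZ k).measure_le hd (fun A B => t ≤ opNorm ((A * B).map f
      - constMat (N k) (n k) (∫ x, f x ∂(gaussianReal 0 1))))
  have h2 := prod_feature_sub_const_ge_le (N := N k) (n := n k) hf hL0 hL hd (κ := x) (τ := x)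
    (t := t) hxpos htle hxpos.le
  have e1 : (5 : ℝ) ^ (N k + d k) * Real.exp (-((x * √(d k)) ^ 2 / 128)) ≤ Real.exp (-(1 * x)) := by
    refine (mul_le_mul_of_nonneg_right (five_pow_le_exp _) (Real.exp_pos _).le).trans ?_
    rw [← Real.exp_add]
    refine Real.exp_le_exp.2 ?_
    rw [mul_pow, hsd]
    push_cast
    have h4 : (N k : ℝ) ≤ C ^ 2 * d k := by
      calc (N k : ℝ) ≤ C * n k := hNn
        _ ≤ C * (C * d k) := by gcongr
        _ = _ := by ring
    have h5 : (2 * C ^ 2 + 3) * (x * d k) ≤ x ^ 2 * d k / 128 := by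
      calc (2 * C ^ 2 + 3) * (x * d k) = 128 * (2 * C ^ 2 + 3) * (x * d k) / 128 := by ring
        _ ≤ x * (x * d k) / 128 := by gcongr
        _ = _ := by ring
    have h6 : (2 * C ^ 2 + 2) * (1 * (d k : ℝ)) ≤ (2 * C ^ 2 + 2) * (x * d k) := by gcongr
    have h7 : x * 1 ≤ x * d k := by
      gcongr
      exact_mod_cast hd
    linarith
  have e3 : (5 : ℝ) ^ (N k + n k) * Real.exp (-((t / 2) ^ 2 / (128 * (L * x) ^ 2)))
      ≤ Real.exp (-(1 * x)) := by
    refine (mul_le_mul_of_nonneg_right (five_pow_le_exp _) (Real.exp_pos _).le).trans ?_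
    rw [← Real.exp_add]
    refine Real.exp_le_exp.2 ?_
    have h3 : (t / 2) ^ 2 / (128 * (L * x) ^ 2) = x ^ 6 * n k / (512 * L ^ 2) := by
      rw [ht, hxε, div_pow, mul_pow, hsn]
      field_simp
      ring
    rw [h3]
    push_cast
    have h5 : (2 * C + 3) * (x * n k) ≤ x ^ 6 * n k / (512 * L ^ 2) := by
      rw [le_div_iff₀ (by positivity)]
      calc (2 * C + 3) * (x * n k) * (512 * L ^ 2) = 512 * L ^ 2 * (2 * C + 3) * (x * n k) := by ring
        _ ≤ x * (x ^ 5 * n k) := by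
          gcongr
          exact le_self_pow₀ hx0 (by norm_num)
        _ = _ := by ring
    have h6 : (2 * C + 2) * (1 * (n k : ℝ)) ≤ (2 * C + 2) * (x * n k) := by gcongr
    have h7 : x * 1 ≤ x * n k := by gcongr
    linarith
  have h3 : P {ω | ω ∈ Set.univ ∧ (n k : ℝ) ^ ε * √(n k) ≤ opNorm ((W k ω * Z k ω).map f
      - constMat (N k) (n k) (∫ x, f x ∂(gaussianReal 0 1)))}
      ≤ ENNReal.ofReal ((n k : ℝ) ^ (-D)) := by
    simp only [Set.mem_univ, true_and]
    refine h1.trans (h2.trans ?_)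
    calc _ = ENNReal.ofReal ((5 : ℝ) ^ (N k + d k) * Real.exp (-((x * √(d k)) ^ 2 / 128))
          + N k * (2 * Real.exp (1 / 4 - x / 4))
          + (5 : ℝ) ^ (N k + n k) * Real.exp (-((t / 2) ^ 2 / (128 * (L * x) ^ 2)))) := by
          rw [ENNReal.ofReal_add (by positivity) (by positivity),
            ENNReal.ofReal_add (by positivity) (by positivity), ENNReal.ofReal_mul (by positivity),
            ENNReal.ofReal_mul (by positivity), ENNReal.ofReal_mul (by positivity),
            ENNReal.ofReal_mul (by positivity), ENNReal.ofReal_pow (by norm_num),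
            ENNReal.ofReal_pow (by norm_num)]
          simp
      _ ≤ _ := by
          refine ENNReal.ofReal_le_ofReal ?_
          have h4 : (n k : ℝ) ^ (-D) = n k * (n k : ℝ) ^ (-(D + 1)) := by
            nth_rewrite 2 [← Real.rpow_one (n k : ℝ)]
            rw [← Real.rpow_add h0]; congr 1; ring
          have h5 : Real.exp (1 / 4 - x / 4) = Real.exp (1 / 4) * Real.exp (-(1 / 4 * x)) := by
            rw [← Real.exp_add]; congr 1; ring
          have h6 : (N k : ℝ) * (2 * Real.exp (1 / 4 - x / 4))
              ≤ n k * ((n k : ℝ) ^ (-(D + 1)) / 3) := by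
            rw [h5]
            calc _ ≤ C * n k * (2 * (Real.exp (1 / 4) * Real.exp (-(1 / 4 * x)))) := by gcongr
              _ = n k * (6 * C * Real.exp (1 / 4) * Real.exp (-(1 / 4 * x)) / 3) := by ring
              _ ≤ _ := by gcongr
          have h7 : (n k : ℝ) ^ (-(D + 1)) ≤ n k * (n k : ℝ) ^ (-(D + 1)) :=
            le_mul_of_one_le_left (by positivity) hn1
          rw [h4]
          linarith
  exact ENNReal.toReal_le_of_le_ofReal (by positivity) h3

end Domination

/-! ### The XOR vectors -/

theorem abs_xorV1_le (n : ℕ) (j : Fin n) : |xorV1 n j| ≤ √(2 / (n : ℝ)) := by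
  unfold xorV1
  split_ifs <;> simp only [abs_neg, abs_zero, abs_of_nonneg (Real.sqrt_nonneg _), le_refl,
    Real.sqrt_nonneg]

theorem abs_xorV2_le (n : ℕ) (j : Fin n) : |xorV2 n j| ≤ √(2 / (n : ℝ)) := by
  unfold xorV2
  split_ifs <;> simp only [abs_neg, abs_zero, abs_of_nonneg (Real.sqrt_nonneg _), le_refl,
    Real.sqrt_nonneg]

/-- Disjoint supports: no cross term g₁ ⊙ g₂ arises when the signal is squared entrywise. -/
theorem xorV1_mul_xorV2 (n : ℕ) (j : Fin n) : xorV1 n j * xorV2 n j = 0 := by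
  unfold xorV1 xorV2
  split_ifs <;> first | omega | simp

theorem xorU1_dotProduct_self {d : ℕ} (hd : 0 < d) : xorU1 d ⬝ᵥ xorU1 d = 1 := by
  have hd' : (0 : ℝ) < d := by exact_mod_cast hd
  have h : ∀ i, xorU1 d i * xorU1 d i = 1 / d := by
    intro i
    have : 1 / √(d : ℝ) * (1 / √(d : ℝ)) = 1 / d := by
      rw [div_mul_div_comm, Real.mul_self_sqrt hd'.le, one_mul]
    unfold xorU1
    split_ifs <;> simp only [neg_mul_neg, this]
  simp only [dotProduct, h]
  simp [hd'.ne']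

theorem xorU2_dotProduct_self {d : ℕ} (hd : 0 < d) : xorU2 d ⬝ᵥ xorU2 d = 1 := by
  have hd' : (0 : ℝ) < d := by exact_mod_cast hd
  have h : ∀ i, xorU2 d i * xorU2 d i = 1 / d := by
    intro i
    rw [xorU2, div_mul_div_comm, Real.mul_self_sqrt hd'.le, one_mul]
  simp only [dotProduct, h]
  simp [hd'.ne']

/-- Only the size n/2 of the support matters, not the place of the sign change, so divisibility by 2
is enough. -/
theorem xorV1_dotProduct_self {n : ℕ} (hn : 0 < n) (h2 : 2 ∣ n) : xorV1 n ⬝ᵥ xorV1 n = 1 := by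
  have hn' : (0 : ℝ) < n := by exact_mod_cast hn
  have h : ∀ j : Fin n, xorV1 n j * xorV1 n j = if (j : ℕ) < n / 2 then 2 / (n : ℝ) else 0 := by
    intro j
    have : √(2 / (n : ℝ)) * √(2 / (n : ℝ)) = 2 / n := Real.mul_self_sqrt (by positivity)
    unfold xorV1
    split_ifs <;> first | omega | simp only [neg_mul_neg, this, mul_zero]
  obtain ⟨m, rfl⟩ := h2
  simp only [dotProduct, h]
  rw [Fin.sum_univ_eq_sum_range (fun j => if j < 2 * m / 2 then 2 / ((2 * m : ℕ) : ℝ) else 0),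
    ← Finset.sum_filter]
  have : (Finset.range (2 * m)).filter (· < 2 * m / 2) = Finset.range m := by
    ext j; simp; omega
  rw [this, Finset.sum_const, Finset.card_range, nsmul_eq_mul]
  have : (m : ℝ) ≠ 0 := by
    rintro h0
    simp [h0] at hn'
  push_cast
  field_simp

/-! ### Taylor expansion -/

/-- The mean value inequality on [-|m|, |m|] is applied three times, starting from the bound on the
third derivative. This needs no continuity of that derivative; the price is the constant L instead
of L/6. -/
theorem abs_taylor_two_le {σ : ℝ → ℝ} {L : ℝ} (h0 : Differentiable ℝ σ)
    (h1 : Differentiable ℝ (deriv σ)) (h2 : Differentiable ℝ (deriv (deriv σ)))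
    (h3 : ∀ x, |deriv (deriv (deriv σ)) x| ≤ L) (x m : ℝ) :
    |σ (x + m) - σ x - deriv σ x * m - deriv (deriv σ) x * m ^ 2 / 2| ≤ L * |m| ^ 3 := by
  have mvt : ∀ (F F' : ℝ → ℝ) (c R : ℝ), (∀ t, HasDerivAt F (F' t) t) → F 0 = 0 →
      (∀ t, |t| ≤ R → |F' t| ≤ c) → ∀ t, |t| ≤ R → |F t| ≤ c * |t| := by
    intro F F' c R hF hF0 hF' t ht
    have hR : 0 ≤ R := (abs_nonneg _).trans ht
    have := Convex.norm_image_sub_le_of_norm_hasDerivWithin_le (f := F) (f' := F')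
      (s := Set.Icc (-R) R) (C := c) (fun s _ => (hF s).hasDerivWithinAt)
      (fun s hs => hF' s (abs_le.2 hs)) (convex_Icc _ _)
      (show (0 : ℝ) ∈ Set.Icc (-R) R from ⟨by linarith, hR⟩) (abs_le.1 ht)
    simpa [hF0] using this
  have hshift : ∀ {f : ℝ → ℝ}, Differentiable ℝ f → ∀ t,
      HasDerivAt (fun t => f (x + t)) (deriv f (x + t)) t := fun hf t => by
    simpa using (hf (x + t)).hasDerivAt.comp_const_add x t
  have e2 : ∀ t, |t| ≤ |m| → |deriv (deriv σ) (x + t) - deriv (deriv σ) x| ≤ L * |t| :=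
    mvt (fun t => deriv (deriv σ) (x + t) - deriv (deriv σ) x) _ L |m|
      (fun t => (hshift h2 t).sub_const _) (by simp) (fun t _ => h3 _)
  have hL : 0 ≤ L := (abs_nonneg _).trans (h3 0)
  have e1 : ∀ t, |t| ≤ |m| →
      |deriv σ (x + t) - deriv σ x - deriv (deriv σ) x * t| ≤ L * |m| * |t| :=
    mvt (fun t => deriv σ (x + t) - deriv σ x - deriv (deriv σ) x * t) _ (L * |m|) |m|
      (fun t => ((hshift h1 t).sub_const _).sub ((hasDerivAt_id t).const_mul _)) (by simp)
      (fun t ht => by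
        rw [mul_one]
        exact (e2 t ht).trans (by gcongr))
  have e0 : ∀ t, |t| ≤ |m| →
      |σ (x + t) - σ x - deriv σ x * t - deriv (deriv σ) x * t ^ 2 / 2| ≤ L * |m| * |m| * |t| := by
    refine mvt (fun t => σ (x + t) - σ x - deriv σ x * t - deriv (deriv σ) x * t ^ 2 / 2)
      (fun t => deriv σ (x + t) - deriv σ x - deriv (deriv σ) x * t) (L * |m| * |m|) |m|
      (fun t => ?_) (by simp) (fun t ht => (e1 t ht).trans (by gcongr))
    have h4 := (((hshift h0 t).sub_const (σ x)).sub ((hasDerivAt_id t).const_mul (deriv σ x))).sub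
      ((((hasDerivAt_id t).pow 2).const_mul (deriv (deriv σ) x)).div_const 2)
    refine (h4.congr_deriv ?_)
    simp
    ring
  refine (e0 m le_rfl).trans (le_of_eq (by ring))

/-! ### Deterministic comparison -/

section Deterministic

variable {σ : ℝ → ℝ} {L r : ℝ} {N d n : ℕ} (W : Matrix (Fin N) (Fin d) ℝ)
  (Z : Matrix (Fin d) (Fin n) ℝ)

/-- The total size of the two signal directions in feature space. -/
noncomputable def signalSize {N d : ℕ} (W : Matrix (Fin N) (Fin d) ℝ) : ℝ := ‖W *ᵥ xorU1 d‖ + ‖W *ᵥ xorU2 d‖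

/-- An entrywise bound for `W M`. -/
noncomputable def signalBound (r : ℝ) (n : ℕ) {N d : ℕ} (W : Matrix (Fin N) (Fin d) ℝ) : ℝ :=
  thetaSNR r n d * √(2 / (n : ℝ)) * signalSize W

theorem thetaSNR_nonneg (hr : 0 ≤ r) : 0 ≤ thetaSNR r n d := mul_nonneg hr (Real.sqrt_nonneg _)

theorem signalSize_nonneg : 0 ≤ signalSize W := by unfold signalSize; positivity

theorem signalBound_nonneg (hr : 0 ≤ r) : 0 ≤ signalBound r n W :=
  mul_nonneg (mul_nonneg (thetaSNR_nonneg hr) (Real.sqrt_nonneg _)) (signalSize_nonneg W)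

theorem mul_xorSignal_apply (i : Fin N) (j : Fin n) : (W * xorSignal r d n) i j
    = thetaSNR r n d * ((W *ᵥ xorU1 d) i * xorV1 n j + (W *ᵥ xorU2 d) i * xorV2 n j) := by
  rw [xorSignal, Matrix.mul_smul, Matrix.mul_add, mul_vecMulVec, mul_vecMulVec]
  simp [vecMulVec_apply]

theorem abs_mul_xorSignal_le (hr : 0 ≤ r) (i : Fin N) (j : Fin n) :
    |thetaSNR r n d * ((W *ᵥ xorU1 d) i * xorV1 n j + (W *ᵥ xorU2 d) i * xorV2 n j)|
      ≤ signalBound r n W := by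
  rw [abs_mul, abs_of_nonneg (thetaSNR_nonneg hr), signalBound, mul_assoc]
  refine mul_le_mul_of_nonneg_left ?_ (thetaSNR_nonneg hr)
  refine (abs_add_le _ _).trans ?_
  rw [abs_mul, abs_mul, signalSize, mul_add, mul_comm (√_), mul_comm (√_)]
  have h1 : |(W *ᵥ xorU1 d) i| ≤ ‖W *ᵥ xorU1 d‖ := norm_le_pi_norm (W *ᵥ xorU1 d) i
  have h2 : |(W *ᵥ xorU2 d) i| ≤ ‖W *ᵥ xorU2 d‖ := norm_le_pi_norm (W *ᵥ xorU2 d) i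
  have h3 := abs_xorV1_le n j
  have h4 := abs_xorV2_le n j
  gcongr

theorem sq_mul_xorSignal (i : Fin N) (j : Fin n) :
    (thetaSNR r n d * ((W *ᵥ xorU1 d) i * xorV1 n j + (W *ᵥ xorU2 d) i * xorV2 n j)) ^ 2
      = thetaSNR r n d ^ 2 * ((W *ᵥ xorU1 d) i ^ 2 * xorV1 n j ^ 2
        + (W *ᵥ xorU2 d) i ^ 2 * xorV2 n j ^ 2) := by
  linear_combination 2 * thetaSNR r n d ^ 2 * (W *ᵥ xorU1 d) i * (W *ᵥ xorU2 d) i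
    * xorV1_mul_xorV2 n j

/-- The entrywise product of `D` with the rank-one matrix a bᵀ equals diag(a) D diag(b), so
multiplying by a rank-one signal costs sup norms only and no power of the dimension. -/
theorem opNorm_diagonal_mul_mul_diagonal_le {a : Fin N → ℝ} {D : Matrix (Fin N) (Fin n) ℝ}
    {b : Fin n → ℝ} {α β : ℝ} (hα : 0 ≤ α) (hβ : 0 ≤ β) (ha : ∀ i, |a i| ≤ α)
    (hb : ∀ j, |b j| ≤ β) : opNorm (diagonal a * D * diagonal b) ≤ α * β * opNorm D := by
  refine (opNorm_mul_le _ _).trans ?_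
  have h1 := opNorm_diagonal_le hα ha
  have h2 := opNorm_diagonal_le hβ hb
  have h3 := opNorm_mul_le (diagonal a) D
  have h0 := opNorm_nonneg D
  calc _ ≤ opNorm (diagonal a) * opNorm D * opNorm (diagonal b) :=
        mul_le_mul_of_nonneg_right h3 (opNorm_nonneg _)
    _ ≤ α * opNorm D * β := by
        gcongr
        exact opNorm_nonneg _
    _ = _ := by ring

theorem opNorm_xorFeature_sub_qeFeature_le (hσ : ActivationAssumption σ L) (hr : 0 ≤ r) :
    opNorm (xorFeature σ r W Z - qeFeature σ r W Z)
      ≤ 1 / √(N : ℝ) * (signalBound r n W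
          * opNorm ((W * Z).map (deriv σ) - constMat N n (bCoeff σ))
        + signalBound r n W ^ 2
          * opNorm ((W * Z).map (deriv (deriv σ)) - constMat N n (cCoeff σ))
        + L * signalBound r n W ^ 3 * √(N * n)) := by
  set q := signalBound r n W with hq
  set θ := thetaSNR r n d with hθ
  set D₁ := (W * Z).map (deriv σ) - constMat N n (bCoeff σ) with hD₁
  set D₂ := (W * Z).map (deriv (deriv σ)) - constMat N n (cCoeff σ) with hD₂
  set g₁ := W *ᵥ xorU1 d with hg₁
  set g₂ := W *ᵥ xorU2 d with hg₂
  have hθ0 : 0 ≤ θ := thetaSNR_nonneg hr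
  have hq0 : 0 ≤ q := signalBound_nonneg W hr
  let m : Fin N → Fin n → ℝ := fun i j => θ * (g₁ i * xorV1 n j + g₂ i * xorV2 n j)
  let R : Matrix (Fin N) (Fin n) ℝ := Matrix.of fun i j =>
    σ ((W * Z) i j + m i j) - σ ((W * Z) i j) - deriv σ ((W * Z) i j) * m i j
      - deriv (deriv σ) ((W * Z) i j) * m i j ^ 2 / 2
  -- The Taylor polynomial minus the quadratic equivalent: the constants b_σ and c_σ are absorbed
  -- into the centered matrices `D₁` and `D₂`, and the square of the signal splits because the cross
  -- term vanishes.
  have hdecomp : xorFeature σ r W Z - qeFeature σ r W Z = (1 / √(N : ℝ)) •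
      (θ • (diagonal g₁ * D₁ * diagonal (xorV1 n) + diagonal g₂ * D₁ * diagonal (xorV2 n))
        + (θ ^ 2 / 2) • (diagonal (fun i => g₁ i ^ 2) * D₂ * diagonal (fun j => xorV1 n j ^ 2)
          + diagonal (fun i => g₂ i ^ 2) * D₂ * diagonal (fun j => xorV2 n j ^ 2)) + R) := by
    ext i j
    have hm2 : m i j ^ 2 = _ := sq_mul_xorSignal W i j
    have hWM : (W * (xorSignal r d n + Z)) i j = (W * Z) i j + m i j := by
      rw [Matrix.mul_add, Matrix.add_apply, mul_xorSignal_apply, add_comm]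
    simp only [xorFeature, qeFeature, featureMatrix, qeLinear, qeQuadratic, Matrix.sub_apply,
      Matrix.add_apply, Matrix.smul_apply, Matrix.map_apply, vecMulVec_apply, smul_eq_mul,
      mul_diagonal, diagonal_mul, hWM, hD₁, hD₂, constMat, Matrix.of_apply, R, hm2]
    simp only [m]
    ring
  have hR : opNorm R ≤ L * q ^ 3 * √(N * n) := by
    refine opNorm_le_of_abs_le (by have := hσ.pos; positivity) fun i j => ?_
    refine (abs_taylor_two_le hσ.diff_zero hσ.diff_one hσ.diff_two hσ.bound_three _ _).trans ?_
    have := abs_mul_xorSignal_le W hr i j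
    have := hσ.pos
    gcongr
  have hg₁' : ∀ i, |g₁ i| ≤ ‖g₁‖ := fun i => norm_le_pi_norm g₁ i
  have hg₂' : ∀ i, |g₂ i| ≤ ‖g₂‖ := fun i => norm_le_pi_norm g₂ i
  have h1 : opNorm (θ • (diagonal g₁ * D₁ * diagonal (xorV1 n)
      + diagonal g₂ * D₁ * diagonal (xorV2 n))) ≤ q * opNorm D₁ := by
    rw [opNorm_smul, abs_of_nonneg hθ0]
    calc _ ≤ θ * (‖g₁‖ * √(2 / (n : ℝ)) * opNorm D₁ + ‖g₂‖ * √(2 / (n : ℝ)) * opNorm D₁) := by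
          refine mul_le_mul_of_nonneg_left ((opNorm_add_le _ _).trans (add_le_add ?_ ?_)) hθ0
          · exact opNorm_diagonal_mul_mul_diagonal_le (norm_nonneg _) (Real.sqrt_nonneg _) hg₁'
              (abs_xorV1_le n)
          · exact opNorm_diagonal_mul_mul_diagonal_le (norm_nonneg _) (Real.sqrt_nonneg _) hg₂'
              (abs_xorV2_le n)
      _ = _ := by rw [hq, signalBound, signalSize]; ring
  have h2 : opNorm ((θ ^ 2 / 2) • (diagonal (fun i => g₁ i ^ 2) * D₂
        * diagonal (fun j => xorV1 n j ^ 2) + diagonal (fun i => g₂ i ^ 2) * D₂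
        * diagonal (fun j => xorV2 n j ^ 2))) ≤ q ^ 2 * opNorm D₂ := by
    rw [opNorm_smul, abs_of_nonneg (by positivity)]
    have hsq : ∀ {a b : ℝ}, |a| ≤ b → |a ^ 2| ≤ b ^ 2 := fun h => by
      rw [abs_pow]; gcongr
    calc _ ≤ θ ^ 2 / 2 * (‖g₁‖ ^ 2 * √(2 / (n : ℝ)) ^ 2 * opNorm D₂
          + ‖g₂‖ ^ 2 * √(2 / (n : ℝ)) ^ 2 * opNorm D₂) := by
          refine mul_le_mul_of_nonneg_left ((opNorm_add_le _ _).trans (add_le_add ?_ ?_))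
            (by positivity)
          · exact opNorm_diagonal_mul_mul_diagonal_le (by positivity) (by positivity)
              (fun i => hsq (hg₁' i)) (fun j => hsq (abs_xorV1_le n j))
          · exact opNorm_diagonal_mul_mul_diagonal_le (by positivity) (by positivity)
              (fun i => hsq (hg₂' i)) (fun j => hsq (abs_xorV2_le n j))
      _ = θ ^ 2 * √(2 / (n : ℝ)) ^ 2 * opNorm D₂ * ((‖g₁‖ ^ 2 + ‖g₂‖ ^ 2) / 2) := by ring
      _ ≤ θ ^ 2 * √(2 / (n : ℝ)) ^ 2 * opNorm D₂ * (‖g₁‖ + ‖g₂‖) ^ 2 := by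
          have := opNorm_nonneg D₂
          gcongr
          nlinarith [norm_nonneg g₁, norm_nonneg g₂,
            mul_nonneg (norm_nonneg g₁) (norm_nonneg g₂)]
      _ = _ := by rw [hq, signalBound, signalSize]; ring
  rw [hdecomp, opNorm_smul, abs_of_nonneg (by positivity)]
  refine mul_le_mul_of_nonneg_left ?_ (by positivity)
  exact (opNorm_add_le _ _).trans (add_le_add ((opNorm_add_le _ _).trans (add_le_add h1 h2)) hR)

theorem one_div_sqrt_mul_sqrt_mul_le : 1 / √(N : ℝ) * √((N : ℝ) * n) ≤ √(n : ℝ) := by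
  rw [Real.sqrt_mul (by positivity), ← mul_assoc]
  refine mul_le_of_le_one_left (by positivity) ?_
  rw [one_div]
  exact inv_mul_le_one

theorem opNorm_qeFeature_sub_qeLinear_le (hσ : ActivationAssumption σ L) (hr : 0 ≤ r) :
    opNorm (qeFeature σ r W Z - qeLinear σ r n W)
      ≤ 1 / √(N : ℝ) * opNorm ((W * Z).map σ - constMat N n (∫ x, σ x ∂(gaussianReal 0 1)))
        + |cCoeff σ| * signalBound r n W ^ 2 * √n := by
  have h0 : qeFeature σ r W Z - qeLinear σ r n W = featureMatrix σ W Z + qeQuadratic σ r n W := by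
    rw [qeFeature]; abel
  rw [h0]
  refine (opNorm_add_le _ _).trans (add_le_add (le_of_eq ?_) ?_)
  · have : constMat N n (∫ x, σ x ∂(gaussianReal 0 1)) = 0 := by
      rw [hσ.centered]; rfl
    rw [this, sub_zero, featureMatrix, opNorm_smul, abs_of_nonneg (by positivity)]
  · have hq0 : 0 ≤ signalBound r n W := signalBound_nonneg W hr
    refine (opNorm_le_of_abs_le (c := 1 / √(N : ℝ) * (|cCoeff σ| * signalBound r n W ^ 2))
      (by positivity) fun i j => ?_).trans ?_
    · have h1 : qeQuadratic σ r n W i j = 1 / √(N : ℝ) * (cCoeff σ / 2 * (thetaSNR r n d *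
          ((W *ᵥ xorU1 d) i * xorV1 n j + (W *ᵥ xorU2 d) i * xorV2 n j)) ^ 2) := by
        rw [sq_mul_xorSignal]
        simp only [qeQuadratic, Matrix.smul_apply, Matrix.add_apply, vecMulVec_apply, smul_eq_mul]
        ring
      rw [h1, abs_mul, abs_of_nonneg (by positivity : 0 ≤ 1 / √(N : ℝ)), abs_mul, abs_pow]
      have h2 := abs_mul_xorSignal_le W hr i j
      have h3 : |cCoeff σ / 2| ≤ |cCoeff σ| := by
        rw [abs_div, abs_two]
        linarith [abs_nonneg (cCoeff σ)]
      gcongr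
    · calc _ = |cCoeff σ| * signalBound r n W ^ 2 * (1 / √(N : ℝ) * √((N : ℝ) * n)) := by ring
        _ ≤ _ := by
          gcongr
          exact one_div_sqrt_mul_sqrt_mul_le

theorem opNorm_qeLinear_le (hr : 0 ≤ r) (hn : 0 < n) :
    opNorm (qeLinear σ r n W) ≤ 2 * (thetaSNR r n d * |bCoeff σ| * signalSize W) := by
  have hq0 : 0 ≤ signalBound r n W := signalBound_nonneg W hr
  refine (opNorm_le_of_abs_le (c := 1 / √(N : ℝ) * (|bCoeff σ| * signalBound r n W))
      (by positivity) fun i j => ?_).trans ?_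
  · have h1 : qeLinear σ r n W i j = 1 / √(N : ℝ) * (bCoeff σ * (thetaSNR r n d *
          ((W *ᵥ xorU1 d) i * xorV1 n j + (W *ᵥ xorU2 d) i * xorV2 n j))) := by
      simp only [qeLinear, Matrix.smul_apply, Matrix.add_apply, vecMulVec_apply, smul_eq_mul]
      ring
    rw [h1, abs_mul, abs_of_nonneg (by positivity : 0 ≤ 1 / √(N : ℝ)), abs_mul]
    have h2 := abs_mul_xorSignal_le W hr i j
    gcongr
  · calc _ = |bCoeff σ| * signalBound r n W * (1 / √(N : ℝ) * √((N : ℝ) * n)) := by ring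
      _ ≤ |bCoeff σ| * signalBound r n W * √n := by
        gcongr
        exact one_div_sqrt_mul_sqrt_mul_le
      _ = thetaSNR r n d * |bCoeff σ| * signalSize W * √(2 / (n : ℝ) * n) := by
        rw [Real.sqrt_mul (by positivity), signalBound]; ring
      _ ≤ thetaSNR r n d * |bCoeff σ| * signalSize W * 2 := by
        have := thetaSNR_nonneg (n := n) (d := d) hr
        have := signalSize_nonneg W
        have hn' : (n : ℝ) ≠ 0 := by positivity
        gcongr
        rw [div_mul_cancel₀ _ hn']
        exact Real.sqrt_le_iff.2 ⟨by norm_num, by norm_num⟩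
      _ = _ := by ring

/-- Test the matrix against g₁ = W u₁ and v₁: orthogonality of v₁ and v₂ removes the second rank-one
term. -/
theorem le_opNorm_qeLinear (hr : 0 ≤ r) (hn : 0 < n) (h2 : 2 ∣ n) :
    thetaSNR r n d * |bCoeff σ| / √(N : ℝ) * √(∑ i, (W *ᵥ xorU1 d) i ^ 2)
      ≤ opNorm (qeLinear σ r n W) := by
  set g := W *ᵥ xorU1 d with hg
  set s := √(∑ i, g i ^ 2) with hs
  have hnorm : ‖(WithLp.toLp 2 g : EuclideanSpace ℝ (Fin N))‖ = s := by
    rw [EuclideanSpace.norm_eq]; simp [hs]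
  have hv : ‖(WithLp.toLp 2 (xorV1 n) : EuclideanSpace ℝ (Fin n))‖ = 1 := by
    have := xorV1_dotProduct_self hn h2
    rwa [dotProduct_eq_norm_sq, pow_eq_one_iff_of_nonneg (norm_nonneg _) two_ne_zero] at this
  have h21 : xorV2 n ⬝ᵥ xorV1 n = 0 := by
    simp only [dotProduct]
    exact Finset.sum_eq_zero fun j _ => by rw [mul_comm]; exact xorV1_mul_xorV2 n j
  have h1 := abs_dotProduct_mulVec_le (qeLinear σ r n W) g (xorV1 n)
  have hsq : g ⬝ᵥ (W *ᵥ xorU1 d) = s ^ 2 := by rw [← hg, dotProduct_eq_norm_sq, hnorm]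
  have h3 : g ⬝ᵥ (qeLinear σ r n W *ᵥ xorV1 n) = thetaSNR r n d * bCoeff σ / √(N : ℝ) * s ^ 2 := by
    rw [qeLinear, smul_mulVec, add_mulVec, vecMulVec_mulVec, vecMulVec_mulVec,
      xorV1_dotProduct_self hn h2, h21]
    simp [hsq]
  rw [h3, hnorm, hv, mul_one, abs_mul, abs_div, abs_mul, abs_of_nonneg (thetaSNR_nonneg hr),
    abs_of_nonneg (Real.sqrt_nonneg _), abs_of_nonneg (sq_nonneg s)] at h1
  rcases eq_or_lt_of_le (show 0 ≤ s from Real.sqrt_nonneg _) with h | h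
  · rw [← h, mul_zero]; exact opNorm_nonneg _
  · rw [sq, ← mul_assoc] at h1
    exact le_of_mul_le_mul_right h1 h

end Deterministic

/-! ### Domination of the feature matrices -/

section Assembly

variable {Ω : Type*} [MeasurableSpace Ω] {P : Measure Ω} [IsProbabilityMeasure P] {σ : ℝ → ℝ}
  {L : ℝ} {n d N : ℕ → ℕ} {φ ψ : ℝ} {r : ℕ → ℝ}
  {W : (k : ℕ) → Ω → Matrix (Fin (N k)) (Fin (d k)) ℝ}
  {Z : (k : ℕ) → Ω → Matrix (Fin (d k)) (Fin (n k)) ℝ}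

theorem stochDom_signalSize (hlim : ProportionalLimit n d N φ ψ)
    (hWZ : ∀ k, IsGaussianPair P (W k) (Z k)) :
    StochDom P n (fun k ω => signalSize (W k ω)) (fun _ => 1) := by
  obtain ⟨C, hC, hcomp⟩ := hlim.exists_comparable
  exact StochDom.add hlim.n_top (fun _ => zero_le_one)
    (stochDom_norm_mulVec hlim hWZ _ (hcomp.mono fun k hk => (xorU1_dotProduct_self hk.2.1).le))
    (stochDom_norm_mulVec hlim hWZ _ (hcomp.mono fun k hk => (xorU2_dotProduct_self hk.2.1).le))

/-- Here θ √(2/n) = r / √d, since (n / 2d)(2 / n) = 1/d; with d comparable to n and r = O(n^{1/4})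
this is of order n^{-1/4}. -/
theorem exists_signalBound_le (hlim : ProportionalLimit n d N φ ψ)
    (hr : r =O[atTop] fun k => (n k : ℝ) ^ (1 / 4 : ℝ)) :
    ∃ C : ℝ, 0 < C ∧ ∀ᶠ k in atTop, ∀ A : Matrix (Fin (N k)) (Fin (d k)) ℝ,
      signalBound (r k) (n k) A ≤ C * ((n k : ℝ) ^ (-(1 / 4) : ℝ) * signalSize A) := by
  obtain ⟨C, hC, hcomp⟩ := hlim.exists_comparable
  obtain ⟨C', hC', hr'⟩ := hr.exists_pos
  refine ⟨C' * √C, by positivity, ?_⟩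
  filter_upwards [hcomp, hr'.bound] with k hk hrk A
  obtain ⟨hn0, hd, -, -, -, -, hnd⟩ := hk
  have h0 : (0 : ℝ) < n k := by exact_mod_cast hn0
  have hd0 : (0 : ℝ) < d k := by exact_mod_cast hd
  rw [Real.norm_eq_abs, Real.norm_eq_abs, abs_of_pos (by positivity : 0 < (n k : ℝ) ^ (1 / 4 : ℝ))]
    at hrk
  have h1 : √((n k : ℝ) / (2 * d k)) * √(2 / (n k : ℝ)) ≤ √C * (n k : ℝ) ^ (-(1 / 2) : ℝ) := by
    rw [← Real.sqrt_mul (by positivity), Real.rpow_neg h0.le, ← Real.sqrt_eq_rpow, ← Real.sqrt_inv,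
      ← Real.sqrt_mul (by positivity)]
    refine Real.sqrt_le_sqrt ?_
    have : (n k : ℝ) / (2 * d k) * (2 / n k) = (d k : ℝ)⁻¹ := by field_simp
    rw [this, ← div_eq_mul_inv, le_div_iff₀ h0, inv_mul_le_iff₀ hd0, mul_comm]
    exact hnd
  have h2 : (n k : ℝ) ^ (1 / 4 : ℝ) * (n k : ℝ) ^ (-(1 / 2) : ℝ) = (n k : ℝ) ^ (-(1 / 4) : ℝ) := by
    rw [← Real.rpow_add h0]; norm_num
  rw [signalBound, thetaSNR, mul_assoc (r k), ← mul_assoc (C' * √C)]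
  refine mul_le_mul_of_nonneg_right ?_ (signalSize_nonneg A)
  calc _ ≤ |r k| * (√C * (n k : ℝ) ^ (-(1 / 2) : ℝ)) :=
        mul_le_mul (le_abs_self _) h1 (by positivity) (abs_nonneg _)
    _ ≤ C' * (n k : ℝ) ^ (1 / 4 : ℝ) * (√C * (n k : ℝ) ^ (-(1 / 2) : ℝ)) := by gcongr
    _ = C' * √C * ((n k : ℝ) ^ (1 / 4 : ℝ) * (n k : ℝ) ^ (-(1 / 2) : ℝ)) := by ring
    _ = _ := by rw [h2]

theorem stochDom_scaled_feature (hlim : ProportionalLimit n d N φ ψ)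
    (hWZ : ∀ k, IsGaussianPair P (W k) (Z k)) {f : ℝ → ℝ} (hf : Differentiable ℝ f)
    (hL0 : 0 < L) (hL : ∀ x, |deriv f x| ≤ L) :
    StochDom P n (fun k ω => 1 / √(N k : ℝ) * opNorm ((W k ω * Z k ω).map f
      - constMat (N k) (n k) (∫ x, f x ∂(gaussianReal 0 1)))) (fun _ => 1) := by
  obtain ⟨C, hC, hcomp⟩ := hlim.exists_comparable
  have h1 := (stochDom_feature hlim hWZ hf hL0 hL).const_mul (fun k => 1 / √(n k : ℝ))
    (hcomp.mono fun k hk => one_div_pos.2 (Real.sqrt_pos.2 (by exact_mod_cast hk.1)))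
  have h2 : StochDom P n _ (fun _ => (1 : ℝ)) := h1.mono_right (B' := fun _ => 1)
    (Eventually.of_forall fun k => by rw [one_div]; exact inv_mul_le_one)
  refine h2.of_le_mul hlim.n_top (fun _ => zero_le_one) (C := √C) (by positivity) ?_
  filter_upwards [hcomp] with k hk ω
  obtain ⟨hn0, -, hN, -, hnN, -, -⟩ := hk
  have h0 : (0 : ℝ) < n k := by exact_mod_cast hn0
  have hN0 : (0 : ℝ) < N k := by exact_mod_cast hN
  rw [← mul_assoc]
  refine mul_le_mul_of_nonneg_right ?_ (opNorm_nonneg _)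
  rw [mul_one_div, div_le_div_iff₀ (Real.sqrt_pos.2 hN0) (Real.sqrt_pos.2 h0), one_mul,
    ← Real.sqrt_mul (by positivity)]
  exact Real.sqrt_le_sqrt hnN

theorem rpow_neg_quarter_facts {x : ℝ} (hx : 1 ≤ x) : 0 < x ^ (-(1 / 4) : ℝ) ∧
    x ^ (-(1 / 4) : ℝ) ≤ 1 ∧ (x ^ (-(1 / 4) : ℝ)) ^ 2 * √x = 1 := by
  have h0 : 0 < x := by linarith
  refine ⟨by positivity, Real.rpow_le_one_of_one_le_of_nonpos hx (by norm_num), ?_⟩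
  rw [← Real.rpow_natCast, ← Real.rpow_mul h0.le, Real.sqrt_eq_rpow, ← Real.rpow_add h0]
  norm_num

/-- With a = n^{-1/4}, the three errors are of order a, a² and a³ √n, and a² √n = 1. The growth rate
n^{1/4} of r is thus the one at which the bounds for the cubic remainder and the linear fluctuation
balance. -/
theorem stochDom_xorFeature_sub_qeFeature (hσ : ActivationAssumption σ L)
    (hlim : ProportionalLimit n d N φ ψ) (hr0 : ∀ k, 0 ≤ r k)
    (hr : r =O[atTop] fun k => (n k : ℝ) ^ (1 / 4 : ℝ))
    (hWZ : ∀ k, IsGaussianPair P (W k) (Z k)) :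
    StochDom P n (fun k ω => opNorm (xorFeature σ (r k) (W k ω) (Z k ω)
      - qeFeature σ (r k) (W k ω) (Z k ω))) (fun k => (n k : ℝ) ^ (-(1 / 4) : ℝ)) := by
  have hn := hlim.n_top
  obtain ⟨C, hC, hbound⟩ := exists_signalBound_le (n := n) hlim hr
  set G : ℕ → Ω → ℝ := fun k ω => signalSize (W k ω) with hG
  set R₁ : ℕ → Ω → ℝ := fun k ω => 1 / √(N k : ℝ) *
    opNorm ((W k ω * Z k ω).map (deriv σ) - constMat (N k) (n k) (bCoeff σ)) with hR₁
  set R₂ : ℕ → Ω → ℝ := fun k ω => 1 / √(N k : ℝ) *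
    opNorm ((W k ω * Z k ω).map (deriv (deriv σ)) - constMat (N k) (n k) (cCoeff σ)) with hR₂
  have hG0 : ∀ k ω, 0 ≤ G k ω := fun k ω => signalSize_nonneg _
  have hR₁0 : ∀ k ω, 0 ≤ R₁ k ω := fun k ω => mul_nonneg (by positivity) (opNorm_nonneg _)
  have hR₂0 : ∀ k ω, 0 ≤ R₂ k ω := fun k ω => mul_nonneg (by positivity) (opNorm_nonneg _)
  have dG : StochDom P n G (fun _ => 1) := stochDom_signalSize hlim hWZ
  have dR₁ : StochDom P n R₁ (fun _ => 1) :=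
    stochDom_scaled_feature hlim hWZ hσ.diff_one hσ.pos hσ.bound_two
  have dR₂ : StochDom P n R₂ (fun _ => 1) :=
    stochDom_scaled_feature hlim hWZ hσ.diff_two hσ.pos hσ.bound_three
  have dGG : StochDom P n (fun k ω => G k ω * G k ω) (fun _ => 1) := by
    simpa using dG.mul hn hG0 hG0 dG
  have hGG0 : ∀ k ω, 0 ≤ G k ω * G k ω := fun k ω => mul_self_nonneg _
  have d1 : StochDom P n (fun k ω => G k ω * R₁ k ω) (fun _ => 1) := by
    simpa using dG.mul hn hG0 hR₁0 dR₁
  have d2 : StochDom P n (fun k ω => G k ω * G k ω * R₂ k ω) (fun _ => 1) := by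
    simpa using dGG.mul hn hGG0 hR₂0 dR₂
  have d3 : StochDom P n (fun k ω => G k ω * G k ω * G k ω) (fun _ => 1) := by
    simpa using dGG.mul hn hGG0 hG0 dG
  have dsum := ((d1.add hn (fun _ => zero_le_one) d2).add hn (fun _ => zero_le_one) d3).const_mul
    (fun k => (n k : ℝ) ^ (-(1 / 4) : ℝ)) (by
      filter_upwards [hn.eventually_ge_atTop 1] with k hk
      exact (rpow_neg_quarter_facts (by exact_mod_cast hk)).1)
  simp only [mul_one] at dsum
  refine dsum.of_le_mul hn (fun k => by positivity) (C := C + C ^ 2 + L * C ^ 3)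
    (by have := hσ.pos; positivity) ?_
  filter_upwards [hbound, hn.eventually_ge_atTop 1] with k hk hn1 ω
  obtain ⟨ha0, ha1, ha2⟩ := rpow_neg_quarter_facts (x := n k) (by exact_mod_cast hn1)
  set a := (n k : ℝ) ^ (-(1 / 4) : ℝ)
  have hq := hk (W k ω)
  have hq0 := signalBound_nonneg (n := n k) (W k ω) (hr0 k)
  set q := signalBound (r k) (n k) (W k ω)
  have hL := hσ.pos
  have h1 := opNorm_xorFeature_sub_qeFeature_le (W k ω) (Z k ω) hσ (hr0 k)
  have hg := hG0 k ω
  have hr1 := hR₁0 k ω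
  have hr2 := hR₂0 k ω
  have h2 : opNorm (xorFeature σ (r k) (W k ω) (Z k ω) - qeFeature σ (r k) (W k ω) (Z k ω))
      ≤ q * R₁ k ω + q ^ 2 * R₂ k ω + L * q ^ 3 * √(n k) := by
    refine h1.trans ?_
    have h3 : L * q ^ 3 * (1 / √(N k : ℝ) * √((N k : ℝ) * n k)) ≤ L * q ^ 3 * √(n k) := by
      gcongr
      exact one_div_sqrt_mul_sqrt_mul_le
    simp only [hR₁, hR₂]
    linarith
  change q ≤ C * (a * G k ω) at hq
  have t1 : q * R₁ k ω ≤ C * (a * (G k ω * R₁ k ω)) := by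
    calc _ ≤ C * (a * G k ω) * R₁ k ω := by gcongr
      _ = _ := by ring
  have t2 : q ^ 2 * R₂ k ω ≤ C ^ 2 * (a * (G k ω * G k ω * R₂ k ω)) := by
    calc _ ≤ (C * (a * G k ω)) ^ 2 * R₂ k ω := by gcongr
      _ = C ^ 2 * (a * (G k ω * G k ω * R₂ k ω)) * a := by ring
      _ ≤ _ := mul_le_of_le_one_right (by positivity) ha1
  have t3 : L * q ^ 3 * √(n k) ≤ L * C ^ 3 * (a * (G k ω * G k ω * G k ω)) := by
    calc _ ≤ L * (C * (a * G k ω)) ^ 3 * √(n k) := by gcongr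
      _ = L * C ^ 3 * (a * (G k ω * G k ω * G k ω)) * (a ^ 2 * √(n k)) := by ring
      _ = _ := by rw [ha2, mul_one]
  have p1 : 0 ≤ a * (G k ω * R₁ k ω) := by positivity
  have p2 : 0 ≤ a * (G k ω * G k ω * R₂ k ω) := by positivity
  have p3 : 0 ≤ a * (G k ω * G k ω * G k ω) := by positivity
  have c2 : 0 ≤ C ^ 2 := by positivity
  have c3 : 0 ≤ L * C ^ 3 := by positivity
  calc _ ≤ C * (a * (G k ω * R₁ k ω)) + C ^ 2 * (a * (G k ω * G k ω * R₂ k ω))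
        + L * C ^ 3 * (a * (G k ω * G k ω * G k ω)) := by linarith
    _ ≤ (C + C ^ 2 + L * C ^ 3) * (a * (G k ω * R₁ k ω))
        + (C + C ^ 2 + L * C ^ 3) * (a * (G k ω * G k ω * R₂ k ω))
        + (C + C ^ 2 + L * C ^ 3) * (a * (G k ω * G k ω * G k ω)) := by
      gcongr <;> linarith
    _ = _ := by ring

/-- The pure noise features are of order one because σ is centered, and the Frobenius norm of the
quadratic term is at most |c_σ| q² √n, in which the powers of n cancel. -/
theorem stochDom_qeFeature_sub_qeLinear (hσ : ActivationAssumption σ L)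
    (hlim : ProportionalLimit n d N φ ψ) (hr0 : ∀ k, 0 ≤ r k)
    (hr : r =O[atTop] fun k => (n k : ℝ) ^ (1 / 4 : ℝ))
    (hWZ : ∀ k, IsGaussianPair P (W k) (Z k)) :
    StochDom P n (fun k ω => opNorm (qeFeature σ (r k) (W k ω) (Z k ω)
      - qeLinear σ (r k) (n k) (W k ω))) (fun _ => 1) := by
  have hn := hlim.n_top
  obtain ⟨C, hC, hbound⟩ := exists_signalBound_le (n := n) hlim hr
  have hG0 : ∀ k ω, 0 ≤ signalSize (W k ω) := fun k ω => signalSize_nonneg _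
  have dG := stochDom_signalSize hlim hWZ
  have dR := stochDom_scaled_feature hlim hWZ hσ.diff_zero hσ.pos hσ.bound_one
  have dGG : StochDom P n (fun k ω => signalSize (W k ω) * signalSize (W k ω)) (fun _ => 1) := by
    simpa using dG.mul hn hG0 hG0 dG
  refine (dR.add hn (fun _ => zero_le_one) dGG).of_le_mul hn (fun _ => zero_le_one)
    (C := 1 + |cCoeff σ| * C ^ 2) (by positivity) ?_
  filter_upwards [hbound, hn.eventually_ge_atTop 1] with k hk hn1 ω
  obtain ⟨ha0, ha1, ha2⟩ := rpow_neg_quarter_facts (x := n k) (by exact_mod_cast hn1)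
  set a := (n k : ℝ) ^ (-(1 / 4) : ℝ)
  have hq := hk (W k ω)
  have hq0 := signalBound_nonneg (n := n k) (W k ω) (hr0 k)
  have h1 := opNorm_qeFeature_sub_qeLinear_le (W k ω) (Z k ω) hσ (hr0 k)
  set q := signalBound (r k) (n k) (W k ω)
  set g := signalSize (W k ω)
  have h2 : |cCoeff σ| * q ^ 2 * √(n k) ≤ |cCoeff σ| * C ^ 2 * (g * g) := by
    calc _ ≤ |cCoeff σ| * (C * (a * g)) ^ 2 * √(n k) := by gcongr
      _ = |cCoeff σ| * C ^ 2 * (g * g) * (a ^ 2 * √(n k)) := by ring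
      _ = _ := by rw [ha2, mul_one]
  have h3 : 0 ≤ 1 / √(N k : ℝ) * opNorm ((W k ω * Z k ω).map σ
      - constMat (N k) (n k) (∫ x, σ x ∂(gaussianReal 0 1))) :=
    mul_nonneg (by positivity) (opNorm_nonneg _)
  have h4 : 0 ≤ |cCoeff σ| * C ^ 2 := by positivity
  have h5 := mul_nonneg h4 h3
  have h6 := mul_self_nonneg g
  linarith

/-- If the quadratic equivalent is bounded in probability then the linear signal term is of
order one. -/
theorem stochDom_thetaSNR_of_boundedInProb (hσ : ActivationAssumption σ L)
    (hlim : ProportionalLimit n d N φ ψ) (hn4 : ∀ k, 4 ∣ n k) (hr0 : ∀ k, 0 ≤ r k)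
    (hr : r =O[atTop] fun k => (n k : ℝ) ^ (1 / 4 : ℝ))
    (hWZ : ∀ k, IsGaussianPair P (W k) (Z k))
    (hb : BoundedInProb P fun k ω => opNorm (qeFeature σ (r k) (W k ω) (Z k ω))) :
    StochDom P n (fun k _ => thetaSNR (r k) (n k) (d k) * |bCoeff σ|) (fun _ => 1) := by
  have hn := hlim.n_top
  obtain ⟨C, hC, hcomp⟩ := hlim.exists_comparable
  refine StochDom.of_deterministic fun ε hε => ?_
  obtain ⟨K, hK⟩ := hb (1 / 4) (by norm_num)
  have hdom := stochDom_qeFeature_sub_qeLinear hσ hlim hr0 hr hWZ (ε / 2) (half_pos hε) 1 one_pos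
  filter_upwards [hK, hdom, hcomp, hn.eventually_ge_atTop 4,
    -- The argument ends with y ≤ 8(K + x), and x ≥ 8|K| + 9 makes the right side smaller than x² =
    -- n^ε.
    eventually_le_rpow hn (half_pos hε) (8 * |K| + 9)] with k h1 h2 hk hn1 h3
  obtain ⟨hn0, hd, hN, -, -, -, -⟩ := hk
  have h0 : (0 : ℝ) < n k := by exact_mod_cast hn0
  have hN0 : (0 : ℝ) < N k := by exact_mod_cast hN
  set x := (n k : ℝ) ^ (ε / 2) with hx
  have hxε : (n k : ℝ) ^ ε = x * x := by
    rw [hx, ← Real.rpow_add h0]; congr 1; ring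
  set A₁ : Set Ω := {ω | K < opNorm (qeFeature σ (r k) (W k ω) (Z k ω))}
  set A₂ : Set Ω := {ω | ω ∈ Set.univ ∧ x * 1 ≤ opNorm (qeFeature σ (r k) (W k ω) (Z k ω)
      - qeLinear σ (r k) (n k) (W k ω))}
  set A₃ : Set Ω := {ω | ∑ i, (W k ω *ᵥ xorU1 (d k)) i ^ 2 ≤ (N k : ℝ) / 60}
  have hA₂ : P.real A₂ ≤ 1 / 4 := by
    refine h2.trans ?_
    rw [Real.rpow_neg_one, one_div]
    exact inv_anti₀ (by norm_num) (by exact_mod_cast hn1)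
  have hA₃ : P.real A₃ ≤ 1 / 3 := by
    have h4 := (hWZ k).measure_le hd
      (fun A _ => ∑ i, (A *ᵥ xorU1 (d k)) i ^ 2 ≤ (N k : ℝ) / 60)
    have h5 : {z : EuclideanSpace ℝ (Fin (N k) × Fin (d k)) ×
        EuclideanSpace ℝ (Fin (d k) × Fin (n k)) |
          ∑ i, (toMat z.1 *ᵥ xorU1 (d k)) i ^ 2 ≤ (N k : ℝ) / 60}
        = {w | ∑ i, (toMat w *ᵥ xorU1 (d k)) i ^ 2 ≤ (N k : ℝ) / 60} ×ˢ Set.univ := by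
      ext z; simp
    rw [h5, Measure.prod_prod, measure_univ, mul_one] at h4
    exact ENNReal.toReal_le_of_le_ofReal (by norm_num)
      (h4.trans (stdGaussian_sum_mulVec_sq_le hN (xorU1_dotProduct_self hd)))
  -- The bad events have total probability at most 1/4 + 1/4 + 1/3 < 1. A single good sample point
  -- suffices, since the quantity to be bounded is deterministic.
  obtain ⟨ω, hω⟩ : ∃ ω, ω ∉ A₁ ∪ A₂ ∪ A₃ := by
    by_contra! hcon
    have h4 : P.real (A₁ ∪ A₂ ∪ A₃) = 1 := by
      rw [Set.eq_univ_of_forall hcon]; simp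
    have h5 := measureReal_union_le (μ := P) (A₁ ∪ A₂) A₃
    have h6 := measureReal_union_le (μ := P) A₁ A₂
    linarith
  simp only [A₁, A₂, A₃, Set.mem_union, Set.mem_ofPred_eq, Set.mem_univ, true_and, not_or, not_lt,
    not_le, mul_one] at hω
  obtain ⟨⟨h4, h5⟩, h6⟩ := hω
  have h7 := le_opNorm_qeLinear (σ := σ) (W k ω) (hr0 k) hn0 ((by norm_num : 2 ∣ 4).trans (hn4 k))
  have h8 : opNorm (qeLinear σ (r k) (n k) (W k ω)) ≤ K + x := by
    have h9 := opNorm_sub_le (qeFeature σ (r k) (W k ω) (Z k ω)) (qeFeature σ (r k) (W k ω) (Z k ω)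
      - qeLinear σ (r k) (n k) (W k ω))
    rw [sub_sub_cancel] at h9
    linarith
  set y := thetaSNR (r k) (n k) (d k) * |bCoeff σ|
  have hy : 0 ≤ y := mul_nonneg (thetaSNR_nonneg (hr0 k)) (abs_nonneg _)
  -- The factor 8 comes from 1/64 ≤ 1/60.
  have h9 : √(N k : ℝ) / 8 ≤ √(∑ i, (W k ω *ᵥ xorU1 (d k)) i ^ 2) := by
    refine Real.le_sqrt_of_sq_le ?_
    rw [div_pow, Real.sq_sqrt hN0.le]
    linarith
  have h10 : y / 8 ≤ K + x := by
    refine le_trans ?_ (h7.trans h8)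
    calc y / 8 = y / √(N k : ℝ) * (√(N k : ℝ) / 8) := by
          have : √(N k : ℝ) ≠ 0 := (Real.sqrt_pos.2 hN0).ne'
          field_simp
      _ ≤ _ := by gcongr
  rw [hxε, mul_one]
  have h11 := le_abs_self K
  have h12 := abs_nonneg K
  nlinarith

/-- Boundedness in probability is used only to bound the deterministic size of the linear term; the
overwhelming-probability tail then comes from the Gaussian factor `signalSize`. -/
theorem stochDom_qeFeature_of_boundedInProb (hσ : ActivationAssumption σ L)
    (hlim : ProportionalLimit n d N φ ψ) (hn4 : ∀ k, 4 ∣ n k) (hr0 : ∀ k, 0 ≤ r k)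
    (hr : r =O[atTop] fun k => (n k : ℝ) ^ (1 / 4 : ℝ))
    (hWZ : ∀ k, IsGaussianPair P (W k) (Z k))
    (hb : BoundedInProb P fun k ω => opNorm (qeFeature σ (r k) (W k ω) (Z k ω))) :
    StochDom P n (fun k ω => opNorm (qeFeature σ (r k) (W k ω) (Z k ω))) (fun _ => 1) := by
  have hn := hlim.n_top
  have d1 := stochDom_thetaSNR_of_boundedInProb hσ hlim hn4 hr0 hr hWZ hb
  have d2 : StochDom P n (fun k ω => thetaSNR (r k) (n k) (d k) * |bCoeff σ| *
      signalSize (W k ω)) (fun _ => 1) := by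
    simpa using d1.mul hn
      (fun k _ => mul_nonneg (thetaSNR_nonneg (hr0 k)) (abs_nonneg _))
      (fun k ω => signalSize_nonneg _) (stochDom_signalSize hlim hWZ)
  refine ((stochDom_qeFeature_sub_qeLinear hσ hlim hr0 hr hWZ).add hn (fun _ => zero_le_one)
    d2).of_le_mul hn (fun _ => zero_le_one) (C := 2) two_pos ?_
  filter_upwards [hn.eventually_ge_atTop 1] with k hk ω
  have h1 := opNorm_add_le (qeFeature σ (r k) (W k ω) (Z k ω) - qeLinear σ (r k) (n k) (W k ω))
    (qeLinear σ (r k) (n k) (W k ω))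
  rw [sub_add_cancel] at h1
  have h2 := opNorm_qeLinear_le (σ := σ) (W k ω) (hr0 k) hk
  have h3 := opNorm_nonneg (qeFeature σ (r k) (W k ω) (Z k ω) - qeLinear σ (r k) (n k) (W k ω))
  linarith

end Assembly

/-! ### Consequences for the spectra -/

section Spectra

variable {Ω : Type*} [MeasurableSpace Ω] {P : Measure Ω} [IsProbabilityMeasure P] {n N : ℕ → ℕ}
  {Y Y' : (k : ℕ) → Ω → Matrix (Fin (N k)) (Fin (n k)) ℝ}

theorem stochDom_ckGram_sub (hn : Tendsto n atTop atTop)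
    (hY : StochDom P n (fun k ω => opNorm (Y k ω)) (fun _ => 1))
    (hY' : StochDom P n (fun k ω => opNorm (Y' k ω)) (fun _ => 1))
    (h : StochDom P n (fun k ω => opNorm (Y k ω - Y' k ω))
      (fun k => (n k : ℝ) ^ (-(1 / 4) : ℝ))) :
    StochDom P n (fun k ω => opNorm (ckGram (Y k ω) - ckGram (Y' k ω)))
      (fun k => (n k : ℝ) ^ (-(1 / 4) : ℝ)) := by
  have h1 := (hY.add hn (fun _ => zero_le_one) hY').mul hn
    (fun k ω => add_nonneg (opNorm_nonneg _) (opNorm_nonneg _)) (fun k ω => opNorm_nonneg _) h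
  simp only [one_mul] at h1
  refine h1.of_le_mul hn (fun k => by positivity) one_pos (Eventually.of_forall fun k ω => ?_)
  rw [one_mul]
  exact opNorm_ckGram_sub_le _ _

theorem spectraMatch_of_stochDom (hn : Tendsto n atTop atTop)
    (h : StochDom P n (fun k ω => opNorm (ckGram (Y k ω) - ckGram (Y' k ω)))
      (fun k => (n k : ℝ) ^ (-(1 / 4) : ℝ))) : SpectraMatch P N n Y Y' := by
  have hB : ∀ k, 0 ≤ (n k : ℝ) ^ (-(1 / 4) : ℝ) := fun k => by positivity
  refine ⟨h.of_le_mul hn hB one_pos (Eventually.of_forall fun k ω => ?_), ?_⟩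
  · rw [one_mul]
    exact Real.iSup_le (fun i => abs_gramEig_sub_le _ _ i) (opNorm_nonneg _)
  intro δ hδ a b E hE
  have hproj : ∀ k, ∀ ω ∈ E k, opNorm (gramProj (Y k ω) (Set.Icc (a k) (b k))
      - gramProj (Y' k ω) (Set.Icc (a k) (b k)))
        ≤ 2 / δ * opNorm (ckGram (Y k ω) - ckGram (Y' k ω)) := by
    intro k ω hω
    rw [hE k] at hω
    refine (opNorm_gramProj_sub_le _ _ hδ hω).trans (le_of_eq (by ring))
  refine ⟨fun D hD => ?_, StochDomOn.of_le_mul hn hB h (C := 2 / δ) (by positivity)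
    (Eventually.of_forall hproj), fun x hx => StochDomOn.of_le_mul hn hB h (C := 2 / δ)
    (by positivity) (Eventually.of_forall fun k ω hω => ?_)⟩
  -- With ε = 1/8 the Gram matrices differ by less than n^{1/8 - 1/4} = n^{-1/8} off a set of
  -- probability n^{-D}, and eventually this is at most δ.
  · filter_upwards [h (1 / 8) (by norm_num) D hD, hn.eventually_ge_atTop 1,
      eventually_le_rpow hn (show (0 : ℝ) < 1 / 8 by norm_num) (1 / δ)] with k h1 h2 h3
    have h0 : (0 : ℝ) < n k := by exact_mod_cast h2
    refine le_trans (measureReal_mono fun ω hω => ?_) h1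
    refine ⟨Set.mem_univ ω, ?_⟩
    by_contra! hcon
    refine hω.2 (gramCount_eq_of_lt _ _ (δ := δ) (by have := hω.1; rwa [hE k] at this)
      (hcon.trans_le ?_))
    rw [← Real.rpow_add h0, show (1 / 8 : ℝ) + -(1 / 4) = -(1 / 8) by norm_num,
      Real.rpow_neg h0.le]
    rw [one_div] at h3
    exact inv_le_of_inv_le₀ hδ h3
  · refine le_trans ?_ (hproj k ω hω)
    rw [← dotProduct_sub, ← Matrix.sub_mulVec]
    refine (abs_dotProduct_mulVec_le _ _ _).trans ?_
    have h1 := hx k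
    rw [dotProduct_eq_norm_sq] at h1
    rw [← sq]
    exact mul_le_of_le_one_right (opNorm_nonneg _) h1

end Spectra

/-! ### Conclusion: the quadratic equivalent and the matching of spectra -/

theorem mainTheorem5 {Ω : Type*} [MeasurableSpace Ω] (P : Measure Ω) [IsProbabilityMeasure P]
    (σ : ℝ → ℝ) (L : ℝ) (hσ : ActivationAssumption σ L)
    (n d N : ℕ → ℕ) (φ ψ : ℝ) (hlim : ProportionalLimit n d N φ ψ)
    (hn : ∀ k, 4 ∣ n k) (hd : ∀ k, 2 ∣ d k)
    (r : ℕ → ℝ) (hr0 : ∀ k, 0 ≤ r k)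
    (hr : r =O[atTop] fun k => (n k : ℝ) ^ (1 / 4 : ℝ))
    (W : (k : ℕ) → Ω → Matrix (Fin (N k)) (Fin (d k)) ℝ)
    (Z : (k : ℕ) → Ω → Matrix (Fin (d k)) (Fin (n k)) ℝ)
    (hWZ : ∀ k, IsGaussianPair P (W k) (Z k))
    (Y YQE : (k : ℕ) → Ω → Matrix (Fin (N k)) (Fin (n k)) ℝ)
    (hY : ∀ k ω, Y k ω = xorFeature σ (r k) (W k ω) (Z k ω))
    (hYQE : ∀ k ω, YQE k ω = qeFeature σ (r k) (W k ω) (Z k ω)) :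
    StochDom P n (fun k ω => opNorm (Y k ω - YQE k ω)) (fun k => (n k : ℝ) ^ (-(1 / 4) : ℝ)) ∧
    TendstoInMeasure P (fun k ω => opNorm (Y k ω - YQE k ω)) atTop (fun _ => (0 : ℝ)) ∧
    ((BoundedInProb P (fun k ω => opNorm (Y k ω)) ∧
          BoundedInProb P (fun k ω => opNorm (YQE k ω))) ∨
        (StochDom P n (fun k ω => opNorm (Y k ω)) (fun _ => 1) ∧
          StochDom P n (fun k ω => opNorm (YQE k ω)) (fun _ => 1)) →
      StochDom P n (fun k ω => opNorm (ckGram (Y k ω) - ckGram (YQE k ω)))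
        (fun k => (n k : ℝ) ^ (-(1 / 4) : ℝ)) ∧
      SpectraMatch P N n Y YQE) := by
  have hn' := hlim.n_top
  have hY' : Y = fun k ω => xorFeature σ (r k) (W k ω) (Z k ω) := funext fun k => funext (hY k)
  have hYQE' : YQE = fun k ω => qeFeature σ (r k) (W k ω) (Z k ω) :=
    funext fun k => funext (hYQE k)
  have h1 : StochDom P n (fun k ω => opNorm (Y k ω - YQE k ω))
      (fun k => (n k : ℝ) ^ (-(1 / 4) : ℝ)) := by
    rw [hY', hYQE']
    exact stochDom_xorFeature_sub_qeFeature hσ hlim hr0 hr hWZ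
  refine ⟨h1, h1.tendstoInMeasure hn' (fun k ω => opNorm_nonneg _) (by norm_num), fun hb => ?_⟩
  have h2 : StochDom P n (fun k ω => opNorm (YQE k ω)) (fun _ => 1) := by
    rcases hb with hb | hb
    · rw [hYQE'] at hb ⊢
      exact stochDom_qeFeature_of_boundedInProb hσ hlim hn hr0 hr hWZ hb.2
    · exact hb.2
  -- Under either reading of boundedness, Y inherits the bound ≺ 1 from Y_QE through the triangle
  -- inequality and part (i).
  have h3 : StochDom P n (fun k ω => opNorm (Y k ω)) (fun _ => 1) := by
    have h4 : StochDom P n (fun k ω => opNorm (Y k ω - YQE k ω)) (fun _ => 1) :=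
      h1.mono_right (by
        filter_upwards [hn'.eventually_ge_atTop 1] with k hk
        exact (rpow_neg_quarter_facts (by exact_mod_cast hk)).2.1)
    refine (h4.add hn' (fun _ => zero_le_one) h2).of_le_mul hn' (fun _ => zero_le_one) one_pos
      (Eventually.of_forall fun k ω => ?_)
    rw [one_mul]
    have := opNorm_add_le (Y k ω - YQE k ω) (YQE k ω)
    rwa [sub_add_cancel] at this
  have h5 := stochDom_ckGram_sub hn' h3 h2 h1
  exact ⟨h5, spectraMatch_of_stochDom hn' h5⟩
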